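/- Let $\sigma_1,\sigma_2,\sigma_3$ be the Pauli matrices and $m\ge 0$. Let $\gamma:\mathbb R\to\mathbb R^2$ be an injective $C^3$ arc-length parametrization of a curve $\Gamma$, let $\nu(s)$ be the unit normal such that $(\gamma'(s),\nu(s))$ is a positive orthonormal basis, and let $\kappa$ be the curvature, $\gamma''=\kappa\nu$. Assume that $\kappa(s)\to0$ as $s\to\pm\infty$, that $\kappa'\in L^\infty(\mathbb R)$, and that for all sufficiently small $\varepsilon>0$ one has $0<\varepsilon<(2\|\kappa\|_{L^\infty})^{-1}$ (with the right-hand side equal to $+\infty$ if $\kappa\equiv 0$) and the map $(s,t)\mapsto\gamma(s)+\varepsilon t\,\nu(s)$ is injective on the strip $\mathrm{Str}:=\mathbb R\times(-1,1)$. For such $\varepsilon$ let $\mathcal E_\Gamma(\varepsilon,m)$ be the operator in $L^2(\mathrm{Str},\mathbb C^2)$ $$\mathcal E_\Gamma(\varepsilon,m)=\frac{1}{1-\varepsilon t\kappa}(-i\sigma_1)\partial_s+\frac1\varepsilon(-i\sigma_2)\partial_t+\frac{\varepsilon t\kappa'}{2(1-\varepsilon t\kappa)^2}(-i\sigma_1)+m\sigma_3$$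 with domain $\{u=(u_1,u_2)^\top\in H^1(\mathrm{Str},\mathbb C^2): u_2(\cdot,\pm1)=\mp u_1(\cdot,\pm1)\}$. Let $\mathcal T_0=-i\sigma_2\frac{d}{dt}$ be the transverse Dirac operator in $L^2((-1,1),\mathbb C^2)$ with domain $\{u\in H^1((-1,1),\mathbb C^2):u_2(\pm1)=\mp u_1(\pm1)\}$ (it is self-adjoint with compact resolvent), let $p^\pm=\mathbf 1_{\{\pm x>0\}}(\mathcal T_0)$ be the projectors on its positive and negative spectral subspaces, and let $P^\pm=1\otimes p^\pm$ be the orthogonal projectors in $L^2(\mathrm{Str},\mathbb C^2)$ obtained by letting $p^\pm$ act in the variable $t$. Finally let $\mathcal D_{1D}(\mu)=-i\sigma_1\partial_s+\mu\sigma_3$ in $L^2(\mathbb R,\mathbb C^2)$ with domain $H^1(\mathbb R,\mathbb C^2)$. Then there exist a closed subspace $F\subset L^2(\mathrm{Str},\mathbb C^2)$ and a unitary map $V:L^2(\mathrm{Str},\mathbb C^2)\to L^2(\mathbb R,\mathbb C^2)\oplus F$, both independent of $\varepsilon$, such that $i$ belongs to the resolvent set of $\mathcal D_{1D}(\tfrac{2}{\pi}m)$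 and, for all sufficiently small $\varepsilon>0$, to that of $\mathcal E_\Gamma(\varepsilon,m)-\frac{\pi}{4\varepsilon}(P^+-P^-)$, and, as $\varepsilon\to0$, $$V\Big(\mathcal E_\Gamma(\varepsilon,m)-\frac{\pi}{4\varepsilon}(P^+-P^-)-i\Big)^{-1}V^{-1}=\big(\mathcal D_{1D}(\tfrac{2}{\pi}m)-i\big)^{-1}\oplus0+\mathcal O(\varepsilon)$$ in operator norm. -/

import Mathlib

open MeasureTheory Set Filter Topology
open scoped ContDiff

noncomputable section

namespace ThinGuide

/-! ### Spinors, Pauli matrices, Hilbert spaces -/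

/-- `ℂ²` with its Hermitian norm. -/
abbrev Spinor : Type := EuclideanSpace ℂ (Fin 2)

/-- The Pauli matrix `σ₁`. -/
def σ₁ : Matrix (Fin 2) (Fin 2) ℂ := !![0, 1; 1, 0]

/-- The Pauli matrix `σ₂`. -/
def σ₂ : Matrix (Fin 2) (Fin 2) ℂ := !![0, -Complex.I; Complex.I, 0]

/-- The Pauli matrix `σ₃`. -/
def σ₃ : Matrix (Fin 2) (Fin 2) ℂ := !![1, 0; 0, -1]

/-- A `2 × 2` matrix acting on spinors. -/
abbrev act (A : Matrix (Fin 2) (Fin 2) ℂ) : Spinor →L[ℂ] Spinor :=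
  Matrix.toEuclideanCLM (𝕜 := ℂ) A

/-- The strip `ℝ × (-1, 1)`, with points `p = (s, t)`. -/
def strip : Set (ℝ × ℝ) := univ ×ˢ Ioo (-1) 1

/-- `L²(ℝ, ℂ²)`. -/
abbrev L2Line : Type := Lp Spinor 2 (volume : Measure ℝ)

/-- `L²((-1, 1), ℂ²)`. -/
abbrev L2Cross : Type := Lp Spinor 2 (volume.restrict (Ioo (-1 : ℝ) 1))

/-- `L²(ℝ × (-1, 1), ℂ²)`. -/
abbrev L2Strip : Type := Lp Spinor 2 ((volume : Measure (ℝ × ℝ)).restrict strip)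

/-! ### Weak derivatives and traces -/

/-- `v` is the weak derivative of `u` in the direction `e` on the open set `Ω`. -/
def IsWeakDeriv {X : Type*} [NormedAddCommGroup X] [NormedSpace ℝ X] [MeasureSpace X]
    (Ω : Set X) (e : X) (u v : X → Spinor) : Prop :=
  ∀ φ : X → ℝ, ContDiff ℝ ∞ φ → HasCompactSupport φ → tsupport φ ⊆ Ω →
    ∫ x in Ω, (fderiv ℝ φ x e) • u x = - ∫ x in Ω, φ x • v x

/-- `a` and `b` are the boundary values at `-1` and `1` of the function `u` on `(-1, 1)` with
weak derivative `v` (characterised by integration by parts against test functions that need not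
vanish at the end points). -/
def HasBoundaryValues (u v : ℝ → Spinor) (a b : Spinor) : Prop :=
  ∀ φ : ℝ → ℝ, ContDiff ℝ ∞ φ → HasCompactSupport φ →
    ∫ t in Ioo (-1 : ℝ) 1, φ t • v t
      = φ 1 • b - φ (-1) • a - ∫ t in Ioo (-1 : ℝ) 1, (deriv φ t) • u t

/-- `a` and `b` are the traces on the lines `t = -1` and `t = 1` of the function `u` on the strip
with weak derivative `v = ∂ₜ u` (characterised by Green's formula against test functions that need
not vanish on the boundary). -/
def HasTraces (u v : ℝ × ℝ → Spinor) (a b : ℝ → Spinor) : Prop :=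
  ∀ φ : ℝ × ℝ → ℝ, ContDiff ℝ ∞ φ → HasCompactSupport φ →
    ∫ p in strip, φ p • v p
      = (∫ s, φ (s, 1) • b s) - (∫ s, φ (s, -1) • a s)
        - ∫ p in strip, (fderiv ℝ φ p (0, 1)) • u p

/-! ### Auxiliary facts: pairing with test functions is linear, weak derivatives are unique -/

section aux

variable {X : Type*} [NormedAddCommGroup X] [NormedSpace ℝ X] [MeasurableSpace X] [BorelSpace X]
  {μ : Measure X} [IsFiniteMeasureOnCompacts μ]

theorem integrable_pairing {g : X → ℝ} (hg : Continuous g) (hc : HasCompactSupport g)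
    (u : Lp Spinor 2 μ) : Integrable (fun x => g x • u x) μ :=
  memLp_one_iff_integrable.1
    ((Lp.memLp u).smul (p := 2) (r := 1) (hg.memLp_of_hasCompactSupport hc))

theorem pairing_add {g : X → ℝ} (hg : Continuous g) (hc : HasCompactSupport g)
    (u v : Lp Spinor 2 μ) :
    ∫ x, g x • (u + v : Lp Spinor 2 μ) x ∂μ = ∫ x, g x • u x ∂μ + ∫ x, g x • v x ∂μ := by
  rw [← integral_add (integrable_pairing hg hc u) (integrable_pairing hg hc v)]
  refine integral_congr_ae ?_
  filter_upwards [Lp.coeFn_add u v] with x hx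
  rw [hx, Pi.add_apply, smul_add]

theorem pairing_smul {X : Type*} [MeasurableSpace X] {μ : Measure X} (g : X → ℝ) (c : ℂ) (u : Lp Spinor 2 μ) :
    ∫ x, g x • (c • u : Lp Spinor 2 μ) x ∂μ = c • ∫ x, g x • u x ∂μ := by
  rw [← integral_smul]
  refine integral_congr_ae ?_
  filter_upwards [Lp.coeFn_smul c u] with x hx
  rw [hx, Pi.smul_apply, smul_comm]

theorem pairing_zero {X : Type*} [MeasurableSpace X] {μ : Measure X} (g : X → ℝ) : ∫ x, g x • (0 : Lp Spinor 2 μ) x ∂μ = 0 := by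
  have := pairing_smul g 0 (0 : Lp Spinor 2 μ)
  rwa [zero_smul, zero_smul] at this

end aux

theorem continuous_fderiv_apply {X : Type*} [NormedAddCommGroup X] [NormedSpace ℝ X]
    {φ : X → ℝ} (h : ContDiff ℝ ∞ φ) (e : X) : Continuous fun x => fderiv ℝ φ x e :=
  (h.continuous_fderiv (by simp)).clm_apply continuous_const

theorem hasCompactSupport_fderiv_apply {X : Type*} [NormedAddCommGroup X] [NormedSpace ℝ X]
    {φ : X → ℝ} (h : HasCompactSupport φ) (e : X) :
    HasCompactSupport fun x => fderiv ℝ φ x e :=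
  (h.fderiv (𝕜 := ℝ)).comp_left (g := fun L : X →L[ℝ] ℝ => L e) rfl

section weak

variable {X : Type*} [NormedAddCommGroup X] [NormedSpace ℝ X] [MeasureSpace X] [BorelSpace X]
  [IsFiniteMeasureOnCompacts (volume : Measure X)] {Ω : Set X} {e : X}

theorem IsWeakDeriv.zero :
    IsWeakDeriv Ω e (0 : Lp Spinor 2 (volume.restrict Ω)) (0 : Lp Spinor 2 (volume.restrict Ω)) := by
  intro φ _ _ _
  rw [pairing_zero, pairing_zero, neg_zero]

theorem IsWeakDeriv.add {u u' v v' : Lp Spinor 2 (volume.restrict Ω)}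
    (h : IsWeakDeriv Ω e u v) (h' : IsWeakDeriv Ω e u' v') :
    IsWeakDeriv Ω e (u + u' : Lp Spinor 2 (volume.restrict Ω))
      (v + v' : Lp Spinor 2 (volume.restrict Ω)) := by
  intro φ h1 h2 h3
  rw [pairing_add (continuous_fderiv_apply h1 e) (hasCompactSupport_fderiv_apply h2 e),
    pairing_add h1.continuous h2, h φ h1 h2 h3, h' φ h1 h2 h3, neg_add]

theorem IsWeakDeriv.smul (c : ℂ) {u v : Lp Spinor 2 (volume.restrict Ω)}
    (h : IsWeakDeriv Ω e u v) :
    IsWeakDeriv Ω e (c • u : Lp Spinor 2 (volume.restrict Ω))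
      (c • v : Lp Spinor 2 (volume.restrict Ω)) := by
  intro φ h1 h2 h3
  rw [pairing_smul, pairing_smul, h φ h1 h2 h3, smul_neg]

theorem IsWeakDeriv.eq_zero [FiniteDimensional ℝ X] (hΩ : IsOpen Ω)
    {v : Lp Spinor 2 (volume.restrict Ω)}
    (h : IsWeakDeriv Ω e (0 : Lp Spinor 2 (volume.restrict Ω)) v) : v = 0 := by
  have hloc : LocallyIntegrableOn v Ω volume :=
    locallyIntegrableOn_of_locallyIntegrable_restrict
      ((Lp.memLp v).locallyIntegrable (by norm_num))
  have := hΩ.ae_eq_zero_of_integral_contDiff_smul_eq_zero hloc (by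
    intro g h1 h2 h3
    have h4 := h g h1 h2 h3
    rw [pairing_zero] at h4
    have h5 : ∫ x, g x • v x = ∫ x in Ω, g x • v x := by
      refine (setIntegral_eq_integral_of_forall_compl_eq_zero fun x hx => ?_).symm
      rw [image_eq_zero_of_notMem_tsupport fun hx' => hx (h3 hx'), zero_smul]
    rw [h5]
    exact neg_eq_zero.mp h4.symm)
  rw [Lp.eq_zero_iff_ae_eq_zero]
  exact (ae_restrict_iff' hΩ.measurableSet).2 this

end weak

theorem isOpen_strip : IsOpen strip := isOpen_univ.prod isOpen_Ioo

theorem continuous_lineSlice {φ : ℝ × ℝ → ℝ} (h : Continuous φ) (t : ℝ) :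
    Continuous fun s : ℝ => φ (s, t) := by fun_prop

theorem hasCompactSupport_lineSlice {φ : ℝ × ℝ → ℝ} (h : HasCompactSupport φ) (t : ℝ) :
    HasCompactSupport fun s : ℝ => φ (s, t) := by
  refine HasCompactSupport.intro (h.isCompact.image continuous_fst) fun s hs => ?_
  exact image_eq_zero_of_notMem_tsupport fun hx => hs ⟨(s, t), hx, rfl⟩

theorem HasTraces.zero : HasTraces (0 : L2Strip) (0 : L2Strip) (0 : L2Line) (0 : L2Line) := by
  intro φ _ _
  simp only [pairing_zero, sub_zero]

theorem HasTraces.add {u u' v v' : L2Strip} {a a' b b' : L2Line}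
    (h : HasTraces u v a b) (h' : HasTraces u' v' a' b') :
    HasTraces (u + u' : L2Strip) (v + v' : L2Strip) (a + a' : L2Line) (b + b' : L2Line) := by
  intro φ h1 h2
  have hs (t : ℝ) := continuous_lineSlice h1.continuous t
  have hc (t : ℝ) := hasCompactSupport_lineSlice h2 t
  rw [pairing_add h1.continuous h2, pairing_add (hs 1) (hc 1), pairing_add (hs (-1)) (hc (-1)),
    pairing_add (continuous_fderiv_apply h1 _) (hasCompactSupport_fderiv_apply h2 _),
    h φ h1 h2, h' φ h1 h2]
  abel

theorem HasTraces.smul (c : ℂ) {u v : L2Strip} {a b : L2Line} (h : HasTraces u v a b) :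
    HasTraces (c • u : L2Strip) (c • v : L2Strip) (c • a : L2Line) (c • b : L2Line) := by
  intro φ h1 h2
  rw [pairing_smul, pairing_smul (fun s => φ (s, 1)), pairing_smul (fun s => φ (s, -1)),
    pairing_smul, h φ h1 h2, smul_sub, smul_sub]

theorem HasBoundaryValues.zero : HasBoundaryValues (0 : L2Cross) (0 : L2Cross) 0 0 := by
  intro φ _ _
  simp only [pairing_zero, sub_zero, smul_zero]

theorem HasBoundaryValues.add {u u' v v' : L2Cross} {a a' b b' : Spinor}
    (h : HasBoundaryValues u v a b) (h' : HasBoundaryValues u' v' a' b') :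
    HasBoundaryValues (u + u' : L2Cross) (v + v' : L2Cross) (a + a') (b + b') := by
  intro φ h1 h2
  rw [pairing_add h1.continuous h2,
    pairing_add (h1.continuous_deriv (by simp)) h2.deriv, h φ h1 h2, h' φ h1 h2,
    smul_add, smul_add]
  abel

theorem HasBoundaryValues.smul (c : ℂ) {u v : L2Cross} {a b : Spinor}
    (h : HasBoundaryValues u v a b) :
    HasBoundaryValues (c • u : L2Cross) (c • v : L2Cross) (c • a) (c • b) := by
  intro φ h1 h2
  rw [pairing_smul, pairing_smul, h φ h1 h2, smul_sub, smul_sub, smul_comm c, smul_comm c]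

/-! ### The Dirac operators -/

/-- `u ∈ H¹(ℝ × (-1, 1), ℂ²)` with `∂ₛ u = us` and `∂ₜ u = ut`, satisfying the boundary condition
`u₂(·, ±1) = ∓ u₁(·, ±1)` in the sense of traces. -/
def IsStripDomain (u us ut : L2Strip) : Prop :=
  IsWeakDeriv strip (1, 0) u us ∧ IsWeakDeriv strip (0, 1) u ut ∧
    ∃ a b : L2Line, HasTraces u ut a b ∧
      (∀ᵐ s, b s 1 = - b s 0) ∧ (∀ᵐ s, a s 1 = a s 0)

/-- The graph of the Dirac operator `E_Γ(ε, m)` in the straightened waveguide, for a base curve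
with curvature `κ`. -/
def guideGraph (κ : ℝ → ℝ) (ε m : ℝ) : Submodule ℂ (L2Strip × L2Strip) where
  carrier := {z | ∃ us ut : L2Strip, IsStripDomain z.1 us ut ∧
    z.2 =ᵐ[volume.restrict strip] fun p =>
      (1 / (1 - ε * p.2 * κ p.1)) • act (-Complex.I • σ₁) (us p)
      + (1 / ε) • act (-Complex.I • σ₂) (ut p)
      + (ε * p.2 * deriv κ p.1 / (2 * (1 - ε * p.2 * κ p.1) ^ 2)) •
          act (-Complex.I • σ₁) (z.1 p)
      + m • act σ₃ (z.1 p)}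
  zero_mem' := by
    refine ⟨0, 0, ⟨.zero, .zero, 0, 0, .zero, ?_, ?_⟩, ?_⟩
    · filter_upwards [Lp.coeFn_zero Spinor 2 (volume : Measure ℝ)] with s hs
      simp only [hs, Pi.zero_apply, PiLp.zero_apply, neg_zero]
    · filter_upwards [Lp.coeFn_zero Spinor 2 (volume : Measure ℝ)] with s hs
      simp only [hs, Pi.zero_apply, PiLp.zero_apply]
    · filter_upwards [Lp.coeFn_zero Spinor 2 ((volume : Measure (ℝ × ℝ)).restrict strip)] with p hp
      simp only [hp, Prod.fst_zero, Prod.snd_zero, Pi.zero_apply, map_zero, smul_zero, add_zero]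
  add_mem' := by
    rintro ⟨u, w⟩ ⟨u', w'⟩ ⟨us, ut, ⟨h1, h2, a, b, h3, h4, h5⟩, h⟩
      ⟨us', ut', ⟨h1', h2', a', b', h3', h4', h5'⟩, h'⟩
    refine ⟨us + us', ut + ut', ⟨h1.add h1', h2.add h2', a + a', b + b', h3.add h3', ?_, ?_⟩, ?_⟩
    · filter_upwards [Lp.coeFn_add b b', h4, h4'] with s hs k k'
      simp only [hs, Pi.add_apply, PiLp.add_apply, k, k']
      ring
    · filter_upwards [Lp.coeFn_add a a', h5, h5'] with s hs k k'
      simp only [hs, Pi.add_apply, PiLp.add_apply, k, k']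
    · filter_upwards [Lp.coeFn_add u u', Lp.coeFn_add w w', Lp.coeFn_add us us',
        Lp.coeFn_add ut ut', h, h'] with p k1 k2 k3 k4 k k'
      simp only [Prod.mk_add_mk] at *
      simp only [k1, k2, k3, k4, k, k', Pi.add_apply, map_add, smul_add]
      abel
  smul_mem' := by
    rintro c ⟨u, w⟩ ⟨us, ut, ⟨h1, h2, a, b, h3, h4, h5⟩, h⟩
    refine ⟨c • us, c • ut, ⟨h1.smul c, h2.smul c, c • a, c • b, h3.smul c, ?_, ?_⟩, ?_⟩
    · filter_upwards [Lp.coeFn_smul c b, h4] with s hs k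
      simp only [hs, Pi.smul_apply, PiLp.smul_apply, k, smul_neg]
    · filter_upwards [Lp.coeFn_smul c a, h5] with s hs k
      simp only [hs, Pi.smul_apply, PiLp.smul_apply, k]
    · filter_upwards [Lp.coeFn_smul c u, Lp.coeFn_smul c w, Lp.coeFn_smul c us,
        Lp.coeFn_smul c ut, h] with p k1 k2 k3 k4 k
      simp only [Prod.smul_mk] at *
      simp only [k1, k2, k3, k4, k, Pi.smul_apply, map_smul, smul_add, smul_comm c]

theorem guideGraph_single (κ : ℝ → ℝ) (ε m : ℝ) (z : L2Strip × L2Strip)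
    (hz : z ∈ guideGraph κ ε m) (h0 : z.1 = 0) : z.2 = 0 := by
  obtain ⟨u, w⟩ := z
  obtain ⟨us, ut, ⟨h1, h2, -⟩, h⟩ := hz
  simp only at h0
  subst h0
  obtain rfl := h1.eq_zero isOpen_strip
  obtain rfl := h2.eq_zero isOpen_strip
  rw [Lp.eq_zero_iff_ae_eq_zero]
  filter_upwards [h, Lp.coeFn_zero Spinor 2 ((volume : Measure (ℝ × ℝ)).restrict strip)]
    with p hp hp0
  simp only [hp, hp0, Pi.zero_apply, map_zero, smul_zero, add_zero]

/-- The operator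
`E_Γ(ε, m) = (1 - ε t κ)⁻¹ (-i σ₁) ∂ₛ + ε⁻¹ (-i σ₂) ∂ₜ + ε t κ' / (2 (1 - ε t κ)²) (-i σ₁) + m σ₃`
in `L²(ℝ × (-1, 1), ℂ²)`, on `H¹` spinors with `u₂(·, ±1) = ∓ u₁(·, ±1)`. -/
def guideDirac (κ : ℝ → ℝ) (ε m : ℝ) : L2Strip →ₗ.[ℂ] L2Strip :=
  (guideGraph κ ε m).toLinearPMap

/-- The graph of the free Dirac operator on the line. -/
def lineGraph (m : ℝ) : Submodule ℂ (L2Line × L2Line) where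
  carrier := {z | ∃ us : L2Line, IsWeakDeriv univ (1 : ℝ) z.1 us ∧
    z.2 =ᵐ[volume] fun s => act (-Complex.I • σ₁) (us s) + m • act σ₃ (z.1 s)}
  zero_mem' := by
    refine ⟨0, ?_, ?_⟩
    · intro φ _ _ _
      simp only [Measure.restrict_univ, Prod.fst_zero, pairing_zero, neg_zero]
    · filter_upwards [Lp.coeFn_zero Spinor 2 (volume : Measure ℝ)] with p hp
      simp only [hp, Prod.fst_zero, Prod.snd_zero, Pi.zero_apply, map_zero, smul_zero, add_zero]
  add_mem' := by
    rintro ⟨u, w⟩ ⟨u', w'⟩ ⟨us, h1, h⟩ ⟨us', h1', h'⟩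
    refine ⟨us + us', ?_, ?_⟩
    · intro φ k1 k2 k3
      have e1 := h1 φ k1 k2 k3
      have e2 := h1' φ k1 k2 k3
      simp only [Measure.restrict_univ, Prod.mk_add_mk] at *
      rw [pairing_add (continuous_fderiv_apply k1 _) (hasCompactSupport_fderiv_apply k2 _),
        pairing_add k1.continuous k2, e1, e2, neg_add]
    · filter_upwards [Lp.coeFn_add u u', Lp.coeFn_add w w', Lp.coeFn_add us us', h, h']
        with p k1 k2 k3 k k'
      simp only [Prod.mk_add_mk] at *
      simp only [k1, k2, k3, k, k', Pi.add_apply, map_add, smul_add]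
      abel
  smul_mem' := by
    rintro c ⟨u, w⟩ ⟨us, h1, h⟩
    refine ⟨c • us, ?_, ?_⟩
    · intro φ k1 k2 k3
      have e1 := h1 φ k1 k2 k3
      simp only [Measure.restrict_univ, Prod.smul_mk] at *
      rw [pairing_smul, pairing_smul, e1, smul_neg]
    · filter_upwards [Lp.coeFn_smul c u, Lp.coeFn_smul c w, Lp.coeFn_smul c us, h]
        with p k1 k2 k3 k
      simp only [Prod.smul_mk] at *
      simp only [k1, k2, k3, k, Pi.smul_apply, map_smul, smul_add, smul_comm c]

theorem lineGraph_single (m : ℝ) (z : L2Line × L2Line)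
    (hz : z ∈ lineGraph m) (h0 : z.1 = 0) : z.2 = 0 := by
  obtain ⟨u, w⟩ := z
  obtain ⟨us, h1, h⟩ := hz
  simp only at h0
  subst h0
  have hus : us =ᵐ[volume] 0 :=
    ae_eq_zero_of_integral_contDiff_smul_eq_zero
      ((Lp.memLp us).locallyIntegrable (by norm_num)) (by
        intro g k1 k2
        have k3 := h1 g k1 k2 (subset_univ _)
        simp only [Measure.restrict_univ] at k3
        rw [pairing_zero] at k3
        exact neg_eq_zero.mp k3.symm)
  rw [Lp.eq_zero_iff_ae_eq_zero]
  filter_upwards [h, hus, Lp.coeFn_zero Spinor 2 (volume : Measure ℝ)] with p hp hp1 hp0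
  simp only [hp, hp0, hp1, Pi.zero_apply, map_zero, smul_zero, add_zero]

/-- The free one-dimensional Dirac operator `-i σ₁ ∂ₛ + m σ₃` in `L²(ℝ, ℂ²)`, on `H¹(ℝ, ℂ²)`. -/
def lineDirac (m : ℝ) : L2Line →ₗ.[ℂ] L2Line :=
  (lineGraph m).toLinearPMap

/-- The graph of the transverse Dirac operator. -/
def crossGraph : Submodule ℂ (L2Cross × L2Cross) where
  carrier := {z | ∃ ut : L2Cross, IsWeakDeriv (Ioo (-1 : ℝ) 1) (1 : ℝ) z.1 ut ∧
    (∃ a b : Spinor, HasBoundaryValues z.1 ut a b ∧ b 1 = - b 0 ∧ a 1 = a 0) ∧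
    z.2 =ᵐ[volume.restrict (Ioo (-1 : ℝ) 1)] fun t => act (-Complex.I • σ₂) (ut t)}
  zero_mem' := by
    refine ⟨0, .zero, ⟨0, 0, .zero, by simp, by simp⟩, ?_⟩
    filter_upwards [Lp.coeFn_zero Spinor 2 (volume.restrict (Ioo (-1 : ℝ) 1))] with p hp
    simp only [hp, Prod.snd_zero, Pi.zero_apply, map_zero]
  add_mem' := by
    rintro ⟨u, w⟩ ⟨u', w'⟩ ⟨ut, h1, ⟨a, b, h2, h3, h4⟩, h⟩ ⟨ut', h1', ⟨a', b', h2', h3', h4'⟩, h'⟩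
    refine ⟨ut + ut', h1.add h1', ⟨a + a', b + b', h2.add h2', ?_, ?_⟩, ?_⟩
    · simp only [PiLp.add_apply, h3, h3']
      ring
    · simp only [PiLp.add_apply, h4, h4']
    · filter_upwards [Lp.coeFn_add w w', Lp.coeFn_add ut ut', h, h'] with p k2 k3 k k'
      simp only [Prod.mk_add_mk] at *
      simp only [k2, k3, k, k', Pi.add_apply, map_add]
  smul_mem' := by
    rintro c ⟨u, w⟩ ⟨ut, h1, ⟨a, b, h2, h3, h4⟩, h⟩
    refine ⟨c • ut, h1.smul c, ⟨c • a, c • b, h2.smul c, ?_, ?_⟩, ?_⟩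
    · simp only [PiLp.smul_apply, h3, smul_neg]
    · simp only [PiLp.smul_apply, h4]
    · filter_upwards [Lp.coeFn_smul c w, Lp.coeFn_smul c ut, h] with p k2 k3 k
      simp only [Prod.smul_mk] at *
      simp only [k2, k3, k, Pi.smul_apply, map_smul]

theorem crossGraph_single (z : L2Cross × L2Cross)
    (hz : z ∈ crossGraph) (h0 : z.1 = 0) : z.2 = 0 := by
  obtain ⟨u, w⟩ := z
  obtain ⟨ut, h1, -, h⟩ := hz
  simp only at h0
  subst h0
  obtain rfl := h1.eq_zero isOpen_Ioo
  rw [Lp.eq_zero_iff_ae_eq_zero]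
  filter_upwards [h, Lp.coeFn_zero Spinor 2 (volume.restrict (Ioo (-1 : ℝ) 1))] with p hp hp0
  simp only [hp, hp0, Pi.zero_apply, map_zero]

/-- The transverse Dirac operator `T₀ = -i σ₂ d/dt` in `L²((-1, 1), ℂ²)`, on `H¹` spinors with
`u₂(±1) = ∓ u₁(±1)`. It is self-adjoint with compact resolvent. -/
def crossDirac : L2Cross →ₗ.[ℂ] L2Cross :=
  crossGraph.toLinearPMap

/-! ### The spectral projectors of the transverse operator -/

/-- The spectral subspace of `T₀` (which has purely discrete spectrum) for the set `Λ ⊆ ℝ`: the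
closed span of the eigenvectors with eigenvalue in `Λ`. -/
def crossSpectralSubspace (Λ : Set ℝ) : Submodule ℂ L2Cross :=
  (Submodule.span ℂ
    {x | ∃ l ∈ Λ, ∃ h : x ∈ crossDirac.domain, crossDirac ⟨x, h⟩ = (l : ℂ) • x}).topologicalClosure

/-- `L²(ℝ) ⊗ E` inside `L²(ℝ × (-1, 1), ℂ²)`, where `E` is the spectral subspace of `T₀` for `Λ`:
the closed span of the products `f(s) x(t)` with `f ∈ L²(ℝ)` and `x ∈ E`. -/
def stripSpectralSubspace (Λ : Set ℝ) : Submodule ℂ L2Strip :=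
  (Submodule.span ℂ
    {u : L2Strip | ∃ f : Lp ℂ 2 (volume : Measure ℝ), ∃ x ∈ crossSpectralSubspace Λ,
      u =ᵐ[volume.restrict strip] fun p => f p.1 • x p.2}).topologicalClosure

instance (Λ : Set ℝ) : CompleteSpace (stripSpectralSubspace Λ) :=
  (Submodule.isClosed_topologicalClosure
    (Submodule.span ℂ _)).completeSpace_coe

/-- The spectral projector of `T₀` for `Λ`, acting in the transverse variable: the orthogonal
projector `1 ⊗ 1_Λ(T₀)` of `L²(ℝ × (-1, 1), ℂ²) = L²(ℝ) ⊗ L²((-1, 1), ℂ²)`. -/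
def stripProjector (Λ : Set ℝ) : L2Strip →L[ℂ] L2Strip :=
  (stripSpectralSubspace Λ).starProjection

/-- The projector `P⁺`. -/
def Pplus : L2Strip →L[ℂ] L2Strip := stripProjector (Ioi 0)

/-- The projector `P⁻`. -/
def Pminus : L2Strip →L[ℂ] L2Strip := stripProjector (Iio 0)

/-- The renormalised operator `E_Γ(ε, m) - π / (4 ε) (P⁺ - P⁻)`, with the domain of `E_Γ(ε, m)`. -/
def renormalizedDirac (κ : ℝ → ℝ) (ε m : ℝ) : L2Strip →ₗ.[ℂ] L2Strip :=
  (-(((Real.pi / (4 * ε) : ℝ) : ℂ) • (Pplus - Pminus)) : L2Strip →L[ℂ] L2Strip).toLinearMap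
    +ᵥ guideDirac κ ε m

/-! ### Resolvents, direct sums -/

/-- `z` is in the resolvent set of the operator `A` and `R = (A - z)⁻¹`. -/
def IsResolvent {H : Type*} [NormedAddCommGroup H] [NormedSpace ℂ H]
    (A : H →ₗ.[ℂ] H) (z : ℂ) (R : H →L[ℂ] H) : Prop :=
  (∀ f : H, ∃ h : R f ∈ A.domain, A ⟨R f, h⟩ - z • R f = f) ∧
    ∀ u : A.domain, R (A u - z • (u : H)) = u

/-- The bounded operator `R ⊕ 0` on the Hilbert direct sum `L²(ℝ, ℂ²) ⊕ F`. -/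
def sumZero (F : Submodule ℂ L2Strip) (R : L2Line →L[ℂ] L2Line) :
    WithLp 2 (L2Line × F) →L[ℂ] WithLp 2 (L2Line × F) :=
  (WithLp.prodContinuousLinearEquiv 2 ℂ L2Line F).symm.toContinuousLinearMap ∘L
    (R.prodMap (0 : F →L[ℂ] F)) ∘L
      (WithLp.prodContinuousLinearEquiv 2 ℂ L2Line F).toContinuousLinearMap

/-- The conjugation `V T V⁻¹` of a bounded operator by a unitary map. -/
def conjugate {H K : Type*} [NormedAddCommGroup H] [NormedSpace ℂ H]
    [NormedAddCommGroup K] [NormedSpace ℂ K] (V : H ≃ₗᵢ[ℂ] K) (T : H →L[ℂ] H) : K →L[ℂ] K :=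
  V.toContinuousLinearEquiv.toContinuousLinearMap ∘L T ∘L
    V.symm.toContinuousLinearEquiv.toContinuousLinearMap

/-! ### The base curve -/

/-- The normal `ν` of a unit speed curve: `(γ', ν)` is a positive orthonormal basis. -/
def normal (γ : ℝ → EuclideanSpace ℝ (Fin 2)) (s : ℝ) : EuclideanSpace ℝ (Fin 2) :=
  !₂[-(deriv γ s 1), deriv γ s 0]

/-- The signed curvature of a unit speed curve, that is, the coefficient in `γ'' = κ ν`. -/
def curvature (γ : ℝ → EuclideanSpace ℝ (Fin 2)) (s : ℝ) : ℝ :=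
  inner ℝ (normal γ s) (deriv (deriv γ) s)

/-- The map `Φ_ε(s, t) = γ(s) + ε t ν(s)`. -/
def tubeMap (γ : ℝ → EuclideanSpace ℝ (Fin 2)) (ε : ℝ) (p : ℝ × ℝ) : EuclideanSpace ℝ (Fin 2) :=
  γ p.1 + (ε * p.2) • normal γ p.1

/-- The standing assumptions on the base curve: an injective `C³` unit speed parametrisation,
curvature that vanishes at infinity and has a bounded derivative. -/
structure IsBaseCurve (γ : ℝ → EuclideanSpace ℝ (Fin 2)) : Prop where
  contDiff : ContDiff ℝ 3 γ
  unit_speed : ∀ s, ‖deriv γ s‖ = 1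
  injective : Function.Injective γ
  curvature_atTop : Tendsto (curvature γ) atTop (𝓝 0)
  curvature_atBot : Tendsto (curvature γ) atBot (𝓝 0)
  deriv_curvature : MemLp (deriv (curvature γ)) ⊤ volume

/-- The admissible half-widths: `0 < ε < (2 ‖κ‖_∞)⁻¹`, and `Φ_ε` is injective on the strip. -/
structure IsAdmissibleWidth (γ : ℝ → EuclideanSpace ℝ (Fin 2)) (ε : ℝ) : Prop where
  pos : 0 < ε
  small : ENNReal.ofReal (2 * ε) * eLpNorm (curvature γ) ⊤ volume < 1
  injOn : InjOn (tubeMap γ ε) strip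

/-- The Frenet formula. -/
theorem IsBaseCurve.frenet {γ : ℝ → EuclideanSpace ℝ (Fin 2)} (h : IsBaseCurve γ) (s : ℝ) :
    deriv (deriv γ) s = curvature γ s • normal γ s := by
  have hd : DifferentiableAt ℝ (deriv γ) s :=
    ((contDiff_succ_iff_deriv (n := 2)).1 h.contDiff).2.2.differentiable (by norm_num) s
  have h1 : inner ℝ (deriv γ s) (deriv (deriv γ) s) = 0 := by
    have e : (fun r => inner ℝ (deriv γ r) (deriv γ r)) = fun _ => (1 : ℝ) := by
      funext r
      rw [real_inner_self_eq_norm_sq, h.unit_speed, one_pow]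
    have k := (hd.hasDerivAt.inner ℝ hd.hasDerivAt).deriv
    rw [e, deriv_const, real_inner_comm (deriv γ s)] at k
    linarith [real_inner_comm (deriv γ s) (deriv (deriv γ) s)]
  have h2 : deriv γ s 0 ^ 2 + deriv γ s 1 ^ 2 = 1 := by
    have k := EuclideanSpace.real_norm_sq_eq (deriv γ s)
    rw [h.unit_speed, Fin.sum_univ_two] at k
    linarith
  simp only [PiLp.inner_apply, Fin.sum_univ_two, RCLike.inner_apply, conj_trivial] at h1
  ext i
  fin_cases i <;> simp [curvature, normal, PiLp.inner_apply, Fin.sum_univ_two]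
  · linear_combination (deriv γ s 0) * h1 - (deriv (deriv γ) s 0) * h2
  · linear_combination (deriv γ s 1) * h1 - (deriv (deriv γ) s 1) * h2

/-- For an admissible width the domain of `E_Γ(ε, m)` consists of all `H¹` spinors on the strip
that satisfy the boundary condition. -/
theorem mem_guideDirac_domain {γ : ℝ → EuclideanSpace ℝ (Fin 2)} (h : IsBaseCurve γ) {ε : ℝ}
    (hε : IsAdmissibleWidth γ ε) (m : ℝ) (u : L2Strip) :
    u ∈ (guideDirac (curvature γ) ε m).domain ↔ ∃ us ut : L2Strip, IsStripDomain u us ut := by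
  rw [guideDirac, Submodule.toLinearPMap_domain, Submodule.mem_map]
  constructor
  · rintro ⟨z, ⟨us, ut, hz, -⟩, rfl⟩
    exact ⟨us, ut, hz⟩
  rintro ⟨us, ut, hu⟩
  have hκm : Measurable (curvature γ) := by
    have c2 := ((contDiff_succ_iff_deriv (n := 2)).1 h.contDiff).2.2
    have c1 := ((contDiff_succ_iff_deriv (n := 1)).1 c2).2.2
    have k : curvature γ = fun s =>
        -(deriv γ s 1) * deriv (deriv γ) s 0 + deriv γ s 0 * deriv (deriv γ) s 1 := by
      funext s
      simp [curvature, normal, PiLp.inner_apply, Fin.sum_univ_two]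
      ring
    rw [k]
    have := c2.continuous
    have := c1.continuous
    fun_prop
  have hm := measurable_deriv (curvature γ)
  have hκ : ∀ᵐ p : ℝ × ℝ, ε * |curvature γ p.1| ≤ 1 / 2 := by
    refine Measure.quasiMeasurePreserving_fst.ae (p := fun s => ε * |curvature γ s| ≤ 1 / 2) ?_
    filter_upwards [ae_le_eLpNormEssSup (f := curvature γ) (μ := volume)] with s hs
    have k : ENNReal.ofReal (2 * ε) * ‖curvature γ s‖ₑ < 1 := by
      refine lt_of_le_of_lt ?_ hε.small
      rw [eLpNorm_exponent_top]
      gcongr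
    rw [← ofReal_norm, ← ENNReal.ofReal_mul (by linarith [hε.pos]),
      ENNReal.ofReal_lt_one, Real.norm_eq_abs] at k
    linarith
  obtain ⟨K, hK⟩ : ∃ K : ℝ, ∀ᵐ p : ℝ × ℝ, |deriv (curvature γ) p.1| ≤ K := by
    refine ⟨(eLpNorm (deriv (curvature γ)) ⊤ volume).toReal,
      Measure.quasiMeasurePreserving_fst.ae
        (p := fun s => |deriv (curvature γ) s| ≤ _) ?_⟩
    filter_upwards [ae_le_eLpNormEssSup (f := deriv (curvature γ)) (μ := volume)] with s hs
    rw [eLpNorm_exponent_top, ← Real.norm_eq_abs, ← toReal_enorm]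
    refine ENNReal.toReal_mono ?_ hs
    rw [← eLpNorm_exponent_top]
    exact h.deriv_curvature.2.ne
  have hst : ∀ᵐ p ∂((volume : Measure (ℝ × ℝ)).restrict strip), |p.2| ≤ 1 := by
    filter_upwards [ae_restrict_mem isOpen_strip.measurableSet] with p hp
    exact abs_le.2 ⟨hp.2.1.le, hp.2.2.le⟩
  have hlow : ∀ᵐ p ∂((volume : Measure (ℝ × ℝ)).restrict strip),
      1 / 2 ≤ 1 - ε * p.2 * curvature γ p.1 := by
    filter_upwards [hst, ae_restrict_of_ae hκ] with p h1 h2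
    have : |ε * p.2 * curvature γ p.1| ≤ 1 / 2 := by
      rw [abs_mul, abs_mul, abs_of_pos hε.pos]
      nlinarith [mul_nonneg hε.pos.le (abs_nonneg (curvature γ p.1))]
    linarith [(abs_le.1 this).2]
  have hc1 : MemLp (fun p : ℝ × ℝ => 1 / (1 - ε * p.2 * curvature γ p.1)) ⊤
      (volume.restrict strip) := by
    refine memLp_top_of_bound (Measurable.aestronglyMeasurable (by fun_prop)) 2 ?_
    filter_upwards [hlow] with p hp
    rw [Real.norm_eq_abs, abs_of_pos (by positivity), div_le_iff₀ (by linarith)]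
    linarith
  have hc2 : MemLp (fun p : ℝ × ℝ => ε * p.2 * deriv (curvature γ) p.1 /
      (2 * (1 - ε * p.2 * curvature γ p.1) ^ 2)) ⊤ (volume.restrict strip) := by
    refine memLp_top_of_bound (Measurable.aestronglyMeasurable (by fun_prop)) (2 * (ε * K)) ?_
    filter_upwards [hlow, hst, ae_restrict_of_ae hK] with p h1 h2 h3
    have h4 : |ε * p.2 * deriv (curvature γ) p.1| ≤ ε * K := by
      rw [abs_mul, abs_mul, abs_of_pos hε.pos, mul_assoc]
      refine mul_le_mul_of_nonneg_left ?_ hε.pos.le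
      nlinarith [abs_nonneg (deriv (curvature γ) p.1)]
    have h5 : 1 / 2 ≤ 2 * (1 - ε * p.2 * curvature γ p.1) ^ 2 := by nlinarith
    rw [Real.norm_eq_abs, abs_div, abs_of_pos (show 0 < 2 * (1 - ε * p.2 * curvature γ p.1) ^ 2 by
      linarith), div_le_iff₀ (by linarith)]
    nlinarith [abs_nonneg (ε * p.2 * deriv (curvature γ) p.1)]
  have hL (A : Matrix (Fin 2) (Fin 2) ℂ) (v : L2Strip) :
      MemLp (fun p => act A (v p)) 2 (volume.restrict strip) :=
    (act A).comp_memLp' (Lp.memLp v)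
  have hw := ((((hL (-Complex.I • σ₁) us).smul (r := 2) hc1).add
    ((hL (-Complex.I • σ₂) ut).const_smul (1 / ε))).add
    ((hL (-Complex.I • σ₁) u).smul (r := 2) hc2)).add ((hL σ₃ u).const_smul m)
  exact ⟨(u, hw.toLp _), ⟨us, ut, hu, hw.coeFn_toLp⟩, rfl⟩

end ThinGuide

end

/-! The transverse operator is diagonalised explicitly. For `l = freq j = π/4 + jπ` the fields `(cos
(l t) - sin (l t) σ₁) e` satisfy the boundary conditions because `sin l = cos l`, and `T₀` replaces
`e` by `l σ₃ e`. The eigenvalues of `T₀` are therefore `±freq j`, with smallest modulus `π/4`,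
attained at `j = 0`. Completeness of these modes reduces to Fourier series
(`ae_eq_zero_of_cos_odd`), so `L²` of the strip is a Hilbert sum of copies of `L²(ℝ, ℂ²)`. The modes
commute with `σ₁`, and `P⁺ - P⁻` acts on the `j`-th one as `modeSign j • σ₃`. Hence the straight
massless renormalised operator is the direct sum of the line operators `-iσ₁∂ₛ + (gap j / ε) σ₃`,
where `gap 0 = 0` and `|gap j| ≥ π/2` otherwise (`adjoint_mode_flatShift`).

Since `σ₁` and `σ₃` anticommute, a line operator `D` of mass `M` satisfies `‖(D - iy)u‖² = ‖u'‖² +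
(M² + y²)‖u‖²` (`norm_lineShift_sq`). Summed over the modes, this bounds `u` and `∂ₛu` uniformly in
`ε` and forces the part of `u` orthogonal to the zero mode to be of order `ε`
(`norm_sub_mode_zero_le`).

The remaining terms are perturbations. The compression of `σ₃` to the zero mode is `(2/π) σ₃`,
because `½ ∫ cos (πt/2) = 2/π` over `(-1, 1)`; this is the effective mass, and the coupling of `mσ₃`
to the other modes costs `O(ε)`. The curvature terms are bounded by `O(ε)(‖∂ₛu‖ + ‖u‖)`, so they are
`O(ε)` relative to the straight operator. Consequently the zero-mode coefficient of the solution
solves the line equation with mass `2m/π` up to `O(ε)`, and `V` is the splitting into the zero mode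
and its orthogonal complement `F`.

Existence of the resolvents rests on closed range, trivial orthogonal complement of the range, and
Neumann series. Unbounded operators are handled throughout as bounded operators on closed spaces of
tuples formed by a function and its weak derivatives. -/

noncomputable section

namespace ThinGuide

open scoped InnerProductSpace FourierTransform SchwartzMap

/-! ### Matrices acting on square integrable spinor fields -/

section lift

variable {X : Type*} [MeasurableSpace X] {μ : Measure X}

/-- A constant matrix acting pointwise on spinor fields. -/
def lift (A : Matrix (Fin 2) (Fin 2) ℂ) : Lp Spinor 2 μ →L[ℂ] Lp Spinor 2 μ :=
  (act A).compLpL 2 μ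

theorem coeFn_lift (A : Matrix (Fin 2) (Fin 2) ℂ) (u : Lp Spinor 2 μ) :
    lift A u =ᵐ[μ] fun x => act A (u x) :=
  (act A).coeFn_compLpL u

theorem lift_mul (A B : Matrix (Fin 2) (Fin 2) ℂ) (u : Lp Spinor 2 μ) :
    lift (A * B) u = lift A (lift B u) := by
  refine Lp.ext ?_
  filter_upwards [coeFn_lift (A * B) u, coeFn_lift A (lift B u), coeFn_lift B u] with x h1 h2 h3
  rw [h1, h2, h3, act, map_mul]
  rfl

theorem lift_one (u : Lp Spinor 2 μ) : lift 1 u = u := by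
  refine Lp.ext ?_
  filter_upwards [coeFn_lift 1 u] with x h1
  rw [h1, act, map_one]
  rfl

theorem lift_add (A B : Matrix (Fin 2) (Fin 2) ℂ) (u : Lp Spinor 2 μ) :
    lift (A + B) u = lift A u + lift B u := by
  refine Lp.ext ?_
  filter_upwards [coeFn_lift (A + B) u, coeFn_lift A u, coeFn_lift B u,
    Lp.coeFn_add (lift A u) (lift B u)] with x h1 h2 h3 h4
  rw [h1, h4, Pi.add_apply, h2, h3, act, map_add]
  rfl

theorem lift_smul (c : ℂ) (A : Matrix (Fin 2) (Fin 2) ℂ) (u : Lp Spinor 2 μ) :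
    lift (c • A) u = c • lift A u := by
  refine Lp.ext ?_
  filter_upwards [coeFn_lift (c • A) u, coeFn_lift A u,
    Lp.coeFn_smul c (lift A u)] with x h1 h2 h4
  rw [h1, h4, Pi.smul_apply, h2, act, map_smul]
  rfl

theorem lift_neg (A : Matrix (Fin 2) (Fin 2) ℂ) (u : Lp Spinor 2 μ) :
    lift (-A) u = - lift A u := by
  rw [← neg_one_smul ℂ A, lift_smul, neg_one_smul]

theorem act_inner (A : Matrix (Fin 2) (Fin 2) ℂ) (x y : Spinor) :
    ⟪act A x, y⟫_ℂ = ⟪x, act A.conjTranspose y⟫_ℂ := by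
  rw [act, act, ← Matrix.star_eq_conjTranspose, map_star, ContinuousLinearMap.star_eq_adjoint,
    ContinuousLinearMap.adjoint_inner_right]

theorem lift_inner (A : Matrix (Fin 2) (Fin 2) ℂ) (u v : Lp Spinor 2 μ) :
    ⟪lift A u, v⟫_ℂ = ⟪u, lift A.conjTranspose v⟫_ℂ := by
  rw [L2.inner_def, L2.inner_def]
  refine integral_congr_ae ?_
  filter_upwards [coeFn_lift A u, coeFn_lift A.conjTranspose v] with x h1 h2
  rw [h1, h2, act_inner]

theorem σ₁_herm : σ₁.conjTranspose = σ₁ := by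
  ext i j; fin_cases i <;> fin_cases j <;> simp [σ₁]

theorem σ₃_herm : σ₃.conjTranspose = σ₃ := by
  ext i j; fin_cases i <;> fin_cases j <;> simp [σ₃]

theorem σ₁_sq : σ₁ * σ₁ = 1 := by
  ext i j; fin_cases i <;> fin_cases j <;> simp [σ₁]

theorem σ₃_sq : σ₃ * σ₃ = 1 := by
  ext i j; fin_cases i <;> fin_cases j <;> simp [σ₃]

theorem σ₃_mul_σ₁ : σ₃ * σ₁ = - (σ₁ * σ₃) := by
  ext i j; fin_cases i <;> fin_cases j <;> simp [σ₁, σ₃]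

/-- In this form, computations with `T₀` use only that `σ₁` and `σ₃` are anticommuting involutions.
-/
theorem neg_I_smul_σ₂ : -Complex.I • σ₂ = σ₁ * σ₃ := by
  ext i j; fin_cases i <;> fin_cases j <;> simp [σ₁, σ₂, σ₃]

theorem norm_lift_of_unitary {A : Matrix (Fin 2) (Fin 2) ℂ} (hA : A.conjTranspose * A = 1)
    (u : Lp Spinor 2 μ) : ‖lift A u‖ = ‖u‖ := by
  have h : ⟪lift A u, lift A u⟫_ℂ = ⟪u, u⟫_ℂ := by
    rw [lift_inner, ← lift_mul, hA, lift_one]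
  rw [inner_self_eq_norm_sq_to_K, inner_self_eq_norm_sq_to_K] at h
  have h' : ‖lift A u‖ ^ 2 = ‖u‖ ^ 2 := by exact_mod_cast h
  exact (sq_eq_sq₀ (norm_nonneg _) (norm_nonneg _)).1 h'

theorem norm_lift_σ₁ (u : Lp Spinor 2 μ) : ‖lift σ₁ u‖ = ‖u‖ :=
  norm_lift_of_unitary (by rw [σ₁_herm, σ₁_sq]) u

theorem norm_lift_σ₃ (u : Lp Spinor 2 μ) : ‖lift σ₃ u‖ = ‖u‖ :=
  norm_lift_of_unitary (by rw [σ₃_herm, σ₃_sq]) u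

theorem pairing_lift {X : Type*} [NormedAddCommGroup X] [NormedSpace ℝ X] [MeasurableSpace X]
    [BorelSpace X] {μ : Measure X} [IsFiniteMeasureOnCompacts μ] {g : X → ℝ} (hg : Continuous g)
    (hc : HasCompactSupport g) (A : Matrix (Fin 2) (Fin 2) ℂ) (u : Lp Spinor 2 μ) :
    ∫ x, g x • lift A u x ∂μ = act A (∫ x, g x • u x ∂μ) := by
  rw [← ContinuousLinearMap.integral_comp_comm _ (integrable_pairing hg hc u)]
  refine integral_congr_ae ?_
  filter_upwards [coeFn_lift A u] with x h1
  rw [h1]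
  exact ((act A).map_smul_of_tower (g x) (u x)).symm

end lift

/-! ### Weak derivatives on the line -/

/-- Weak derivative on the line in terms of one-dimensional calculus. -/
theorem isWeakDeriv_line {u v : ℝ → Spinor} : IsWeakDeriv univ (1 : ℝ) u v ↔
    ∀ φ : ℝ → ℝ, ContDiff ℝ ∞ φ → HasCompactSupport φ →
      ∫ s, deriv φ s • u s = - ∫ s, φ s • v s := by
  simp only [IsWeakDeriv, Measure.restrict_univ, subset_univ, forall_true_left,
    fderiv_apply_one_eq_deriv]

/-- `H¹(ℝ, ℂ²)` as a space of pairs `(u, u')`. -/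
def lineH1 : Submodule ℂ (L2Line × L2Line) where
  carrier := {z | IsWeakDeriv univ (1 : ℝ) z.1 z.2}
  zero_mem' := by
    refine isWeakDeriv_line.2 fun φ _ _ => ?_
    simp only [Prod.fst_zero, Prod.snd_zero, pairing_zero, neg_zero]
  add_mem' := by
    intro z z' h h'
    simp only [mem_ofPred_eq, isWeakDeriv_line] at h h' ⊢
    intro φ k1 k2
    rw [Prod.fst_add, Prod.snd_add, pairing_add (k1.continuous_deriv (by simp)) k2.deriv,
      pairing_add k1.continuous k2, h φ k1 k2, h' φ k1 k2, neg_add]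
  smul_mem' := by
    intro c z h
    simp only [mem_ofPred_eq, isWeakDeriv_line] at h ⊢
    intro φ k1 k2
    rw [Prod.smul_fst, Prod.smul_snd, pairing_smul, pairing_smul, h φ k1 k2, smul_neg]

theorem mem_lineH1 {z : L2Line × L2Line} :
    z ∈ lineH1 ↔ ∀ φ : ℝ → ℝ, ContDiff ℝ ∞ φ → HasCompactSupport φ →
      ∫ s, deriv φ s • z.1 s = - ∫ s, φ s • z.2 s := isWeakDeriv_line

theorem lineH1_lift (A : Matrix (Fin 2) (Fin 2) ℂ) {z : L2Line × L2Line} (h : z ∈ lineH1) :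
    (lift A z.1, lift A z.2) ∈ lineH1 := by
  rw [mem_lineH1] at h ⊢
  intro φ k1 k2
  rw [pairing_lift (k1.continuous_deriv (by simp)) k2.deriv, pairing_lift k1.continuous k2,
    h φ k1 k2, map_neg]

theorem norm_pairing_le {X : Type*} [MeasurableSpace X] {μ : Measure X} {g : X → ℝ}
    (hm : MemLp g 2 μ) (u : Lp Spinor 2 μ) :
    ‖∫ x, g x • u x ∂μ‖ ≤ (eLpNorm g 2 μ).toReal * ‖u‖ := by
  have h0 : eLpNorm (g • (u : X → Spinor)) 1 μ ≤ eLpNorm g 2 μ * eLpNorm u 2 μ :=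
    eLpNorm_smul_le_mul_eLpNorm (p := 2) (q := 2) (r := 1) (Lp.aestronglyMeasurable u) hm.1
  have h1 : ‖∫ x, g x • u x ∂μ‖ₑ ≤ eLpNorm g 2 μ * ‖u‖ₑ := by
    rw [Lp.enorm_def]
    refine (enorm_integral_le_lintegral_enorm _).trans (le_trans (le_of_eq ?_) h0)
    rw [eLpNorm_one_eq_lintegral_enorm]
    rfl
  have h2 : eLpNorm g 2 μ * ‖u‖ₑ ≠ ⊤ := ENNReal.mul_ne_top hm.2.ne enorm_ne_top
  have h3 := ENNReal.toReal_mono h2 h1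
  rwa [ENNReal.toReal_mul, toReal_enorm, toReal_enorm] at h3

theorem continuous_pairing {X : Type*} [NormedAddCommGroup X] [NormedSpace ℝ X] [MeasurableSpace X]
    [BorelSpace X] {μ : Measure X} [IsFiniteMeasureOnCompacts μ] {g : X → ℝ} (hg : Continuous g)
    (hc : HasCompactSupport g) : Continuous fun u : Lp Spinor 2 μ => ∫ x, g x • u x ∂μ := by
  let T : Lp Spinor 2 μ →ₗ[ℂ] Spinor :=
    { toFun := fun u => ∫ x, g x • u x ∂μ
      map_add' := pairing_add hg hc
      map_smul' := fun c u => pairing_smul g c u }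
  exact (T.mkContinuous _ (norm_pairing_le (hg.memLp_of_hasCompactSupport hc))).continuous

/-- Each defining equation compares two continuous functions of the pair. Closedness provides the
completeness needed by `surjective_of_boundedBelow` and lets membership pass to limits. -/
theorem isClosed_lineH1 : IsClosed (lineH1 : Set (L2Line × L2Line)) := by
  have : (lineH1 : Set (L2Line × L2Line)) = ⋂ (φ : ℝ → ℝ) (_ : ContDiff ℝ ∞ φ)
      (_ : HasCompactSupport φ),
      {z | ∫ s, deriv φ s • z.1 s = - ∫ s, φ s • z.2 s} := by
    ext z
    simp only [SetLike.mem_coe, mem_lineH1, mem_iInter, mem_ofPred_eq]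
  rw [this]
  refine isClosed_iInter fun φ => isClosed_iInter fun k1 => isClosed_iInter fun k2 => ?_
  exact isClosed_eq ((continuous_pairing (k1.continuous_deriv (by simp)) k2.deriv).comp
    continuous_fst) (((continuous_pairing k1.continuous k2).comp continuous_snd).neg)

/-- A bounded-below operator on a closed subspace whose range has trivial orthogonal complement is
onto. -/
theorem surjective_of_boundedBelow {Z H : Type*} [NormedAddCommGroup Z] [NormedSpace ℂ Z]
    [CompleteSpace Z] [NormedAddCommGroup H] [InnerProductSpace ℂ H] [CompleteSpace H]
    (X : Submodule ℂ Z) (hX : IsClosed (X : Set Z)) (T : Z →L[ℂ] H) {c : ℝ} (hc : 0 < c)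
    (hT : ∀ x ∈ X, ‖x‖ ≤ c * ‖T x‖)
    (hd : ∀ f : H, (∀ x ∈ X, ⟪T x, f⟫_ℂ = 0) → f = 0) (f : H) : ∃ x ∈ X, T x = f := by
  have : CompleteSpace X := hX.completeSpace_coe
  let S : X →L[ℂ] H := T ∘L X.subtypeL
  -- The lower bound makes the restriction antilipschitz, so its range is closed; a closed subspace
  -- with trivial orthogonal complement is the whole space.
  have hS : AntilipschitzWith ⟨c, hc.le⟩ S := by
    refine ContinuousLinearMap.antilipschitz_of_bound (K := ⟨c, hc.le⟩) S fun x => ?_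
    exact hT x x.2
  have hcl : IsClosed (LinearMap.range S.toLinearMap : Set H) := by
    rw [LinearMap.coe_range]
    exact hS.isClosed_range S.uniformContinuous
  have : CompleteSpace (LinearMap.range S.toLinearMap) := hcl.completeSpace_coe
  have htop : LinearMap.range S.toLinearMap = ⊤ := by
    rw [← Submodule.orthogonal_eq_bot_iff, Submodule.eq_bot_iff]
    intro g hg
    refine hd g fun x hx => ?_
    exact (Submodule.mem_orthogonal _ g).1 hg (T x) ⟨⟨x, hx⟩, rfl⟩
  obtain ⟨x, hx⟩ := LinearMap.range_eq_top.1 htop f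
  exact ⟨x, x.2, hx⟩

/-! ### Integration by parts on the line through the Fourier transform -/

theorem integral_deriv_smul_of_memLp {z : L2Line × L2Line} (hz : z ∈ lineH1) {f : ℝ → ℝ}
    (hf : ContDiff ℝ ∞ f) (h2 : MemLp f 2 volume) (h2' : MemLp (deriv f) 2 volume) :
    ∫ s, deriv f s • z.1 s = - ∫ s, f s • z.2 s := by
  rw [mem_lineH1] at hz
  -- The admissible test functions are `f(s) χ(c n s)` with `c n → 0`. The derivative that falls on
  -- the cutoff carries a factor `c n` and disappears in the limit; `c n ≤ 1` keeps the dominating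
  -- function independent of `n`.
  let χ : ContDiffBump (0 : ℝ) := ⟨1, 2, by norm_num, by norm_num⟩
  have hχ : ContDiff ℝ ∞ χ := χ.contDiff
  obtain ⟨C, hC⟩ : ∃ C, ∀ x, ‖deriv χ x‖ ≤ C :=
    (hχ.continuous_deriv (by simp)).bounded_above_of_compact_support χ.hasCompactSupport.deriv
  let c : ℕ → ℝ := fun n => ((n : ℝ) + 1)⁻¹
  have hc0 (n : ℕ) : 0 < c n := by positivity
  have hc1 (n : ℕ) : c n ≤ 1 := inv_le_one_of_one_le₀ (by simp)
  have hct : Tendsto c atTop (𝓝 0) := by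
    simpa [c] using tendsto_one_div_add_atTop_nhds_zero_nat (𝕜 := ℝ)
  have hχ1 (s : ℝ) : Tendsto (fun n => χ (c n * s)) atTop (𝓝 1) := by
    have h0 : Tendsto (fun n => c n * s) atTop (𝓝 0) := by simpa using hct.mul_const s
    have := (χ.continuous.tendsto 0).comp h0
    rwa [χ.one_of_mem_closedBall (by simp [χ.rIn_pos.le])] at this
  have hsm (n : ℕ) : ContDiff ℝ ∞ fun s => χ (c n * s) := hχ.comp (contDiff_const.mul contDiff_id)
  have hcs (n : ℕ) : HasCompactSupport fun s => χ (c n * s) :=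
    χ.hasCompactSupport.comp_homeomorph (Homeomorph.mulLeft₀ (c n) (hc0 n).ne')
  have hd (n : ℕ) (s : ℝ) : deriv (fun s => f s * χ (c n * s)) s
      = deriv f s * χ (c n * s) + f s * (c n * deriv χ (c n * s)) := by
    have k1 : HasDerivAt f (deriv f s) s := (hf.differentiable (by simp) s).hasDerivAt
    have k2 : HasDerivAt χ (deriv χ (c n * s)) (c n * s) :=
      (hχ.differentiable (by simp) _).hasDerivAt
    have k3 : HasDerivAt (fun s => c n * s) (c n) s := by
      simpa using (hasDerivAt_id s).const_mul (c n)
    refine (k1.mul (k2.comp s k3)).deriv.trans ?_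
    simp only [Function.comp_apply]
    ring
  have hint {g : ℝ → ℝ} (hg : MemLp g 2 volume) (w : L2Line) :
      Integrable (fun s => ‖g s‖ * ‖w s‖) volume := by
    have := memLp_one_iff_integrable.1 ((Lp.memLp w).norm.mul (p := 2) (r := 1) hg.norm)
    exact this
  have key (n : ℕ) := hz (fun s => f s * χ (c n * s)) (hf.mul (hsm n)) ((hcs n).mul_left)
  have lim1 : Tendsto (fun n => ∫ s, deriv (fun s => f s * χ (c n * s)) s • z.1 s) atTop
      (𝓝 (∫ s, deriv f s • z.1 s)) := by
    refine tendsto_integral_of_dominated_convergence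
      (fun s => ‖deriv f s‖ * ‖z.1 s‖ + C * (‖f s‖ * ‖z.1 s‖)) (fun n => ?_)
      ((hint h2' z.1).add ((hint h2 z.1).const_mul C)) (fun n => ?_) ?_
    · exact (((hf.mul (hsm n)).continuous_deriv (by simp)).aestronglyMeasurable).smul
        (Lp.aestronglyMeasurable z.1)
    · refine Eventually.of_forall fun s => ?_
      rw [hd, norm_smul, ← mul_assoc C, ← add_mul]
      refine mul_le_mul_of_nonneg_right ?_ (norm_nonneg _)
      refine (norm_add_le _ _).trans (add_le_add ?_ ?_)
      · rw [norm_mul]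
        refine mul_le_of_le_one_right (norm_nonneg _) ?_
        rw [Real.norm_of_nonneg χ.nonneg]
        exact χ.le_one
      · rw [norm_mul, norm_mul, mul_comm]
        refine mul_le_mul_of_nonneg_right ?_ (norm_nonneg _)
        rw [Real.norm_of_nonneg (hc0 n).le]
        exact (mul_le_of_le_one_left (norm_nonneg _) (hc1 n)).trans (hC _)
    · refine Eventually.of_forall fun s => Tendsto.smul_const ?_ _
      simp only [hd]
      have k : Tendsto (fun n => c n * deriv χ (c n * s)) atTop (𝓝 0) := by
        refine squeeze_zero_norm (a := fun n => c n * C) (fun n => ?_) (by simpa using hct.mul_const C)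
        rw [norm_mul, Real.norm_of_nonneg (hc0 n).le]
        exact mul_le_mul_of_nonneg_left (hC _) (hc0 n).le
      simpa using ((hχ1 s).const_mul (deriv f s)).add (k.const_mul (f s))
  have lim2 : Tendsto (fun n => -∫ s, (f s * χ (c n * s)) • z.2 s) atTop
      (𝓝 (- ∫ s, f s • z.2 s)) := by
    refine (tendsto_integral_of_dominated_convergence
      (fun s => ‖f s‖ * ‖z.2 s‖) (fun n => ?_) (hint h2 z.2) (fun n => ?_) ?_).neg
    · exact ((hf.mul (hsm n)).continuous.aestronglyMeasurable).smul (Lp.aestronglyMeasurable z.2)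
    · refine Eventually.of_forall fun s => ?_
      rw [norm_smul]
      refine mul_le_mul_of_nonneg_right ?_ (norm_nonneg _)
      rw [norm_mul]
      refine mul_le_of_le_one_right (norm_nonneg _) ?_
      rw [Real.norm_of_nonneg χ.nonneg]
      exact χ.le_one
    · refine Eventually.of_forall fun s => Tendsto.smul_const ?_ _
      simpa using (hχ1 s).const_mul (f s)
  simp only [key] at lim1
  exact tendsto_nhds_unique lim1 lim2

/-- Tempered distributions are tested against complex Schwartz functions, weak derivatives against
real ones of compact support. Splitting `g` into real and imaginary parts reduces the claim to
`integral_deriv_smul_of_memLp`. -/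
theorem integral_deriv_smul_schwartz {z : L2Line × L2Line} (hz : z ∈ lineH1) (g : 𝓢(ℝ, ℂ)) :
    ∫ s, SchwartzMap.derivCLM ℂ ℂ g s • z.1 s = - ∫ s, g s • z.2 s := by
  have hm (g : 𝓢(ℝ, ℂ)) : MemLp g 2 volume := g.memLp 2 volume
  have hg : ContDiff ℝ ∞ g := g.smooth ⊤
  have hre : ContDiff ℝ ∞ fun s => (g s).re := Complex.reCLM.contDiff.comp hg
  have him : ContDiff ℝ ∞ fun s => (g s).im := Complex.imCLM.contDiff.comp hg
  have hdg (s : ℝ) : HasDerivAt g (SchwartzMap.derivCLM ℂ ℂ g s) s := by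
    rw [SchwartzMap.derivCLM_apply]
    exact (hg.differentiable (by simp) s).hasDerivAt
  have dre : deriv (fun s => (g s).re) = fun s => (SchwartzMap.derivCLM ℂ ℂ g s).re := by
    funext s
    exact (Complex.reCLM.hasFDerivAt.comp_hasDerivAt s (hdg s)).deriv
  have dim : deriv (fun s => (g s).im) = fun s => (SchwartzMap.derivCLM ℂ ℂ g s).im := by
    funext s
    exact (Complex.imCLM.hasFDerivAt.comp_hasDerivAt s (hdg s)).deriv
  have split (g : 𝓢(ℝ, ℂ)) (w : L2Line) : ∫ s, g s • w s
      = (∫ s, (g s).re • w s) + Complex.I • ∫ s, (g s).im • w s := by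
    have i1 : Integrable (fun s => (g s).re • w s) volume :=
      memLp_one_iff_integrable.1 ((Lp.memLp w).smul (p := 2) (r := 1) (hm g).re)
    have i2 : Integrable (fun s => (g s).im • w s) volume :=
      memLp_one_iff_integrable.1 ((Lp.memLp w).smul (p := 2) (r := 1) (hm g).im)
    rw [← integral_smul]
    refine Eq.trans ?_ (integral_add i1 (i2.smul Complex.I))
    refine integral_congr_ae (Eventually.of_forall fun s => ?_)
    simp only
    conv_lhs => rw [← Complex.re_add_im (g s)]
    rw [add_smul, Complex.coe_smul, mul_comm, mul_smul, Complex.coe_smul]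
  rw [split, split]
  have e1 := integral_deriv_smul_of_memLp hz hre (hm g).re (by
    rw [dre]; exact (hm _).re)
  have e2 := integral_deriv_smul_of_memLp hz him (hm g).im (by
    rw [dim]; exact (hm _).im)
  simp only [dre] at e1
  simp only [dim] at e2
  rw [e1, e2, smul_neg, neg_add]

open TemperedDistribution in
theorem toTemperedDistribution_of_mem_lineH1 {z : L2Line × L2Line} (hz : z ∈ lineH1) :
    LineDeriv.lineDerivOp (1 : ℝ) (z.1 : 𝓢'(ℝ, Spinor)) = (z.2 : 𝓢'(ℝ, Spinor)) := by
  ext1 g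
  rw [lineDerivOp_apply_apply, map_neg, Lp.toTemperedDistribution_apply,
    Lp.toTemperedDistribution_apply, neg_eq_iff_eq_neg, ← integral_deriv_smul_schwartz hz]
  rfl

open TemperedDistribution in
/-- The Fourier transform of a weak derivative. -/
theorem fourier_of_mem_lineH1 {z : L2Line × L2Line} (hz : z ∈ lineH1) :
    (𝓕 z.2 : L2Line) =ᵐ[volume]
      fun x => (2 * Real.pi * Complex.I * x) • (𝓕 z.1 : L2Line) x := by
  have h := toTemperedDistribution_of_mem_lineH1 hz
  apply_fun (𝓕 · : 𝓢'(ℝ, Spinor) → 𝓢'(ℝ, Spinor)) at h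
  rw [fourier_lineDerivOp_eq, Lp.fourier_toTemperedDistribution_eq,
    Lp.fourier_toTemperedDistribution_eq] at h
  have hcl : Continuous fun x : ℝ => (2 * Real.pi * Complex.I * x : ℂ) := by fun_prop
  have l1 : LocallyIntegrable (𝓕 z.2 : L2Line) volume :=
    (Lp.memLp _).locallyIntegrable (by norm_num)
  have l2 : LocallyIntegrable (fun x : ℝ => (2 * Real.pi * Complex.I * x : ℂ) •
      (𝓕 z.1 : L2Line) x) volume := by
    have := ((Lp.memLp (𝓕 z.1 : L2Line)).locallyIntegrable (by norm_num))
    exact this.continuous_smul hcl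
  refine ae_eq_of_integral_contDiff_smul_eq l1 l2 fun g g1 g2 => ?_
  have g1' : ContDiff ℝ ∞ fun x => (g x : ℂ) := Complex.ofRealCLM.contDiff.comp g1
  have g2' : HasCompactSupport fun x => (g x : ℂ) := g2.comp_left (g := Complex.ofReal) rfl
  have hh := congrArg (fun T : 𝓢'(ℝ, Spinor) => T (g2'.toSchwartzMap g1')) h
  have htg : (fun x : ℝ => (x : ℂ)).HasTemperateGrowth := by fun_prop
  simp [smulLeftCLM_apply_apply, SchwartzMap.smulLeftCLM_apply_apply htg] at hh
  rw [← hh, ← integral_smul]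
  refine integral_congr_ae (Eventually.of_forall fun x => ?_)
  simp only [← Complex.coe_smul, smul_smul]
  ring_nf

/-- By Plancherel the derivative becomes multiplication by `2πix`, which is skew, so no boundary
terms at infinity need discussion. -/
theorem line_ibp {z w : L2Line × L2Line} (hz : z ∈ lineH1) (hw : w ∈ lineH1) :
    ⟪z.2, w.1⟫_ℂ = - ⟪z.1, w.2⟫_ℂ := by
  rw [← Lp.inner_fourier_eq z.2, ← Lp.inner_fourier_eq z.1, L2.inner_def, L2.inner_def,
    ← integral_neg]
  refine integral_congr_ae ?_
  filter_upwards [fourier_of_mem_lineH1 hz, fourier_of_mem_lineH1 hw] with x h1 h2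
  rw [h1, h2, inner_smul_left, inner_smul_right, ← neg_mul]
  congr 1
  simp only [map_mul, Complex.conj_I, Complex.conj_ofReal, map_ofNat]
  ring

/-- A point of the graph bundles the domain membership with the value, so resolvents can be verified
by equations between pairs alone. -/
theorem isResolvent_of_graph {H : Type*} [NormedAddCommGroup H] [NormedSpace ℂ H]
    {A : H →ₗ.[ℂ] H} {z : ℂ} {R : H →L[ℂ] H} (h1 : ∀ f, (R f, f + z • R f) ∈ A.graph)
    (h2 : ∀ p ∈ A.graph, R (p.2 - z • p.1) = p.1) : IsResolvent A z R := by
  refine ⟨fun f => ?_, fun u => ?_⟩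
  · obtain ⟨y, hy1, hy2⟩ := (LinearPMap.mem_graph_iff A).1 (h1 f)
    simp only at hy1 hy2
    refine ⟨hy1 ▸ y.2, ?_⟩
    have : (⟨R f, hy1 ▸ y.2⟩ : A.domain) = y := Subtype.ext hy1.symm
    rw [this, hy2, add_sub_cancel_right]
  · exact h2 (u, A u) (A.mem_graph u)

/-! ### Localised constant spinors -/

section testField

variable {X : Type*} [MeasurableSpace X] {μ : Measure X}

/-- The spinor field `x ↦ g x • e`. -/
def testField {g : X → ℝ} (hg : MemLp g 2 μ) (e : Spinor) : Lp Spinor 2 μ :=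
  MemLp.toLp (fun x => g x • e) (by
    exact ((ContinuousLinearMap.toSpanSingleton ℝ e).comp_memLp' hg))

theorem coeFn_testField {g : X → ℝ} (hg : MemLp g 2 μ) (e : Spinor) :
    testField hg e =ᵐ[μ] fun x => g x • e := MemLp.coeFn_toLp _

/-- Pairing with an arbitrary `e` turns identities between spinor-valued integrals into identities
between inner products; weak equations for adjoints are tested in this way. -/
theorem inner_testField {g : X → ℝ} (hg : MemLp g 2 μ) (e : Spinor) (u : Lp Spinor 2 μ) :
    ⟪testField hg e, u⟫_ℂ = ⟪e, ∫ x, g x • u x ∂μ⟫_ℂ := by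
  have hi : Integrable (fun x => g x • u x) μ :=
    memLp_one_iff_integrable.1 ((Lp.memLp u).smul (p := 2) (r := 1) hg)
  rw [L2.inner_def, ← integral_inner hi]
  refine integral_congr_ae ?_
  filter_upwards [coeFn_testField hg e] with x hx
  rw [hx, ← Complex.coe_smul, ← Complex.coe_smul, inner_smul_left, inner_smul_right,
    Complex.conj_ofReal]

end testField

theorem memLp_deriv_of_test {φ : ℝ → ℝ} (h : ContDiff ℝ ∞ φ) (hc : HasCompactSupport φ) :
    MemLp (deriv φ) 2 (volume : Measure ℝ) :=
  (h.continuous_deriv (by simp)).memLp_of_hasCompactSupport hc.deriv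

theorem testField_mem_lineH1 {φ : ℝ → ℝ} (h : ContDiff ℝ ∞ φ) (hc : HasCompactSupport φ)
    (e : Spinor) : (testField (μ := volume) (h.continuous.memLp_of_hasCompactSupport hc) e,
      testField (memLp_deriv_of_test h hc) e) ∈ lineH1 := by
  rw [mem_lineH1]
  intro ψ k1 k2
  have hφ' := h.continuous_deriv (by simp)
  have hψ' := k1.continuous_deriv (by simp)
  have e1 : ∫ s, deriv ψ s • testField (μ := volume)
      (h.continuous.memLp_of_hasCompactSupport hc) e s = (∫ s, deriv ψ s * φ s) • e := by
    rw [← integral_smul_const]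
    refine integral_congr_ae ?_
    filter_upwards [coeFn_testField (μ := volume) (h.continuous.memLp_of_hasCompactSupport hc) e]
      with s hs
    rw [hs, smul_smul]
  have e2 : ∫ s, ψ s • testField (memLp_deriv_of_test h hc) e s = (∫ s, ψ s * deriv φ s) • e := by
    rw [← integral_smul_const]
    refine integral_congr_ae ?_
    filter_upwards [coeFn_testField (memLp_deriv_of_test h hc) e] with s hs
    rw [hs, smul_smul]
  simp only
  rw [e1, e2, integral_mul_deriv_eq_deriv_mul_of_integrable (u := ψ) (v := φ) (u' := deriv ψ)
    (v' := deriv φ), neg_smul, neg_neg]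
  · exact fun x _ => (k1.differentiable (by simp) x).hasDerivAt
  · exact fun x _ => (h.differentiable (by simp) x).hasDerivAt
  · exact (k1.continuous.mul hφ').integrable_of_hasCompactSupport k2.mul_right
  · exact (hψ'.mul h.continuous).integrable_of_hasCompactSupport k2.deriv.mul_right
  · exact (k1.continuous.mul h.continuous).integrable_of_hasCompactSupport k2.mul_right

/-! ### The shifted Dirac operator on the line -/

/-- The symbol `M σ₃ - i y`. -/
def massShift (M y : ℝ) : Matrix (Fin 2) (Fin 2) ℂ := (M : ℂ) • σ₃ - (y * Complex.I) • 1

/-- The operator `-i σ₁ ∂ₛ + M σ₃ - i y` as a function of `(u, ∂ₛ u)`. -/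
def lineShift (M y : ℝ) : L2Line × L2Line →L[ℂ] L2Line :=
  lift (-Complex.I • σ₁) ∘L ContinuousLinearMap.snd ℂ _ _ +
    lift (massShift M y) ∘L ContinuousLinearMap.fst ℂ _ _

theorem lineShift_apply (M y : ℝ) (z : L2Line × L2Line) :
    lineShift M y z = lift (-Complex.I • σ₁) z.2 + lift (massShift M y) z.1 := rfl

/-- Integration by parts gives `⟪u', K u⟫ = -⟪u, K u'⟫`, and for Hermitian `K` the right side is
minus the conjugate of the left. -/
theorem re_inner_herm {K : Matrix (Fin 2) (Fin 2) ℂ} (hK : K.conjTranspose = K)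
    {z : L2Line × L2Line} (hz : z ∈ lineH1) : (⟪z.2, lift K z.1⟫_ℂ).re = 0 := by
  have h := line_ibp hz (lineH1_lift K hz)
  simp only at h
  have h2 : ⟪z.1, lift K z.2⟫_ℂ = (starRingEnd ℂ) ⟪z.2, lift K z.1⟫_ℂ := by
    rw [inner_conj_symm, lift_inner, hK]
  rw [h2] at h
  have := congrArg Complex.re h
  rw [Complex.neg_re, Complex.conj_re] at this
  linarith

/-- Put `J = -iσ₁` and `B = Mσ₃ - iy`. Then `J` is unitary, `B*B = M² + y²`, and `J*B` is Hermitian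
because `σ₁` and `σ₃` anticommute, so the cross term vanishes by `re_inner_herm`. The bounds uniform
in `ε` for the straight operator all originate in this exact identity. -/
theorem norm_lineShift_sq (M y : ℝ) {z : L2Line × L2Line} (hz : z ∈ lineH1) :
    ‖lineShift M y z‖ ^ 2 = ‖z.2‖ ^ 2 + (M ^ 2 + y ^ 2) * ‖z.1‖ ^ 2 := by
  have hJ : (-Complex.I • σ₁).conjTranspose * (-Complex.I • σ₁) = 1 := by
    ext i j; fin_cases i <;> fin_cases j <;> simp [σ₁, Matrix.mul_apply]
  have hB : (massShift M y).conjTranspose * massShift M y = ((M ^ 2 + y ^ 2 : ℝ) : ℂ) • 1 := by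
    ext i j; fin_cases i <;> fin_cases j <;> simp [σ₃, massShift, Matrix.mul_apply] <;>
      ring_nf <;> simp
  have hK : ((-Complex.I • σ₁).conjTranspose * massShift M y).conjTranspose =
      (-Complex.I • σ₁).conjTranspose * massShift M y := by
    ext i j; fin_cases i <;> fin_cases j <;> simp [σ₁, σ₃, massShift, Matrix.mul_apply] <;> ring
  have h1 : ‖lift (massShift M y) z.1‖ ^ 2 = (M ^ 2 + y ^ 2) * ‖z.1‖ ^ 2 := by
    have : ⟪lift (massShift M y) z.1, lift (massShift M y) z.1⟫_ℂ
        = ((M ^ 2 + y ^ 2 : ℝ) : ℂ) * ⟪z.1, z.1⟫_ℂ := by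
      rw [lift_inner, ← lift_mul, hB, lift_smul, lift_one, inner_smul_right]
    have h := congrArg Complex.re this
    rw [Complex.re_ofReal_mul] at h
    rwa [@norm_sq_eq_re_inner ℂ, @norm_sq_eq_re_inner ℂ _ _ _ _ z.1]
  rw [lineShift_apply, norm_add_sq (𝕜 := ℂ), norm_lift_of_unitary hJ, lift_inner, ← lift_mul,
    RCLike.re_eq_complex_re, re_inner_herm hK hz, h1]
  ring

/-- The norm identity bounds the operator from below. A vector orthogonal to the range solves the
equation with `-y` in place of `y`, and the same identity forces it to vanish. -/
theorem lineShift_surjective (M : ℝ) {y : ℝ} (hy : y ≠ 0) (f : L2Line) :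
    ∃ z ∈ lineH1, lineShift M y z = f := by
  refine surjective_of_boundedBelow lineH1 isClosed_lineH1 (lineShift M y) (c := 1 + |y|⁻¹)
    (by positivity) (fun z hz => ?_) (fun g hg => ?_) f
  · have h := norm_lineShift_sq M y hz
    have hy' := abs_pos.2 hy
    have h1 : ‖z.2‖ ≤ ‖lineShift M y z‖ := by
      refine abs_le_of_sq_le_sq' ?_ (norm_nonneg _) |>.2
      rw [h]
      exact le_add_of_nonneg_right (by positivity)
    have h2 : ‖z.1‖ ≤ |y|⁻¹ * ‖lineShift M y z‖ := by
      rw [inv_mul_eq_div, le_div_iff₀ hy']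
      refine abs_le_of_sq_le_sq' ?_ (norm_nonneg _) |>.2
      rw [mul_pow, sq_abs, h]
      nlinarith [sq_nonneg ‖z.2‖, mul_nonneg (sq_nonneg M) (sq_nonneg ‖z.1‖)]
    have h3 := norm_nonneg (lineShift M y z)
    have h4 : 0 ≤ |y|⁻¹ * ‖lineShift M y z‖ := by positivity
    rw [Prod.norm_def]
    refine max_le ?_ ?_ <;> linarith
  · have hB : (massShift M y).conjTranspose = massShift M (-y) := by
      ext i j; fin_cases i <;> fin_cases j <;> simp [σ₃, massShift]
    -- In the notation `J = -iσ₁`, `B = massShift M y`: orthogonality tested on the fields `φ e`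
    -- says that `J* g` has the weak derivative `B* g`. Multiplication by `J` gives `g' = J B* g`,
    -- and `J² = -1` yields `lineShift M (-y) (g, g') = 0`.
    have k : (lift (-Complex.I • σ₁).conjTranspose g, lift (massShift M (-y)) g) ∈ lineH1 := by
      rw [mem_lineH1]
      intro φ k1 k2
      refine ext_inner_left ℂ fun e => ?_
      have h := hg _ (testField_mem_lineH1 k1 k2 e)
      rw [lineShift_apply, inner_add_left, lift_inner, lift_inner, hB, inner_testField,
        inner_testField] at h
      rw [inner_neg_right]
      exact eq_neg_of_add_eq_zero_left h
    have k' := lineH1_lift (-Complex.I • σ₁) k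
    have h1 : (-Complex.I • σ₁) * (-Complex.I • σ₁).conjTranspose = 1 := by
      ext i j; fin_cases i <;> fin_cases j <;> simp [σ₁, Matrix.mul_apply]
    have h2 : (-Complex.I • σ₁) * (-Complex.I • σ₁) = -1 := by
      ext i j; fin_cases i <;> fin_cases j <;> simp [σ₁, Matrix.mul_apply]
    simp only [← lift_mul, h1, lift_one] at k'
    have h3 := norm_lineShift_sq M (-y) k'
    rw [lineShift_apply] at h3
    simp only [← lift_mul, ← mul_assoc, h2, neg_mul, one_mul, lift_neg, neg_add_cancel, norm_zero]
      at h3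
    have h4 : y ^ 2 * ‖g‖ ^ 2 = 0 := by
      have a1 := sq_nonneg (‖lift ((-Complex.I • σ₁) * massShift M (-y)) g‖)
      simp only [neg_mul, lift_neg, norm_neg, neg_smul] at a1 h3
      nlinarith [mul_nonneg (sq_nonneg y) (sq_nonneg ‖g‖), mul_nonneg (sq_nonneg M) (sq_nonneg ‖g‖)]
    have h5 : ‖g‖ ^ 2 = 0 := (mul_eq_zero.1 h4).resolve_left (pow_ne_zero 2 hy)
    exact norm_eq_zero.1 (pow_eq_zero_iff (two_ne_zero)|>.1 h5)

theorem mem_lineGraph {M : ℝ} {p : L2Line × L2Line} : p ∈ lineGraph M ↔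
    ∃ us, (p.1, us) ∈ lineH1 ∧ p.2 = lift (-Complex.I • σ₁) us + (M : ℂ) • lift σ₃ p.1 := by
  have key (us : L2Line) : (p.2 =ᵐ[volume] fun s => act (-Complex.I • σ₁) (us s)
      + M • act σ₃ (p.1 s)) ↔ p.2 = lift (-Complex.I • σ₁) us + (M : ℂ) • lift σ₃ p.1 := by
    have e : (fun s => act (-Complex.I • σ₁) (us s) + M • act σ₃ (p.1 s)) =ᵐ[volume]
        (lift (-Complex.I • σ₁) us + (M : ℂ) • lift σ₃ p.1 : L2Line) := by
      filter_upwards [Lp.coeFn_add (lift (-Complex.I • σ₁) us) ((M : ℂ) • lift σ₃ p.1),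
        Lp.coeFn_smul (M : ℂ) (lift σ₃ p.1), coeFn_lift (-Complex.I • σ₁) us, coeFn_lift σ₃ p.1]
        with s h1 h2 h3 h4
      rw [h1, Pi.add_apply, h2, Pi.smul_apply, h3, h4, Complex.coe_smul]
    exact ⟨fun h => Lp.ext (h.trans e), fun h => h ▸ e.symm⟩
  exact exists_congr fun us => and_congr Iff.rfl (key us)

theorem lineShift_eq (M y : ℝ) (z : L2Line × L2Line) : lineShift M y z =
    lift (-Complex.I • σ₁) z.2 + (M : ℂ) • lift σ₃ z.1 - (y * Complex.I) • z.1 := by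
  rw [lineShift_apply, massShift, sub_eq_add_neg, lift_add, lift_neg, lift_smul _ σ₃,
    lift_smul _ 1, lift_one]
  abel

/-- The point `i` is in the resolvent set of the Dirac operator on the line. -/
theorem exists_resolvent_lineDirac (M : ℝ) :
    ∃ R₀ : L2Line →L[ℂ] L2Line, IsResolvent (lineDirac M) Complex.I R₀ := by
  let T : lineH1 →ₗ[ℂ] L2Line := (lineShift M 1).toLinearMap ∘ₗ lineH1.subtype
  have hT (z : lineH1) : ‖(z : L2Line × L2Line).1‖ ≤ ‖T z‖ := by
    have h : ‖T z‖ ^ 2 = ‖(z : L2Line × L2Line).2‖ ^ 2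
      + (M ^ 2 + 1 ^ 2) * ‖(z : L2Line × L2Line).1‖ ^ 2 := norm_lineShift_sq M 1 z.2
    refine abs_le_of_sq_le_sq' ?_ (norm_nonneg _) |>.2
    rw [h]
    nlinarith [sq_nonneg ‖(z : L2Line × L2Line).2‖,
      mul_nonneg (sq_nonneg M) (sq_nonneg ‖(z : L2Line × L2Line).1‖)]
  have hinj : Function.Injective T := by
    rw [injective_iff_map_eq_zero]
    intro z hz
    have h : ‖T z‖ ^ 2 = ‖(z : L2Line × L2Line).2‖ ^ 2
      + (M ^ 2 + 1 ^ 2) * ‖(z : L2Line × L2Line).1‖ ^ 2 := norm_lineShift_sq M 1 z.2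
    rw [hz, norm_zero] at h
    have h1 : (z : L2Line × L2Line).1 = 0 := by
      rw [← norm_le_zero_iff]; simpa [hz] using hT z
    have h2 : (z : L2Line × L2Line).2 = 0 := by
      rw [h1, norm_zero] at h
      rw [← norm_eq_zero]
      exact pow_eq_zero_iff (two_ne_zero) |>.1 (by linarith)
    exact Subtype.ext (Prod.ext h1 h2)
  have hsurj : Function.Surjective T := fun f => by
    obtain ⟨z, hz, h⟩ := lineShift_surjective M one_ne_zero f
    exact ⟨⟨z, hz⟩, h⟩
  let e : lineH1 ≃ₗ[ℂ] L2Line := LinearEquiv.ofBijective T ⟨hinj, hsurj⟩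
  have he (f : L2Line) : T (e.symm f) = f := e.apply_symm_apply f
  let R : L2Line →ₗ[ℂ] L2Line := LinearMap.fst ℂ L2Line L2Line ∘ₗ lineH1.subtype ∘ₗ e.symm.toLinearMap
  refine ⟨R.mkContinuous 1 fun f => ?_, isResolvent_of_graph (fun f => ?_) (fun p hp => ?_)⟩
  · have := hT (e.symm f)
    rwa [he, ← one_mul ‖f‖] at this
  · rw [lineDirac, Submodule.toLinearPMap_graph_eq _ (lineGraph_single M), mem_lineGraph]
    refine ⟨(e.symm f : L2Line × L2Line).2, (e.symm f).2, ?_⟩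
    have h : lineShift M 1 (e.symm f) = f := he f
    rw [lineShift_eq, Complex.ofReal_one, one_mul, sub_eq_iff_eq_add] at h
    exact h.symm
  · rw [lineDirac, Submodule.toLinearPMap_graph_eq _ (lineGraph_single M), mem_lineGraph] at hp
    obtain ⟨us, h1, h2⟩ := hp
    have h : e ⟨(p.1, us), h1⟩ = p.2 - Complex.I • p.1 := by
      change lineShift M 1 (p.1, us) = _
      rw [lineShift_eq, h2, Complex.ofReal_one, one_mul]
    change (e.symm (p.2 - Complex.I • p.1) : L2Line × L2Line).1 = _
    rw [← h, LinearEquiv.symm_apply_apply]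

/-! ### Products of line fields with transverse functions, and their adjoints -/

theorem volume_restrict_strip : (volume : Measure (ℝ × ℝ)).restrict strip =
    (volume : Measure ℝ).prod (volume.restrict (Ioo (-1 : ℝ) 1)) := by
  rw [strip, Measure.volume_eq_prod, ← Measure.prod_restrict, Measure.restrict_univ]

theorem integrable_of_continuous_Ioo {h : ℝ → ℝ} (hh : Continuous h) :
    Integrable h (volume.restrict (Ioo (-1 : ℝ) 1)) :=
  (hh.integrableOn_Icc (μ := volume) (a := -1) (b := 1)).mono_set Ioo_subset_Icc_self

theorem memLp_tensor {a : ℝ → Spinor} (ha : MemLp a 2 volume) {h : ℝ → ℝ} (hh : Continuous h) :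
    MemLp (fun p : ℝ × ℝ => h p.2 • a p.1) 2 (volume.restrict strip) := by
  rw [volume_restrict_strip]
  have h1 : AEStronglyMeasurable (fun p : ℝ × ℝ => h p.2 • a p.1)
      ((volume : Measure ℝ).prod (volume.restrict (Ioo (-1 : ℝ) 1))) :=
    (hh.comp continuous_snd).aestronglyMeasurable.smul ha.1.comp_fst
  rw [← integrable_norm_rpow_iff h1 (by simp) (by simp)]
  have h2 := (memLp_two_iff_integrable_sq_norm ha.1).1 ha
  have h3 := h2.mul_prod (integrable_of_continuous_Ioo (hh.pow 2))
  refine h3.congr (Eventually.of_forall fun p => ?_)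
  simp only [norm_smul, ENNReal.toReal_ofNat, Real.rpow_ofNat, mul_pow, Real.norm_eq_abs, sq_abs,
    Pi.pow_apply]
  ring

/-- The product of a spinor field on the line and a continuous function of the transverse
variable, as a function on the strip. -/
def tensorL (h : C(ℝ, ℝ)) : L2Line →ₗ[ℂ] L2Strip where
  toFun a := (memLp_tensor (Lp.memLp a) h.continuous).toLp _
  map_add' a b := by
    rw [← MemLp.toLp_add]
    refine MemLp.toLp_congr _ _ ?_
    have h1 := Lp.coeFn_add a b
    rw [volume_restrict_strip]
    filter_upwards [Measure.quasiMeasurePreserving_fst.ae h1] with p hp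
    rw [hp, Pi.add_apply, smul_add]
    rfl
  map_smul' c a := by
    rw [RingHom.id_apply, ← MemLp.toLp_const_smul]
    refine MemLp.toLp_congr _ _ ?_
    have h1 := Lp.coeFn_smul c a
    rw [volume_restrict_strip]
    filter_upwards [Measure.quasiMeasurePreserving_fst.ae h1] with p hp
    rw [hp, Pi.smul_apply, smul_comm]
    rfl

theorem coeFn_tensorL (h : C(ℝ, ℝ)) (a : L2Line) :
    tensorL h a =ᵐ[volume.restrict strip] fun p => h p.2 • a p.1 :=
  MemLp.coeFn_toLp (memLp_tensor (Lp.memLp a) h.continuous)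

theorem inner_tensorL (h g : C(ℝ, ℝ)) (a b : L2Line) : ⟪tensorL h a, tensorL g b⟫_ℂ =
    ((∫ t in Ioo (-1 : ℝ) 1, h t * g t : ℝ) : ℂ) * ⟪a, b⟫_ℂ := by
  rw [L2.inner_def, L2.inner_def]
  have e : (fun p : ℝ × ℝ => ⟪tensorL h a p, tensorL g b p⟫_ℂ) =ᵐ[volume.restrict strip]
      fun p => ⟪a p.1, b p.1⟫_ℂ * ((h p.2 * g p.2 : ℝ) : ℂ) := by
    filter_upwards [coeFn_tensorL h a, coeFn_tensorL g b] with p h1 h2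
    rw [h1, h2, ← Complex.coe_smul, ← Complex.coe_smul, inner_smul_left, inner_smul_right,
      Complex.conj_ofReal, Complex.ofReal_mul]
    ring
  rw [integral_congr_ae e, volume_restrict_strip,
    integral_prod_mul (fun s => ⟪a s, b s⟫_ℂ) (fun t => ((h t * g t : ℝ) : ℂ)),
    integral_complex_ofReal, mul_comm]

theorem norm_tensorL_sq (h : C(ℝ, ℝ)) (a : L2Line) :
    ‖tensorL h a‖ ^ 2 = (∫ t in Ioo (-1 : ℝ) 1, h t ^ 2) * ‖a‖ ^ 2 := by
  rw [@norm_sq_eq_re_inner ℂ, @norm_sq_eq_re_inner ℂ _ _ _ _ a, inner_tensorL,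
    RCLike.re_eq_complex_re, Complex.re_ofReal_mul]
  simp only [sq]

/-- `tensorL` as a bounded operator. -/
def tensor (h : C(ℝ, ℝ)) : L2Line →L[ℂ] L2Strip :=
  (tensorL h).mkContinuous (Real.sqrt (∫ t in Ioo (-1 : ℝ) 1, h t ^ 2)) fun a => by
    refine abs_le_of_sq_le_sq' ?_ (by positivity) |>.2
    rw [norm_tensorL_sq, mul_pow, Real.sq_sqrt (integral_nonneg fun t => sq_nonneg _)]

theorem coeFn_tensor (h : C(ℝ, ℝ)) (a : L2Line) :
    tensor h a =ᵐ[volume.restrict strip] fun p => h p.2 • a p.1 := coeFn_tensorL h a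

theorem inner_tensor (h g : C(ℝ, ℝ)) (a b : L2Line) : ⟪tensor h a, tensor g b⟫_ℂ =
    ((∫ t in Ioo (-1 : ℝ) 1, h t * g t : ℝ) : ℂ) * ⟪a, b⟫_ℂ := inner_tensorL h g a b

theorem norm_tensor_le (h : C(ℝ, ℝ)) : ‖tensor h‖ ≤ Real.sqrt (∫ t in Ioo (-1 : ℝ) 1, h t ^ 2) :=
  LinearMap.mkContinuous_norm_le _ (Real.sqrt_nonneg _) _

theorem ae_strip_of_ae_line {P : ℝ → Prop} (h : ∀ᵐ s, P s) :
    ∀ᵐ p ∂((volume : Measure (ℝ × ℝ)).restrict strip), P p.1 := by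
  rw [volume_restrict_strip]
  exact Measure.quasiMeasurePreserving_fst.ae h

theorem tensor_sub (h g : C(ℝ, ℝ)) : tensor (h - g) = tensor h - tensor g := by
  ext1 a
  refine Lp.ext ?_
  filter_upwards [coeFn_tensor (h - g) a, coeFn_tensor h a, coeFn_tensor g a,
    Lp.coeFn_sub (tensor h a) (tensor g a)] with p h1 h2 h3 h4
  rw [h1, ContinuousMap.sub_apply, sub_apply, h4, Pi.sub_apply, h2, h3, sub_smul]

theorem tensor_smul (c : ℝ) (h : C(ℝ, ℝ)) : tensor (c • h) = (c : ℂ) • tensor h := by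
  ext1 a
  refine Lp.ext ?_
  filter_upwards [coeFn_tensor (c • h) a, coeFn_tensor h a,
    Lp.coeFn_smul (c : ℂ) (tensor h a)] with p h1 h2 h4
  rw [h1, ContinuousMap.smul_apply, smul_apply, h4, Pi.smul_apply, h2, Complex.coe_smul,
    smul_smul, smul_eq_mul]

theorem tensor_lift (h : C(ℝ, ℝ)) (A : Matrix (Fin 2) (Fin 2) ℂ) (a : L2Line) :
    tensor h (lift A a) = lift A (tensor h a) := by
  refine Lp.ext ?_
  filter_upwards [coeFn_tensor h (lift A a), coeFn_tensor h a, coeFn_lift A (tensor h a),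
    ae_strip_of_ae_line (coeFn_lift A a)] with p h1 h2 h3 h4
  rw [h1, h3, h2, h4]
  exact ((act A).map_smul_of_tower (h p.2) (a p.1)).symm

theorem adjoint_tensor_lift (h : C(ℝ, ℝ)) (A : Matrix (Fin 2) (Fin 2) ℂ) (u : L2Strip) :
    (tensor h).adjoint (lift A u) = lift A ((tensor h).adjoint u) := by
  refine ext_inner_left ℂ fun a => ?_
  rw [← A.conjTranspose_conjTranspose, ← lift_inner, ContinuousLinearMap.adjoint_inner_right,
    ContinuousLinearMap.adjoint_inner_right, ← lift_inner, tensor_lift]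

theorem norm_adjoint_tensor_le (h : C(ℝ, ℝ)) (u : L2Strip) :
    ‖(tensor h).adjoint u‖ ≤ Real.sqrt (∫ t in Ioo (-1 : ℝ) 1, h t ^ 2) * ‖u‖ := by
  refine (ContinuousLinearMap.le_opNorm _ _).trans ?_
  rw [LinearIsometryEquiv.norm_map]
  exact mul_le_mul_of_nonneg_right (norm_tensor_le h) (norm_nonneg _)

theorem memLp_prod_mul {ψ : ℝ → ℝ} (hψ : Continuous ψ) (hc : HasCompactSupport ψ) {h : ℝ → ℝ}
    (hh : Continuous h) :
    MemLp (fun p : ℝ × ℝ => ψ p.1 * h p.2) 2 (volume.restrict strip) := by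
  rw [volume_restrict_strip]
  have h1 : AEStronglyMeasurable (fun p : ℝ × ℝ => ψ p.1 * h p.2)
      ((volume : Measure ℝ).prod (volume.restrict (Ioo (-1 : ℝ) 1))) :=
    Continuous.aestronglyMeasurable (by fun_prop)
  rw [memLp_two_iff_integrable_sq h1]
  have h2 : Integrable (fun s => ψ s ^ 2) volume :=
    (hψ.memLp_of_hasCompactSupport (p := 2) hc).integrable_sq
  have h3 := h2.mul_prod (integrable_of_continuous_Ioo (h := fun t => h t ^ 2) (hh.pow 2))
  refine h3.congr (Eventually.of_forall fun p => ?_)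
  simp only [mul_pow]

/-- Pairing with products of test functions in terms of the adjoint of `tensor`. -/
theorem pairing_strip {ψ : ℝ → ℝ} (hψ : Continuous ψ) (hc : HasCompactSupport ψ) (h : C(ℝ, ℝ))
    (u : L2Strip) : ∫ p in strip, (ψ p.1 * h p.2) • u p =
      ∫ s, ψ s • ((tensor h).adjoint u : L2Line) s := by
  refine ext_inner_left ℂ fun e => ?_
  rw [← inner_testField (memLp_prod_mul hψ hc h.continuous), ← inner_testField
    (hψ.memLp_of_hasCompactSupport hc), ContinuousLinearMap.adjoint_inner_right]
  congr 1
  refine Lp.ext ?_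
  filter_upwards [coeFn_testField (memLp_prod_mul hψ hc h.continuous) e,
    coeFn_tensor h (testField (hψ.memLp_of_hasCompactSupport hc) e), ae_strip_of_ae_line
      (coeFn_testField (μ := volume) (hψ.memLp_of_hasCompactSupport hc) e)] with p h1 h2 h3
  rw [h1, h2, h3, smul_smul, mul_comm]

theorem eq_of_pairing_line {u v : L2Line} (h : ∀ ψ : ℝ → ℝ, ContDiff ℝ ∞ ψ → HasCompactSupport ψ →
    ∫ s, ψ s • u s = ∫ s, ψ s • v s) : u = v :=
  Lp.ext (ae_eq_of_integral_contDiff_smul_eq ((Lp.memLp u).locallyIntegrable (by norm_num))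
    ((Lp.memLp v).locallyIntegrable (by norm_num)) h)

theorem hasFDerivAt_prod_mul {ψ h : ℝ → ℝ} (hψ : ContDiff ℝ ∞ ψ) (hh : ContDiff ℝ ∞ h)
    (p e : ℝ × ℝ) : fderiv ℝ (fun p : ℝ × ℝ => ψ p.1 * h p.2) p e
      = deriv ψ p.1 * h p.2 * e.1 + ψ p.1 * deriv h p.2 * e.2 := by
  have h1 : HasFDerivAt (fun p : ℝ × ℝ => ψ p.1) _ p :=
    ((hψ.differentiable (by simp) p.1).hasDerivAt.hasFDerivAt).comp p hasFDerivAt_fst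
  have h2 : HasFDerivAt (fun p : ℝ × ℝ => h p.2) _ p :=
    ((hh.differentiable (by simp) p.2).hasDerivAt.hasFDerivAt).comp p hasFDerivAt_snd
  rw [(h1.fun_mul h2).fderiv]
  simp
  ring

theorem hasCompactSupport_prod_mul {ψ h : ℝ → ℝ} (hψ : HasCompactSupport ψ)
    (hh : HasCompactSupport h) : tsupport (fun p : ℝ × ℝ => ψ p.1 * h p.2) ⊆
      tsupport ψ ×ˢ tsupport h ∧ HasCompactSupport (fun p : ℝ × ℝ => ψ p.1 * h p.2) := by
  have h1 : tsupport (fun p : ℝ × ℝ => ψ p.1 * h p.2) ⊆ tsupport ψ ×ˢ tsupport h := by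
    refine closure_minimal (fun p hp => ?_)
      ((isClosed_tsupport _).prod (isClosed_tsupport _))
    have := mul_ne_zero_iff.1 hp
    exact ⟨subset_tsupport _ this.1, subset_tsupport _ this.2⟩
  exact ⟨h1, (hψ.isCompact.prod hh.isCompact).of_isClosed_subset (isClosed_tsupport _) h1⟩

/-! ### Integrating weak derivatives and traces over the cross section -/

/-- The transverse cutoff functions, with compact support in `(-1, 1)`. -/
def crossCutoff (n : ℕ) : ContDiffBump (0 : ℝ) where
  -- The offset `3` keeps the inner radius positive already for `n = 0`; both radii tend to `1` from
  -- below.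
  rIn := 1 - 2 / (n + 3)
  rOut := 1 - 1 / (n + 3)
  rIn_pos := by
    rw [sub_pos, div_lt_one (by positivity)]
    linarith [(Nat.cast_nonneg n : (0 : ℝ) ≤ n)]
  rIn_lt_rOut := by
    have : (0 : ℝ) < n + 3 := by positivity
    gcongr
    norm_num

theorem tsupport_crossCutoff (n : ℕ) : tsupport (crossCutoff n) ⊆ Ioo (-1) 1 := by
  rw [ContDiffBump.tsupport_eq, Real.closedBall_eq_Icc]
  have h : (crossCutoff n).rOut < 1 := by
    have : (0 : ℝ) < 1 / (n + 3) := by positivity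
    simp only [crossCutoff]
    linarith
  exact Icc_subset_Ioo (by linarith) (by linarith)

theorem tendsto_crossCutoff {t : ℝ} (ht : t ∈ Ioo (-1 : ℝ) 1) :
    Tendsto (fun n => crossCutoff n t) atTop (𝓝 1) := by
  have h1 : Tendsto (fun n : ℕ => (1 : ℝ) - 2 / (n + 3)) atTop (𝓝 (1 - 0)) := by
    refine tendsto_const_nhds.sub (tendsto_const_nhds.div_atTop ?_)
    exact tendsto_atTop_add_const_right _ _ tendsto_natCast_atTop_atTop
  have h2 : |t| < 1 - 0 := by rw [sub_zero]; exact abs_lt.2 ht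
  refine tendsto_const_nhds.congr' ?_
  filter_upwards [h1.eventually (eventually_gt_nhds h2)] with n hn
  refine ((crossCutoff n).one_of_mem_closedBall ?_).symm
  rw [mem_closedBall_zero_iff, Real.norm_eq_abs]
  exact hn.le

/-- The norm of the adjoint of `tensor h` is at most the `L²(-1, 1)` norm of `h`, and in that norm
the truncations of `h` converge by dominated convergence. -/
theorem tendsto_adjoint_tensor_cutoff (h : C(ℝ, ℝ)) (u : L2Strip) :
    Tendsto (fun n => (tensor (⟨crossCutoff n, (crossCutoff n).continuous⟩ * h)).adjoint u) atTop
      (𝓝 ((tensor h).adjoint u)) := by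
  rw [tendsto_iff_norm_sub_tendsto_zero]
  have e (n : ℕ) : (tensor (⟨crossCutoff n, (crossCutoff n).continuous⟩ * h)).adjoint u
      - (tensor h).adjoint u
      = (tensor (⟨crossCutoff n, (crossCutoff n).continuous⟩ * h - h)).adjoint u := by
    rw [tensor_sub, map_sub, sub_apply]
  have lim : Tendsto (fun n => ∫ t in Ioo (-1 : ℝ) 1, (crossCutoff n t * h t - h t) ^ 2) atTop
      (𝓝 (∫ t in Ioo (-1 : ℝ) 1, (0 : ℝ))) := by
    refine tendsto_integral_of_dominated_convergence (fun t => h t ^ 2) (fun n => ?_)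
      (integrable_of_continuous_Ioo (h.continuous.pow 2)) (fun n => ?_) ?_
    · exact Continuous.aestronglyMeasurable
        ((((crossCutoff n).continuous.mul h.continuous).sub h.continuous).pow 2)
    · refine Eventually.of_forall fun t => ?_
      have h0 := (crossCutoff n).nonneg (x := t)
      have h1 := (crossCutoff n).le_one (x := t)
      rw [Real.norm_of_nonneg (sq_nonneg _), ← sub_one_mul, mul_pow]
      refine mul_le_of_le_one_left (sq_nonneg _) ?_
      nlinarith
    · filter_upwards [ae_restrict_mem measurableSet_Ioo] with t ht
      have := (((tendsto_crossCutoff ht).mul_const (h t)).sub_const (h t)).pow 2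
      simpa using this
  rw [integral_zero] at lim
  refine squeeze_zero (fun n => norm_nonneg _) (fun n => ?_)
    (by simpa using (lim.sqrt).mul_const ‖u‖)
  rw [e]
  exact norm_adjoint_tensor_le _ u

theorem IsWeakDeriv.adjoint_tensor {u us : L2Strip} (hu : IsWeakDeriv strip (1, 0) u us)
    {h : C(ℝ, ℝ)} (hh : ContDiff ℝ ∞ h) :
    ((tensor h).adjoint u, (tensor h).adjoint us) ∈ lineH1 := by
  refine isClosed_lineH1.mem_of_tendsto ((tendsto_adjoint_tensor_cutoff h u).prodMk_nhds
    (tendsto_adjoint_tensor_cutoff h us)) (Eventually.of_forall fun n => ?_)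
  change _ ∈ lineH1
  rw [mem_lineH1]
  intro ψ k1 k2
  have hs : ContDiff ℝ ∞ (fun t => crossCutoff n t * h t) := (crossCutoff n).contDiff.mul hh
  have hc : HasCompactSupport (fun t => crossCutoff n t * h t) :=
    (crossCutoff n).hasCompactSupport.mul_right
  have ht : tsupport (fun t => crossCutoff n t * h t) ⊆ Ioo (-1) 1 :=
    (tsupport_mul_subset_left).trans (tsupport_crossCutoff n)
  have := hu (fun p => ψ p.1 * (crossCutoff n p.2 * h p.2))
    ((k1.comp contDiff_fst).mul (hs.comp contDiff_snd)) (hasCompactSupport_prod_mul k2 hc).2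
    ((hasCompactSupport_prod_mul k2 hc).1.trans (prod_mono (subset_univ _) ht))
  simp only [hasFDerivAt_prod_mul k1 hs, mul_one, mul_zero, add_zero] at this
  simp only
  rw [← pairing_strip (k1.continuous_deriv (by simp)) k2.deriv, ← pairing_strip k1.continuous k2]
  exact this

/-- A cutoff function that equals `1` near `[-1, 1]`. -/
def wideCutoff : ContDiffBump (0 : ℝ) := ⟨2, 3, by norm_num, by norm_num⟩

theorem wideCutoff_eventuallyEq {t : ℝ} (ht : t ∈ Icc (-1 : ℝ) 1) : wideCutoff =ᶠ[𝓝 t] 1 := by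
  refine wideCutoff.eventuallyEq_one_of_mem_ball ?_
  rw [mem_ball_zero_iff, Real.norm_eq_abs]
  exact (abs_le.2 ht).trans_lt (by norm_num [wideCutoff])

/-- Green's formula for the test function `ψ(s) h(t)`. Compact support in `t` is arranged by
`wideCutoff`, which changes neither the integrals nor the boundary values. -/
theorem HasTraces.adjoint_tensor {u ut : L2Strip} {a b : L2Line} (hu : HasTraces u ut a b)
    {h h' : C(ℝ, ℝ)} (hh : ContDiff ℝ ∞ h) (hd : ∀ t, HasDerivAt h (h' t) t) :
    (tensor h).adjoint ut =
      (h 1 : ℂ) • b - (h (-1) : ℂ) • a - (tensor h').adjoint u := by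
  refine eq_of_pairing_line fun ψ k1 k2 => ?_
  have hs : ContDiff ℝ ∞ (fun t => wideCutoff t * h t) := wideCutoff.contDiff.mul hh
  have hc : HasCompactSupport (fun t => wideCutoff t * h t) :=
    wideCutoff.hasCompactSupport.mul_right
  have := hu (fun p => ψ p.1 * (wideCutoff p.2 * h p.2))
    ((k1.comp contDiff_fst).mul (hs.comp contDiff_snd)) (hasCompactSupport_prod_mul k2 hc).2
  have e1 : ∫ p in strip, (ψ p.1 * (wideCutoff p.2 * h p.2)) • ut p
      = ∫ p in strip, (ψ p.1 * h p.2) • ut p := by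
    refine setIntegral_congr_fun isOpen_strip.measurableSet fun p hp => ?_
    rw [(wideCutoff_eventuallyEq (Ioo_subset_Icc_self hp.2)).eq_of_nhds, Pi.one_apply, one_mul]
  have e2 : ∫ p in strip, (fderiv ℝ (fun p => ψ p.1 * (wideCutoff p.2 * h p.2)) p (0, 1)) • u p
      = ∫ p in strip, (ψ p.1 * h' p.2) • u p := by
    refine setIntegral_congr_fun isOpen_strip.measurableSet fun p hp => ?_
    have : (fun t => wideCutoff t * h t) =ᶠ[𝓝 p.2] h := by
      filter_upwards [wideCutoff_eventuallyEq (Ioo_subset_Icc_self hp.2)] with t ht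
      rw [ht, Pi.one_apply, one_mul]
    have k := hasFDerivAt_prod_mul k1 hs p (0, 1)
    simp only [mul_one, mul_zero, zero_add] at k
    rw [k, this.deriv_eq, (hd _).deriv]
  rw [e1, e2, pairing_strip k1.continuous k2, pairing_strip k1.continuous k2] at this
  change _ = (∫ s, (ψ s * (wideCutoff 1 * h 1)) • b s)
    - (∫ s, (ψ s * (wideCutoff (-1) * h (-1))) • a s) - _ at this
  rw [(wideCutoff_eventuallyEq (t := 1) (by simp)).eq_of_nhds,
    (wideCutoff_eventuallyEq (t := -1) (by simp)).eq_of_nhds] at this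
  simp only [Pi.one_apply, one_mul] at this
  have e3 (c : ℝ) (w : L2Line) : ∫ s, (ψ s * c) • w s = ∫ s, ψ s • ((c : ℂ) • w : L2Line) s := by
    refine integral_congr_ae ?_
    filter_upwards [Lp.coeFn_smul (c : ℂ) w] with s hs
    rw [hs, Pi.smul_apply, Complex.coe_smul, smul_smul]
  have e4 (v w : L2Line) : ∫ s, ψ s • (v - w : L2Line) s
      = (∫ s, ψ s • v s) - ∫ s, ψ s • w s := by
    rw [← integral_sub (integrable_pairing k1.continuous k2 v)
      (integrable_pairing k1.continuous k2 w)]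
    refine integral_congr_ae ?_
    filter_upwards [Lp.coeFn_sub v w] with s hs
    rw [hs, Pi.sub_apply, smul_sub]
  rw [this, e3, e3, e4, e4]

/-! ### Traces and weak derivatives of product fields -/

theorem integral_Ioo_eq_intervalIntegral {E : Type*} [NormedAddCommGroup E] [NormedSpace ℝ E]
    (f : ℝ → E) : ∫ t in Ioo (-1 : ℝ) 1, f t = ∫ t in (-1 : ℝ)..1, f t := by
  rw [intervalIntegral.integral_of_le (by norm_num), integral_Ioc_eq_integral_Ioo]

theorem setIntegral_strip_tensor {F : ℝ × ℝ → ℝ} (h : C(ℝ, ℝ)) (a : L2Line) :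
    ∫ p in strip, F p • tensor h a p = ∫ p, (F p * h p.2) • a p.1
      ∂((volume : Measure ℝ).prod (volume.restrict (Ioo (-1 : ℝ) 1))) := by
  rw [← volume_restrict_strip]
  refine integral_congr_ae ?_
  filter_upwards [coeFn_tensor h a] with p hp
  rw [hp, smul_smul]

theorem integrable_smul_line {F : ℝ × ℝ → ℝ} (hF : Continuous F) (hc : HasCompactSupport F)
    (a : L2Line) : Integrable (fun p : ℝ × ℝ => F p • a p.1)
      ((volume : Measure ℝ).prod (volume.restrict (Ioo (-1 : ℝ) 1))) := by
  rw [← volume_restrict_strip]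
  refine (integrable_pairing hF hc (tensor 1 a)).congr ?_
  filter_upwards [coeFn_tensor 1 a] with p hp
  rw [hp, ContinuousMap.one_apply, one_smul]

/-- By Fubini, Green's formula reduces for each fixed `s` to the fundamental theorem of calculus for
`φ(s, ·) h`. Such products supply explicit elements of the operator domain. -/
theorem hasTraces_tensor {h h' : C(ℝ, ℝ)} (hd : ∀ t, HasDerivAt h (h' t) t) (a : L2Line) :
    HasTraces (tensor h a) (tensor h' a) ((h (-1) : ℂ) • a : L2Line) ((h 1 : ℂ) • a : L2Line) := by
  intro φ k1 k2
  have hφt (s t : ℝ) : HasDerivAt (fun t => φ (s, t)) (fderiv ℝ φ (s, t) (0, 1)) t := by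
    have h1 : HasFDerivAt φ (fderiv ℝ φ (s, t)) (s, t) :=
      (k1.differentiable (by simp) _).hasFDerivAt
    exact h1.comp_hasDerivAt t ((hasDerivAt_const t s).prodMk (hasDerivAt_id t))
  have c0 := continuous_fderiv_apply k1 (0, 1)
  have s0 := hasCompactSupport_fderiv_apply k2 (0, 1)
  have i1 : Integrable (fun p : ℝ × ℝ => (φ p * h' p.2) • a p.1)
      ((volume : Measure ℝ).prod (volume.restrict (Ioo (-1 : ℝ) 1))) :=
    integrable_smul_line (k1.continuous.mul (h'.continuous.comp continuous_snd)) k2.mul_right a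
  have i2 : Integrable (fun p : ℝ × ℝ => (fderiv ℝ φ p (0, 1) * h p.2) • a p.1)
      ((volume : Measure ℝ).prod (volume.restrict (Ioo (-1 : ℝ) 1))) :=
    integrable_smul_line (c0.mul (h.continuous.comp continuous_snd)) s0.mul_right a
  have e1 (c t : ℝ) : ∫ s, φ (s, t) • ((c : ℂ) • a : L2Line) s = ∫ s, (φ (s, t) * c) • a s := by
    refine integral_congr_ae ?_
    filter_upwards [Lp.coeFn_smul (c : ℂ) a] with s hs
    rw [hs, Pi.smul_apply, Complex.coe_smul, smul_smul]
  have j (t : ℝ) : Integrable (fun s => (φ (s, t) * h t) • a s) volume :=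
    integrable_pairing ((continuous_lineSlice k1.continuous t).mul continuous_const)
      (hasCompactSupport_lineSlice k2 t).mul_right a
  rw [eq_sub_iff_add_eq, setIntegral_strip_tensor, setIntegral_strip_tensor, ← integral_add i1 i2,
    integral_prod _ (show Integrable (fun p : ℝ × ℝ => (φ p * h' p.2) • a p.1 +
      (fderiv ℝ φ p (0, 1) * h p.2) • a p.1) _ from i1.add i2), e1, e1, ← integral_sub (j 1) (j (-1))]
  refine integral_congr_ae (Eventually.of_forall fun s => ?_)
  simp only [← add_smul, ← sub_smul]
  rw [integral_smul_const, integral_Ioo_eq_intervalIntegral]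
  congr 1
  refine intervalIntegral.integral_eq_sub_of_hasDerivAt (f := fun t => φ (s, t) * h t)
    (fun t _ => ?_) (Continuous.intervalIntegrable ?_ _ _)
  · convert! (hφt s t).mul (hd t) using 1
    ring
  · have := h.continuous
    have := h'.continuous
    have := k1.continuous
    have := c0.comp (Continuous.prodMk_right s)
    simp only [Function.comp_def] at this
    fun_prop

theorem isWeakDeriv_tensor (h : C(ℝ, ℝ)) {a a' : L2Line} (ha : (a, a') ∈ lineH1) :
    IsWeakDeriv strip (1, 0) (tensor h a) (tensor h a') := by
  intro φ k1 k2 _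
  rw [mem_lineH1] at ha
  have hφs (s t : ℝ) : HasDerivAt (fun s => φ (s, t)) (fderiv ℝ φ (s, t) (1, 0)) s := by
    have h1 : HasFDerivAt φ (fderiv ℝ φ (s, t)) (s, t) :=
      (k1.differentiable (by simp) _).hasFDerivAt
    exact h1.comp_hasDerivAt s ((hasDerivAt_id s).prodMk (hasDerivAt_const s t))
  have c0 := continuous_fderiv_apply k1 (1, 0)
  have s0 := hasCompactSupport_fderiv_apply k2 (1, 0)
  have i1 : Integrable (fun p : ℝ × ℝ => (φ p * h p.2) • a' p.1)
      ((volume : Measure ℝ).prod (volume.restrict (Ioo (-1 : ℝ) 1))) :=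
    integrable_smul_line (k1.continuous.mul (h.continuous.comp continuous_snd)) k2.mul_right a'
  have i2 : Integrable (fun p : ℝ × ℝ => (fderiv ℝ φ p (1, 0) * h p.2) • a p.1)
      ((volume : Measure ℝ).prod (volume.restrict (Ioo (-1 : ℝ) 1))) :=
    integrable_smul_line (c0.mul (h.continuous.comp continuous_snd)) s0.mul_right a
  rw [setIntegral_strip_tensor, setIntegral_strip_tensor, integral_prod_symm _ i1,
    integral_prod_symm _ i2, ← integral_neg]
  refine integral_congr_ae (Eventually.of_forall fun t => ?_)
  have := ha (fun s => φ (s, t)) (k1.comp (contDiff_id.prodMk contDiff_const))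
    (hasCompactSupport_lineSlice k2 t)
  simp only [(hφs _ t).deriv] at this
  simp only [mul_comm _ (h t), mul_smul, integral_smul]
  rw [this, smul_neg]

theorem HasTraces.isWeakDeriv {u ut : L2Strip} {a b : L2Line} (h : HasTraces u ut a b) :
    IsWeakDeriv strip (0, 1) u ut := by
  intro φ k1 k2 k3
  have z1 (s : ℝ) : φ (s, 1) = 0 := image_eq_zero_of_notMem_tsupport fun hx => by
    simpa [strip] using k3 hx
  have z2 (s : ℝ) : φ (s, -1) = 0 := image_eq_zero_of_notMem_tsupport fun hx => by
    simpa [strip] using k3 hx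
  have := h φ k1 k2
  simp only [z1, z2, zero_smul, integral_zero, sub_zero, zero_sub] at this
  rw [this, neg_neg]

/-! ### The domain of the Dirac operators on the strip -/

theorem act_apply (A : Matrix (Fin 2) (Fin 2) ℂ) (x : Spinor) (i : Fin 2) :
    act A x i = A i 0 * x 0 + A i 1 * x 1 := by
  rw [act, Matrix.ofLp_toEuclideanCLM, Matrix.mulVec, dotProduct, Fin.sum_univ_two]

/-- As the vanishing of a bounded operator, the boundary condition is visibly linear and closed. -/
theorem boundary_top_iff (b : L2Line) :
    (∀ᵐ s, b s 1 = - b s 0) ↔ lift (1 + σ₁) b = 0 := by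
  rw [Lp.eq_zero_iff_ae_eq_zero]
  have key (x : Spinor) : x 1 = - x 0 ↔ act (1 + σ₁) x = 0 := by
    constructor
    · intro h
      ext i; fin_cases i <;> simp [act_apply, σ₁, h]
    · intro h
      have := congrArg (fun y : Spinor => y 0) h
      simp [act_apply, σ₁] at this
      linear_combination this
  constructor
  · intro h
    filter_upwards [h, coeFn_lift (1 + σ₁) b] with s h1 h2
    rw [h2, (key _).1 h1, Pi.zero_apply]
  · intro h
    filter_upwards [h, coeFn_lift (1 + σ₁) b] with s h1 h2
    exact (key _).2 (by rw [← h2, h1, Pi.zero_apply])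

theorem boundary_bot_iff (a : L2Line) :
    (∀ᵐ s, a s 1 = a s 0) ↔ lift (1 - σ₁) a = 0 := by
  rw [Lp.eq_zero_iff_ae_eq_zero]
  have key (x : Spinor) : x 1 = x 0 ↔ act (1 - σ₁) x = 0 := by
    constructor
    · intro h
      ext i; fin_cases i <;> simp [act_apply, σ₁, h]
    · intro h
      have := congrArg (fun y : Spinor => y 0) h
      simp [act_apply, σ₁] at this
      linear_combination -this
  constructor
  · intro h
    filter_upwards [h, coeFn_lift (1 - σ₁) a] with s h1 h2
    rw [h2, (key _).1 h1, Pi.zero_apply]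
  · intro h
    filter_upwards [h, coeFn_lift (1 - σ₁) a] with s h1 h2
    exact (key _).2 (by rw [← h2, h1, Pi.zero_apply])

/-- The common domain of the Dirac operators on the strip, as a space of triples
`(u, ∂ₛ u, ∂ₜ u)`. -/
def stripH1 : Submodule ℂ (L2Strip × L2Strip × L2Strip) where
  carrier := {z | IsStripDomain z.1 z.2.1 z.2.2}
  zero_mem' := by
    refine ⟨.zero, .zero, 0, 0, .zero, ?_, ?_⟩
    · exact (boundary_top_iff 0).2 (map_zero _)
    · exact (boundary_bot_iff 0).2 (map_zero _)
  add_mem' := by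
    rintro z z' ⟨h1, h2, a, b, h3, h4, h5⟩ ⟨h1', h2', a', b', h3', h4', h5'⟩
    rw [boundary_top_iff] at h4 h4'
    rw [boundary_bot_iff] at h5 h5'
    refine ⟨h1.add h1', h2.add h2', a + a', b + b', h3.add h3', ?_, ?_⟩
    · rw [boundary_top_iff, map_add, h4, h4', add_zero]
    · rw [boundary_bot_iff, map_add, h5, h5', add_zero]
  smul_mem' := by
    rintro c z ⟨h1, h2, a, b, h3, h4, h5⟩
    rw [boundary_top_iff] at h4
    rw [boundary_bot_iff] at h5
    refine ⟨h1.smul c, h2.smul c, c • a, c • b, h3.smul c, ?_, ?_⟩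
    · rw [boundary_top_iff, map_smul, h4, smul_zero]
    · rw [boundary_bot_iff, map_smul, h5, smul_zero]

theorem mem_stripH1 {z : L2Strip × L2Strip × L2Strip} :
    z ∈ stripH1 ↔ IsStripDomain z.1 z.2.1 z.2.2 := Iff.rfl

/-- The trace on `t = 1` of a function with square integrable derivative. -/
def traceTop : L2Strip × L2Strip × L2Strip →L[ℂ] L2Line :=
  (tensor ⟨fun t => (1 + t) / 2, by fun_prop⟩).adjoint ∘L
      ContinuousLinearMap.snd ℂ _ _ ∘L ContinuousLinearMap.snd ℂ _ _ +
    (tensor (ContinuousMap.const ℝ (1 / 2))).adjoint ∘L ContinuousLinearMap.fst ℂ _ _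

/-- The trace on `t = -1` of a function with square integrable derivative. -/
def traceBot : L2Strip × L2Strip × L2Strip →L[ℂ] L2Line :=
  (tensor ⟨fun t => (-1 + t) / 2, by fun_prop⟩).adjoint ∘L
      ContinuousLinearMap.snd ℂ _ _ ∘L ContinuousLinearMap.snd ℂ _ _ +
    (tensor (ContinuousMap.const ℝ (1 / 2))).adjoint ∘L ContinuousLinearMap.fst ℂ _ _

/-- The weight `(1 + t)/2` vanishes at `-1` and equals `1` at `1`, so Green's formula isolates the
upper trace. Traces are thus unique and depend boundedly on `u` and `∂ₜu`. -/
theorem HasTraces.eq_traceTop {z : L2Strip × L2Strip × L2Strip} {a b : L2Line}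
    (h : HasTraces z.1 z.2.2 a b) : b = traceTop z := by
  have := h.adjoint_tensor (h := ⟨fun t => (1 + t) / 2, by fun_prop⟩)
    (h' := ContinuousMap.const ℝ (1 / 2)) (by
      change ContDiff ℝ ∞ fun t : ℝ => (1 + t) / 2
      fun_prop) (fun t => ((hasDerivAt_id t).const_add 1).div_const 2)
  simp only [traceTop, add_apply, ContinuousLinearMap.comp_apply,
    ContinuousLinearMap.coe_fst', ContinuousLinearMap.coe_snd']
  rw [this]
  norm_num

theorem HasTraces.eq_traceBot {z : L2Strip × L2Strip × L2Strip} {a b : L2Line}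
    (h : HasTraces z.1 z.2.2 a b) : a = traceBot z := by
  have := h.adjoint_tensor (h := ⟨fun t => (-1 + t) / 2, by fun_prop⟩)
    (h' := ContinuousMap.const ℝ (1 / 2)) (by
      change ContDiff ℝ ∞ fun t : ℝ => (-1 + t) / 2
      fun_prop) (fun t => ((hasDerivAt_id t).const_add (-1)).div_const 2)
  simp only [traceBot, add_apply, ContinuousLinearMap.comp_apply,
    ContinuousLinearMap.coe_fst', ContinuousLinearMap.coe_snd']
  rw [this]
  norm_num

/-- The quantifier over traces is gone, and Green's formula already contains the weak derivative in
`t`. Every remaining condition is closed in the triple. -/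
theorem mem_stripH1_iff {z : L2Strip × L2Strip × L2Strip} : z ∈ stripH1 ↔
    IsWeakDeriv strip (1, 0) z.1 z.2.1 ∧ HasTraces z.1 z.2.2 (traceBot z) (traceTop z) ∧
      lift (1 + σ₁) (traceTop z) = 0 ∧ lift (1 - σ₁) (traceBot z) = 0 := by
  rw [mem_stripH1]
  constructor
  · rintro ⟨h1, -, a, b, h3, h4, h5⟩
    obtain rfl := h3.eq_traceTop
    obtain rfl := h3.eq_traceBot
    exact ⟨h1, h3, (boundary_top_iff _).1 h4, (boundary_bot_iff _).1 h5⟩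
  · rintro ⟨h1, h2, h3, h4⟩
    exact ⟨h1, h2.isWeakDeriv, _, _, h2, (boundary_top_iff _).2 h3, (boundary_bot_iff _).2 h4⟩

theorem isClosed_stripH1 : IsClosed (stripH1 : Set (L2Strip × L2Strip × L2Strip)) := by
  have e : (stripH1 : Set (L2Strip × L2Strip × L2Strip)) =
      (⋂ (φ : ℝ × ℝ → ℝ) (_ : ContDiff ℝ ∞ φ) (_ : HasCompactSupport φ) (_ : tsupport φ ⊆ strip),
        {z | ∫ p in strip, (fderiv ℝ φ p (1, 0)) • z.1 p = - ∫ p in strip, φ p • z.2.1 p}) ∩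
      (⋂ (φ : ℝ × ℝ → ℝ) (_ : ContDiff ℝ ∞ φ) (_ : HasCompactSupport φ),
        {z | ∫ p in strip, φ p • z.2.2 p = (∫ s, φ (s, 1) • traceTop z s) -
          (∫ s, φ (s, -1) • traceBot z s) - ∫ p in strip, (fderiv ℝ φ p (0, 1)) • z.1 p}) ∩
      ({z | lift (1 + σ₁) (traceTop z) = 0} ∩ {z | lift (1 - σ₁) (traceBot z) = 0}) := by
    ext z
    simp only [SetLike.mem_coe, mem_stripH1_iff, IsWeakDeriv, HasTraces, mem_inter_iff, mem_iInter,
      mem_ofPred_eq, and_assoc]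
  rw [e]
  refine (IsClosed.inter ?_ ?_).inter (IsClosed.inter ?_ ?_)
  · refine isClosed_iInter fun φ => isClosed_iInter fun k1 => isClosed_iInter fun k2 =>
      isClosed_iInter fun _ => isClosed_eq ?_ ?_
    · exact (continuous_pairing (continuous_fderiv_apply k1 _)
        (hasCompactSupport_fderiv_apply k2 _)).comp continuous_fst
    · exact ((continuous_pairing k1.continuous k2).comp (continuous_fst.comp continuous_snd)).neg
  · refine isClosed_iInter fun φ => isClosed_iInter fun k1 => isClosed_iInter fun k2 =>
      isClosed_eq ?_ ((Continuous.sub ?_ ?_).sub ?_)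
    · exact (continuous_pairing k1.continuous k2).comp (continuous_snd.comp continuous_snd)
    · exact (continuous_pairing (continuous_lineSlice k1.continuous 1)
        (hasCompactSupport_lineSlice k2 1)).comp traceTop.continuous
    · exact (continuous_pairing (continuous_lineSlice k1.continuous (-1))
        (hasCompactSupport_lineSlice k2 (-1))).comp traceBot.continuous
    · exact (continuous_pairing (continuous_fderiv_apply k1 _)
        (hasCompactSupport_fderiv_apply k2 _)).comp continuous_fst
  · exact isClosed_eq ((lift _).continuous.comp traceTop.continuous) continuous_const
  · exact isClosed_eq ((lift _).continuous.comp traceBot.continuous) continuous_const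

/-! ### Completeness of the transverse modes -/

/-- The eigenvalues `π / 4 + j π`, `j ∈ ℤ`; together with their negatives, they form the spectrum
of the transverse operator. -/
def freq (j : ℤ) : ℝ := Real.pi / 4 + j * Real.pi

/-- With `y = t + 1`, reflection of `f` about `-1` gives an even function on `(-2, 2)`. Its
integrals against `exp (-i(2n+1)πy/4)` are twice the given cosine integrals, so after a twist all
Fourier coefficients of period `4` vanish and Parseval applies. -/
theorem ae_eq_zero_of_cos_odd {f : ℝ → ℂ} (hf : MemLp f 2 volume)
    (hs : ∀ t, t ∉ Ioo (-1 : ℝ) 1 → f t = 0)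
    (h : ∀ n : ℤ, ∫ t, (Real.cos ((2 * n + 1) * Real.pi / 4 * (t + 1)) : ℂ) * f t = 0) :
    f =ᵐ[volume] 0 := by
  have m1 : MeasurePreserving (fun y : ℝ => y - 1) volume volume := measurePreserving_sub_right _ _
  have m2 : MeasurePreserving (fun y : ℝ => -1 - y) volume volume :=
    Measure.measurePreserving_sub_left volume (-1)
  have f1 : MemLp (fun y => f (y - 1)) 2 volume := hf.comp_measurePreserving m1
  have f2 : MemLp (fun y => f (-1 - y)) 2 volume := hf.comp_measurePreserving m2
  let E (l y : ℝ) : ℂ := Complex.exp (-(l * y * Complex.I))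
  have hE (l y : ℝ) : ‖E l y‖ = 1 := by
    simp only [E]
    rw [← neg_mul, ← Complex.ofReal_mul, ← Complex.ofReal_neg, Complex.norm_exp_ofReal_mul_I]
  have cE (l : ℝ) : Continuous (E l) := by fun_prop
  -- The factor `exp (-iπy/4)` shifts the frequencies `nπ/2` of the period-`4` basis to the odd
  -- multiples of `π/4`.
  let g : ℝ → ℂ := fun y => E (Real.pi / 4) y * (f (y - 1) + f (-1 - y))
  have hg : MemLp g 2 volume := (f1.add f2).of_le
    ((cE _).aestronglyMeasurable.mul (f1.add f2).1) (Eventually.of_forall fun y => by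
      simp only [g, norm_mul, hE, one_mul, Pi.add_apply]
      exact le_rfl)
  have hf1 : Integrable f volume := by
    have : IntegrableOn f (Ioo (-1 : ℝ) 1) volume :=
      (hf.mono_measure Measure.restrict_le_self).integrable (by norm_num)
    rw [← integrableOn_univ]
    refine IntegrableOn.of_forall_sdiff_eq_zero this MeasurableSet.univ fun t ht => hs t ht.2
  have hEi (l : ℝ) {k : ℝ → ℂ} (hk : Integrable k volume) : Integrable (fun y => E l y * k y) volume :=
    hk.bdd_mul (cE l).aestronglyMeasurable (Eventually.of_forall fun y => (hE l y).le)
  have i1 : Integrable (fun y => f (y - 1)) volume := m1.integrable_comp_of_integrable hf1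
  have i2 : Integrable (fun y => f (-1 - y)) volume := m2.integrable_comp_of_integrable hf1
  have hcoef (n : ℤ) : fourierCoeffOn (by norm_num : (-2 : ℝ) < 2) g n = 0 := by
    rw [fourierCoeffOn_eq_integral, intervalIntegral.integral_of_le (by norm_num)]
    have e0 (y : ℝ) : fourier (-n) (y : AddCircle ((2 : ℝ) - -2)) • g y =
        E ((2 * n + 1) * Real.pi / 4) y * f (y - 1)
          + E ((2 * n + 1) * Real.pi / 4) y * f (-1 - y) := by
      rw [fourier_coe_apply, smul_eq_mul, ← mul_add]
      simp only [g, E]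
      rw [← mul_assoc, ← Complex.exp_add]
      congr 2
      push_cast
      ring
    have e1 : ∫ y in Ioc (-2 : ℝ) 2, fourier (-n) (y : AddCircle ((2 : ℝ) - -2)) • g y =
        ∫ y, (E ((2 * n + 1) * Real.pi / 4) y * f (y - 1)
          + E ((2 * n + 1) * Real.pi / 4) y * f (-1 - y)) := by
      simp only [e0]
      refine setIntegral_eq_integral_of_forall_compl_eq_zero fun y hy => ?_
      rw [hs (y - 1), hs (-1 - y), mul_zero, add_zero]
      · exact fun h => hy ⟨by linarith [h.1, h.2], by linarith [h.1, h.2]⟩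
      · exact fun h => hy ⟨by linarith [h.1, h.2], by linarith [h.1, h.2]⟩
    have e2 : ∫ y, E ((2 * n + 1) * Real.pi / 4) y * f (y - 1)
        = ∫ t, E ((2 * n + 1) * Real.pi / 4) (t + 1) * f t := by
      rw [← integral_sub_right_eq_self (fun t => E ((2 * n + 1) * Real.pi / 4) (t + 1) * f t) 1]
      simp only [sub_add_cancel]
    have e3 : ∫ y, E ((2 * n + 1) * Real.pi / 4) y * f (-1 - y)
        = ∫ t, E ((2 * n + 1) * Real.pi / 4) (-(t + 1)) * f t := by
      rw [← integral_sub_left_eq_self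
        (fun t => E ((2 * n + 1) * Real.pi / 4) (-(t + 1)) * f t) volume (-1)]
      refine integral_congr_ae (Eventually.of_forall fun y => ?_)
      simp only
      congr 2
      ring
    have j1 : Integrable (fun t => E ((2 * n + 1) * Real.pi / 4) (t + 1) * f t) volume :=
      hf1.bdd_mul ((cE _).comp (continuous_add_const 1)).aestronglyMeasurable
        (Eventually.of_forall fun y => (hE _ _).le)
    have j2 : Integrable (fun t => E ((2 * n + 1) * Real.pi / 4) (-(t + 1)) * f t) volume :=
      hf1.bdd_mul ((cE _).comp (continuous_add_const 1).neg).aestronglyMeasurable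
        (Eventually.of_forall fun y => (hE _ _).le)
    rw [e1, integral_add (hEi _ i1) (hEi _ i2), e2, e3, ← integral_add j1 j2]
    have e4 (t : ℝ) : E ((2 * n + 1) * Real.pi / 4) (t + 1) * f t
        + E ((2 * n + 1) * Real.pi / 4) (-(t + 1)) * f t
        = 2 * ((Real.cos ((2 * n + 1) * Real.pi / 4 * (t + 1)) : ℂ) * f t) := by
      rw [← add_mul, ← mul_assoc, Complex.ofReal_cos, Complex.two_cos]
      simp only [E]
      rw [add_comm]
      push_cast
      ring_nf
    simp only [e4]
    rw [integral_const_mul, h n, mul_zero, smul_zero]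
  have hsum := hasSum_sq_fourierCoeffOn (by norm_num : (-2 : ℝ) < 2)
    (hg.mono_measure (Measure.restrict_le_self (s := Ioc (-2 : ℝ) 2)))
  simp only [hcoef, norm_zero, ne_eq, OfNat.ofNat_ne_zero, not_false_eq_true, zero_pow] at hsum
  have h0 := hsum.unique hasSum_zero
  rw [smul_eq_zero, intervalIntegral.integral_of_le (by norm_num)] at h0
  have h1 := h0.resolve_left (by norm_num)
  rw [integral_eq_zero_iff_of_nonneg (fun y => sq_nonneg _)
    (hg.mono_measure Measure.restrict_le_self).norm.integrable_sq] at h1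
  -- For `y` in `(0, 2)` the reflected summand of `g` is zero, so there `|g y| = |f (y - 1)|`.
  have h2 : ∀ᵐ y : ℝ, f (y - 1) = 0 := by
    filter_upwards [(ae_restrict_iff' measurableSet_Ioc).1 h1] with y hy
    by_cases hy1 : y - 1 ∈ Ioo (-1 : ℝ) 1
    · have k := hy ⟨by linarith [hy1.1], by linarith [hy1.2]⟩
      have k2 : f (-1 - y) = 0 := hs _ fun h => by linarith [h.1, hy1.1]
      simp only [g, k2, add_zero, norm_mul, hE, one_mul, Pi.zero_apply] at k
      exact norm_eq_zero.1 (pow_eq_zero_iff two_ne_zero |>.1 k)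
    · exact hs _ hy1
  have m3 : MeasurePreserving (fun y : ℝ => y + 1) volume volume := measurePreserving_add_right _ _
  filter_upwards [m3.quasiMeasurePreserving.ae h2] with t ht
  simpa using ht

/-- Here `freq j = (4j + 1)π/4`. Since the cosine is even, the missing odd numbers `4j + 3 = -(4(-j
- 1) + 1)` are covered by the index `-j - 1`. -/
theorem cos_odd_of_cos_freq {f : ℝ → ℂ}
    (h : ∀ j : ℤ, ∫ t, (Real.cos (freq j * (t + 1)) : ℂ) * f t = 0) (n : ℤ) :
    ∫ t, (Real.cos ((2 * n + 1) * Real.pi / 4 * (t + 1)) : ℂ) * f t = 0 := by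
  obtain ⟨j, rfl | rfl⟩ := n.even_or_odd'
  · rw [← h j]
    refine integral_congr_ae (Eventually.of_forall fun t => ?_)
    simp only [freq]
    congr 3
    push_cast
    ring
  · rw [← h (-j - 1)]
    refine integral_congr_ae (Eventually.of_forall fun t => ?_)
    simp only [freq]
    rw [← Real.cos_neg]
    congr 3
    push_cast
    ring

/-- This is `cos x - sin x = √2 cos (x + π/4)`, where the phase `π/4` equals `freq j` up to the
multiple `jπ`. -/
theorem cos_sub_sin_freq (j : ℤ) (t : ℝ) : Real.cos (freq j * t) - Real.sin (freq j * t) =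
    Real.sqrt 2 * (-1) ^ j * Real.cos (freq j * (t + 1)) := by
  have h1 : freq j * (t + 1) = (freq j * t + Real.pi / 4) + j * Real.pi := by
    simp only [freq]; ring
  have h2 : Real.sqrt 2 * Real.sqrt 2 = 2 := Real.mul_self_sqrt (by norm_num)
  have h3 : ((-1 : ℝ) ^ j) * (-1) ^ j = 1 := by
    rw [← mul_zpow]; norm_num
  rw [h1, Real.cos_add_int_mul_pi, Real.cos_add, Real.cos_pi_div_four, Real.sin_pi_div_four]
  linear_combination (-(Real.cos (freq j * t) - Real.sin (freq j * t)) * Real.sqrt 2 * Real.sqrt 2 / 2) * h3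
    - ((Real.cos (freq j * t) - Real.sin (freq j * t)) / 2) * h2

theorem ae_eq_zero_of_cos_sub_sin {f : ℝ → ℂ} (hf : MemLp f 2 volume)
    (hs : ∀ t, t ∉ Ioo (-1 : ℝ) 1 → f t = 0)
    (h : ∀ j : ℤ, ∫ t, ((Real.cos (freq j * t) - Real.sin (freq j * t) : ℝ) : ℂ) * f t = 0) :
    f =ᵐ[volume] 0 := by
  refine ae_eq_zero_of_cos_odd hf hs (cos_odd_of_cos_freq fun j => ?_)
  have h1 := h j
  have e (t : ℝ) : ((Real.cos (freq j * t) - Real.sin (freq j * t) : ℝ) : ℂ) * f t =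
      ((Real.sqrt 2 * (-1) ^ j : ℝ) : ℂ) * ((Real.cos (freq j * (t + 1)) : ℂ) * f t) := by
    rw [cos_sub_sin_freq, Complex.ofReal_mul (Real.sqrt 2 * (-1) ^ j), mul_assoc]
  simp only [e] at h1
  rw [integral_const_mul] at h1
  refine (mul_eq_zero.1 h1).resolve_left ?_
  refine Complex.ofReal_ne_zero.2 ?_
  exact mul_ne_zero (by positivity) (zpow_ne_zero _ (by norm_num))

theorem ae_eq_zero_of_cos_add_sin {f : ℝ → ℂ} (hf : MemLp f 2 volume)
    (hs : ∀ t, t ∉ Ioo (-1 : ℝ) 1 → f t = 0)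
    (h : ∀ j : ℤ, ∫ t, ((Real.cos (freq j * t) + Real.sin (freq j * t) : ℝ) : ℂ) * f t = 0) :
    f =ᵐ[volume] 0 := by
  have m := Measure.measurePreserving_neg (volume : Measure ℝ)
  have key : (fun t => f (-t)) =ᵐ[volume] 0 := by
    refine ae_eq_zero_of_cos_sub_sin (hf.comp_measurePreserving m)
      (fun t ht => hs _ fun h => ht ⟨by linarith [h.2], by linarith [h.1]⟩) fun j => ?_
    rw [← h j, ← integral_neg_eq_self]
    refine integral_congr_ae (Eventually.of_forall fun t => ?_)
    simp only [mul_neg, Real.cos_neg, Real.sin_neg, neg_neg, sub_neg_eq_add]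
  filter_upwards [m.quasiMeasurePreserving.ae key] with t ht
  simpa using ht

theorem integrable_continuous_smul {E : Type*} [NormedAddCommGroup E] [NormedSpace ℝ E]
    {x : ℝ → E} (hx : Integrable x (volume.restrict (Ioo (-1 : ℝ) 1))) {c : ℝ → ℝ}
    (hc : Continuous c) : Integrable (fun t => c t • x t) (volume.restrict (Ioo (-1 : ℝ) 1)) := by
  obtain ⟨C, hC⟩ := isCompact_Icc.exists_bound_of_continuousOn (hc.continuousOn (s := Icc (-1) 1))
  have h : Integrable (c • x) (volume.restrict (Ioo (-1 : ℝ) 1)) :=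
    hx.bdd_smul C hc.aestronglyMeasurable (by
      filter_upwards [ae_restrict_mem measurableSet_Ioo] with t ht
      exact hC t (Ioo_subset_Icc_self ht))
  exact h

/-- The matrix `cos - sin σ₁` is diagonal in the eigenbasis of `σ₁`: the sum `x + y` is paired with
`cos - sin` and the difference `x - y` with `cos + sin`, so scalar completeness applies to each. -/
theorem ae_eq_zero_of_scalar_modes {x y : ℝ → ℂ}
    (hx : MemLp x 2 (volume.restrict (Ioo (-1 : ℝ) 1)))
    (hy : MemLp y 2 (volume.restrict (Ioo (-1 : ℝ) 1)))
    (h0 : ∀ j : ℤ, (∫ t in Ioo (-1 : ℝ) 1, Real.cos (freq j * t) • x t)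
      = ∫ t in Ioo (-1 : ℝ) 1, Real.sin (freq j * t) • y t)
    (h1 : ∀ j : ℤ, (∫ t in Ioo (-1 : ℝ) 1, Real.cos (freq j * t) • y t)
      = ∫ t in Ioo (-1 : ℝ) 1, Real.sin (freq j * t) • x t) :
    ∀ᵐ t ∂(volume.restrict (Ioo (-1 : ℝ) 1)), x t = 0 ∧ y t = 0 := by
  have hc {z : ℝ → ℂ} (hz : MemLp z 2 (volume.restrict (Ioo (-1 : ℝ) 1))) (j : ℤ) :
      Integrable (fun t => Real.cos (freq j * t) • z t) (volume.restrict (Ioo (-1 : ℝ) 1)) :=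
    integrable_continuous_smul (hz.integrable (by norm_num)) (by fun_prop)
  have hs {z : ℝ → ℂ} (hz : MemLp z 2 (volume.restrict (Ioo (-1 : ℝ) 1))) (j : ℤ) :
      Integrable (fun t => Real.sin (freq j * t) • z t) (volume.restrict (Ioo (-1 : ℝ) 1)) :=
    integrable_continuous_smul (hz.integrable (by norm_num)) (by fun_prop)
  have d1 (j : ℤ) : Integrable (fun t => Real.cos (freq j * t) • x t - Real.sin (freq j * t) • y t)
      (volume.restrict (Ioo (-1 : ℝ) 1)) := (hc hx j).sub (hs hy j)
  have d2 (j : ℤ) : Integrable (fun t => Real.cos (freq j * t) • y t - Real.sin (freq j * t) • x t)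
      (volume.restrict (Ioo (-1 : ℝ) 1)) := (hc hy j).sub (hs hx j)
  have ind (c : ℝ → ℂ) (y : ℝ → ℂ) : ∫ t, c t * (Ioo (-1 : ℝ) 1).indicator y t
      = ∫ t in Ioo (-1 : ℝ) 1, c t * y t := by
    rw [← integral_indicator measurableSet_Ioo]
    simp only [indicator_mul_right]
  have hp : (Ioo (-1 : ℝ) 1).indicator (fun t => x t + y t) =ᵐ[volume] 0 := by
    refine ae_eq_zero_of_cos_sub_sin
      ((memLp_indicator_iff_restrict measurableSet_Ioo).2 (hx.add hy))
      (fun t ht => indicator_of_notMem ht _) fun j => ?_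
    rw [ind]
    have e (t : ℝ) : ((Real.cos (freq j * t) - Real.sin (freq j * t) : ℝ) : ℂ) * (x t + y t) =
        (Real.cos (freq j * t) • x t - Real.sin (freq j * t) • y t)
          + (Real.cos (freq j * t) • y t - Real.sin (freq j * t) • x t) := by
      simp only [Complex.real_smul, Complex.ofReal_sub]; ring
    simp only [e]
    rw [integral_add (d1 j) (d2 j),
      integral_sub (hc hx j) (hs hy j), integral_sub (hc hy j) (hs hx j), h0, h1, sub_self,
      sub_self, add_zero]
  have hq : (Ioo (-1 : ℝ) 1).indicator (fun t => x t - y t) =ᵐ[volume] 0 := by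
    refine ae_eq_zero_of_cos_add_sin
      ((memLp_indicator_iff_restrict measurableSet_Ioo).2 (hx.sub hy))
      (fun t ht => indicator_of_notMem ht _) fun j => ?_
    rw [ind]
    have e (t : ℝ) : ((Real.cos (freq j * t) + Real.sin (freq j * t) : ℝ) : ℂ) * (x t - y t) =
        (Real.cos (freq j * t) • x t - Real.sin (freq j * t) • y t)
          - (Real.cos (freq j * t) • y t - Real.sin (freq j * t) • x t) := by
      simp only [Complex.real_smul, Complex.ofReal_add]; ring
    simp only [e]
    rw [integral_sub (d1 j) (d2 j),
      integral_sub (hc hx j) (hs hy j), integral_sub (hc hy j) (hs hx j), h0, h1, sub_self,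
      sub_self, sub_zero]
  rw [ae_restrict_iff' measurableSet_Ioo]
  filter_upwards [hp, hq] with t h2 h3 ht
  rw [indicator_of_mem ht, Pi.zero_apply] at h2 h3
  exact ⟨by linear_combination h2 / 2 + h3 / 2, by linear_combination h2 / 2 - h3 / 2⟩

/-- A square integrable spinor on `(-1, 1)` that is orthogonal to all transverse modes vanishes. -/
theorem ae_eq_zero_of_modes {x : ℝ → Spinor} (hx : MemLp x 2 (volume.restrict (Ioo (-1 : ℝ) 1)))
    (h : ∀ j : ℤ, (∫ t in Ioo (-1 : ℝ) 1, Real.cos (freq j * t) • x t)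
      - act σ₁ (∫ t in Ioo (-1 : ℝ) 1, Real.sin (freq j * t) • x t) = 0) :
    x =ᵐ[volume.restrict (Ioo (-1 : ℝ) 1)] 0 := by
  have hxi : Integrable x (volume.restrict (Ioo (-1 : ℝ) 1)) := hx.integrable (by norm_num)
  have hco (i : Fin 2) : MemLp (fun t => x t i) 2 (volume.restrict (Ioo (-1 : ℝ) 1)) :=
    (EuclideanSpace.proj (𝕜 := ℂ) i : Spinor →L[ℂ] ℂ).comp_memLp' hx
  have hin {c : ℝ → ℝ} (hc : Continuous c) (i : Fin 2) :
      (∫ t in Ioo (-1 : ℝ) 1, c t • x t) i = ∫ t in Ioo (-1 : ℝ) 1, c t • x t i :=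
    ((EuclideanSpace.proj (𝕜 := ℂ) i : Spinor →L[ℂ] ℂ).integral_comp_comm
      (integrable_continuous_smul hxi hc)).symm
  have hcc (j : ℤ) : Continuous fun t => Real.cos (freq j * t) := by fun_prop
  have hcs (j : ℤ) : Continuous fun t => Real.sin (freq j * t) := by fun_prop
  have key (j : ℤ) (i : Fin 2) := congrArg (fun y : Spinor => y i) (h j)
  simp only [PiLp.sub_apply, act_apply, PiLp.zero_apply, hin (hcc _), hin (hcs _)] at key
  have h0 := ae_eq_zero_of_scalar_modes (hco 0) (hco 1)
    (fun j => by simpa [σ₁, sub_eq_zero] using key j 0)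
    (fun j => by simpa [σ₁, sub_eq_zero] using key j 1)
  filter_upwards [h0] with t ht
  ext i
  fin_cases i
  · exact ht.1
  · exact ht.2

theorem coeFn_adjoint_tensor (h : C(ℝ, ℝ)) (u : L2Strip) :
    ((tensor h).adjoint u : L2Line) =ᵐ[volume] fun s => ∫ t in Ioo (-1 : ℝ) 1, h t • u (s, t) := by
  refine ae_eq_of_integral_contDiff_smul_eq ((Lp.memLp _).locallyIntegrable (by norm_num)) ?_ ?_
  · rw [locallyIntegrable_iff]
    intro K hK
    have e : ((volume : Measure ℝ).restrict K).prod (volume.restrict (Ioo (-1 : ℝ) 1))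
        = (volume.restrict strip).restrict (K ×ˢ univ) := by
      rw [volume_restrict_strip, ← Measure.prod_restrict, Measure.restrict_univ]
    have : IsFiniteMeasure ((volume : Measure ℝ).restrict K) := ⟨by
      rw [Measure.restrict_apply_univ]; exact hK.measure_lt_top⟩
    have hu : MemLp u 2 (((volume : Measure ℝ).restrict K).prod
        (volume.restrict (Ioo (-1 : ℝ) 1))) := by
      rw [e]
      exact (Lp.memLp u).mono_measure Measure.restrict_le_self
    obtain ⟨C, hC⟩ := isCompact_Icc.exists_bound_of_continuousOn
      (h.continuous.continuousOn (s := Icc (-1) 1))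
    have hi : Integrable ((fun p : ℝ × ℝ => h p.2) • (u : ℝ × ℝ → Spinor))
        (((volume : Measure ℝ).restrict K).prod (volume.restrict (Ioo (-1 : ℝ) 1))) := by
      refine (hu.integrable (by norm_num)).bdd_smul C
        (h.continuous.comp continuous_snd).aestronglyMeasurable ?_
      refine Measure.quasiMeasurePreserving_snd.ae (p := fun t => ‖h t‖ ≤ C) ?_
      filter_upwards [ae_restrict_mem measurableSet_Ioo] with t ht
      exact hC t (Ioo_subset_Icc_self ht)
    exact hi.integral_prod_left
  · intro ψ k1 k2
    rw [← pairing_strip k1.continuous k2]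
    have hi : Integrable (fun p : ℝ × ℝ => (ψ p.1 * h p.2) • u p)
        ((volume : Measure ℝ).prod (volume.restrict (Ioo (-1 : ℝ) 1))) := by
      rw [← volume_restrict_strip]
      exact memLp_one_iff_integrable.1 ((Lp.memLp u).smul (p := 2) (r := 1)
        (memLp_prod_mul k1.continuous k2 h.continuous))
    have e (f : ℝ × ℝ → Spinor) : ∫ p in strip, f p =
        ∫ p, f p ∂((volume : Measure ℝ).prod (volume.restrict (Ioo (-1 : ℝ) 1))) := by
      rw [volume_restrict_strip]
    rw [e, integral_prod _ hi]
    refine integral_congr_ae (Eventually.of_forall fun s => ?_)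
    simp only [mul_smul, integral_smul]

/-! ### The transverse modes -/

/-- `t ↦ cos (l t)`. -/
def cosMap (l : ℝ) : C(ℝ, ℝ) := ⟨fun t => Real.cos (l * t), by fun_prop⟩

/-- `t ↦ sin (l t)`. -/
def sinMap (l : ℝ) : C(ℝ, ℝ) := ⟨fun t => Real.sin (l * t), by fun_prop⟩

theorem cosMap_apply (l t : ℝ) : cosMap l t = Real.cos (l * t) := rfl

theorem sinMap_apply (l t : ℝ) : sinMap l t = Real.sin (l * t) := rfl

/-- Multiplication by the unitary matrix `(cos (l t) - sin (l t) σ₁) / √2`, `l = freq j`, whose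
columns are the eigenvectors of the transverse operator for the eigenvalues `l` and `-l`. -/
def mode (j : ℤ) : L2Line →L[ℂ] L2Strip :=
  (((Real.sqrt 2)⁻¹ : ℝ) : ℂ) • (tensor (cosMap (freq j)) - tensor (sinMap (freq j)) ∘L lift σ₁)

theorem mode_apply (j : ℤ) (a : L2Line) : mode j a = (((Real.sqrt 2)⁻¹ : ℝ) : ℂ) •
    (tensor (cosMap (freq j)) a - tensor (sinMap (freq j)) (lift σ₁ a)) := rfl

theorem adjoint_mode (j : ℤ) (u : L2Strip) : (mode j).adjoint u = (((Real.sqrt 2)⁻¹ : ℝ) : ℂ) •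
    ((tensor (cosMap (freq j))).adjoint u - lift σ₁ ((tensor (sinMap (freq j))).adjoint u)) := by
  refine ext_inner_left ℂ fun a => ?_
  rw [ContinuousLinearMap.adjoint_inner_right, mode_apply, inner_smul_left, inner_smul_right,
    inner_sub_left, inner_sub_right, Complex.conj_ofReal, ContinuousLinearMap.adjoint_inner_right,
    ← ContinuousLinearMap.adjoint_inner_right (tensor (sinMap (freq j))), lift_inner, σ₁_herm]

theorem integral_odd {f : ℝ → ℝ} (hf : ∀ t, f (-t) = - f t) : ∫ t in Ioo (-1 : ℝ) 1, f t = 0 := by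
  rw [integral_Ioo_eq_intervalIntegral]
  have h : ∫ t in (-1 : ℝ)..1, f (-t) = ∫ t in (-1 : ℝ)..1, f t := by
    rw [intervalIntegral.integral_comp_neg, neg_neg]
  simp only [hf, intervalIntegral.integral_neg] at h
  linarith

theorem integral_cos_mul_sin (α β : ℝ) :
    ∫ t in Ioo (-1 : ℝ) 1, Real.cos (α * t) * Real.sin (β * t) = 0 :=
  integral_odd fun t => by simp only [mul_neg, Real.cos_neg, Real.sin_neg]

theorem integral_cos_freq (j k : ℤ) :
    (∫ t in Ioo (-1 : ℝ) 1, Real.cos (freq j * t) * Real.cos (freq k * t))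
      + ∫ t in Ioo (-1 : ℝ) 1, Real.sin (freq j * t) * Real.sin (freq k * t)
      = if j = k then 2 else 0 := by
  rw [← integral_add (integrable_of_continuous_Ioo (by fun_prop))
    (integrable_of_continuous_Ioo (by fun_prop))]
  have e (t : ℝ) : Real.cos (freq j * t) * Real.cos (freq k * t)
      + Real.sin (freq j * t) * Real.sin (freq k * t) = Real.cos (((j - k : ℤ) * Real.pi) * t) := by
    rw [← Real.cos_sub]
    simp only [freq]
    congr 1
    push_cast
    ring
  simp only [e]
  rw [integral_Ioo_eq_intervalIntegral]
  split_ifs with h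
  · subst h
    simp
    norm_num
  · have h1 : ((j - k : ℤ) : ℝ) * Real.pi ≠ 0 :=
      mul_ne_zero (Int.cast_ne_zero.2 (sub_ne_zero.2 h)) Real.pi_ne_zero
    rw [intervalIntegral.integral_comp_mul_left (fun t => Real.cos t) h1, integral_cos, mul_one,
      mul_neg_one, Real.sin_neg, Real.sin_int_mul_pi]
    simp

/-- The mixed products of cosine and sine are odd and integrate to zero; the others combine to `∫
cos ((j - k)πt)`, which is `2` for `j = k` and `0` otherwise. The factor `1/√2` in `mode` normalises
this. -/
theorem inner_mode (j k : ℤ) (a b : L2Line) :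
    ⟪mode j a, mode k b⟫_ℂ = if j = k then ⟪a, b⟫_ℂ else 0 := by
  have h1 := integral_cos_mul_sin (freq j) (freq k)
  have h2 : ∫ t in Ioo (-1 : ℝ) 1, Real.sin (freq j * t) * Real.cos (freq k * t) = 0 := by
    simp only [mul_comm (Real.sin _)]
    exact integral_cos_mul_sin _ _
  have h3 := integral_cos_freq j k
  have h4 : ((Real.sqrt 2 : ℝ) : ℂ)⁻¹ * ((Real.sqrt 2 : ℝ) : ℂ)⁻¹ = 1 / 2 := by
    rw [← mul_inv, ← Complex.ofReal_mul, Real.mul_self_sqrt (by norm_num)]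
    norm_num
  rw [mode_apply, mode_apply, inner_smul_left, inner_smul_right, inner_sub_left, inner_sub_right,
    inner_sub_right, inner_tensor, inner_tensor, inner_tensor, inner_tensor, lift_inner σ₁ a,
    lift_inner σ₁ a, σ₁_herm, ← lift_mul, σ₁_sq, lift_one, Complex.conj_ofReal]
  simp only [cosMap_apply, sinMap_apply]
  rw [h1, h2, ← mul_assoc]
  push_cast
  rw [h4, zero_mul, sub_zero, zero_sub, sub_neg_eq_add, ← add_mul, ← Complex.ofReal_add,
    h3]
  split_ifs <;> simp

theorem adjoint_mode_mode (j k : ℤ) (a : L2Line) :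
    (mode j).adjoint (mode k a) = if j = k then a else 0 := by
  refine ext_inner_left ℂ fun b => ?_
  rw [ContinuousLinearMap.adjoint_inner_right, inner_mode]
  split_ifs <;> simp

/-- Almost every fibre `u(s, ·)` is square integrable and orthogonal to all transverse modes, so
transverse completeness can be applied fibre by fibre. -/
theorem eq_zero_of_adjoint_mode {u : L2Strip} (h : ∀ j, (mode j).adjoint u = 0) : u = 0 := by
  have hr : (((Real.sqrt 2)⁻¹ : ℝ) : ℂ) ≠ 0 := Complex.ofReal_ne_zero.2 (by positivity)
  have h1 : ∀ᵐ s : ℝ, ∀ j : ℤ, (∫ t in Ioo (-1 : ℝ) 1, Real.cos (freq j * t) • u (s, t))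
      - act σ₁ (∫ t in Ioo (-1 : ℝ) 1, Real.sin (freq j * t) • u (s, t)) = 0 := by
    -- There are countably many modes, so one null set of `s` serves them all.
    rw [ae_all_iff]
    intro j
    have hj := h j
    rw [adjoint_mode] at hj
    have hj := (smul_eq_zero.1 hj).resolve_left hr
    rw [Lp.eq_zero_iff_ae_eq_zero] at hj
    filter_upwards [hj, coeFn_adjoint_tensor (cosMap (freq j)) u,
      coeFn_adjoint_tensor (sinMap (freq j)) u,
      coeFn_lift σ₁ ((tensor (sinMap (freq j))).adjoint u),
      Lp.coeFn_sub ((tensor (cosMap (freq j))).adjoint u)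
        (lift σ₁ ((tensor (sinMap (freq j))).adjoint u))] with s k1 k2 k3 k4 k5
    rw [k5, Pi.sub_apply, k4, k2, k3] at k1
    exact k1
  have hu : MemLp u 2 ((volume : Measure ℝ).prod (volume.restrict (Ioo (-1 : ℝ) 1))) := by
    rw [← volume_restrict_strip]
    exact Lp.memLp u
  have h2 : ∀ᵐ s : ℝ, MemLp (fun t => u (s, t)) 2 (volume.restrict (Ioo (-1 : ℝ) 1)) := by
    have k1 := (memLp_two_iff_integrable_sq_norm hu.1).1 hu
    filter_upwards [k1.prod_right_ae, hu.1.prodMk_left] with s m1 m2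
    exact (memLp_two_iff_integrable_sq_norm m2).2 m1
  have hm : MeasurableSet {p : ℝ × ℝ | u p = 0} :=
    (Lp.stronglyMeasurable u).measurable (measurableSet_singleton 0)
  have h3 : ∀ᵐ p ∂((volume : Measure ℝ).prod (volume.restrict (Ioo (-1 : ℝ) 1))), u p = 0 := ?_
  · rw [Lp.eq_zero_iff_ae_eq_zero]
    rw [← volume_restrict_strip] at h3
    exact h3
  refine (Measure.ae_prod_iff_ae_ae hm).2 ?_
  filter_upwards [h1, h2] with s k1 k2
  exact ae_eq_zero_of_modes k2 k1

/-- The isometric embeddings of the modes. -/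
def modeIsometry (j : ℤ) : L2Line →ₗᵢ[ℂ] L2Strip where
  toLinearMap := (mode j).toLinearMap
  norm_map' a := by
    have h := inner_mode j j a a
    rw [if_pos rfl, inner_self_eq_norm_sq_to_K, inner_self_eq_norm_sq_to_K] at h
    have h' : ‖mode j a‖ ^ 2 = ‖a‖ ^ 2 := by exact_mod_cast h
    exact (sq_eq_sq₀ (norm_nonneg _) (norm_nonneg _)).1 h'

theorem norm_mode (j : ℤ) (a : L2Line) : ‖mode j a‖ = ‖a‖ := (modeIsometry j).norm_map a

theorem isHilbertSum_mode : IsHilbertSum ℂ (fun _ : ℤ => L2Line) modeIsometry := by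
  refine IsHilbertSum.mk (fun j k hjk a b => ?_) (top_le_iff.2 ?_)
  · exact (inner_mode j k a b).trans (if_neg hjk)
  · rw [Submodule.topologicalClosure_eq_top_iff, Submodule.eq_bot_iff]
    intro u hu
    refine eq_zero_of_adjoint_mode fun j => ext_inner_left ℂ fun a => ?_
    rw [ContinuousLinearMap.adjoint_inner_right, inner_zero_right]
    exact (Submodule.mem_orthogonal _ u).1 hu _ (Submodule.mem_iSup_of_mem j ⟨a, rfl⟩)

/-- The expansion of a spinor field in transverse modes. -/
theorem hasSum_mode (u : L2Strip) : HasSum (fun j => mode j ((mode j).adjoint u)) u := by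
  have h : HasSum (fun j => mode j (isHilbertSum_mode.linearIsometryEquiv u j)) u := by
    have := isHilbertSum_mode.hasSum_linearIsometryEquiv_symm
      (isHilbertSum_mode.linearIsometryEquiv u)
    rwa [LinearIsometryEquiv.symm_apply_apply] at this
  have key (k : ℤ) : (mode k).adjoint u = isHilbertSum_mode.linearIsometryEquiv u k := by
    have h1 := h.mapL (mode k).adjoint
    simp only [adjoint_mode_mode] at h1
    have h2 := hasSum_single (f := fun j => if k = j then
      (isHilbertSum_mode.linearIsometryEquiv u j : L2Line) else 0) k
      (fun j hj => if_neg (Ne.symm hj))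
    rw [if_pos rfl] at h2
    exact h1.unique h2
  simpa only [key] using h

/-- Parseval's identity. -/
theorem hasSum_inner_mode (u v : L2Strip) :
    HasSum (fun j => ⟪(mode j).adjoint u, (mode j).adjoint v⟫_ℂ) ⟪u, v⟫_ℂ := by
  have := (hasSum_mode v).mapL (innerSL ℂ u)
  simpa only [innerSL_apply_apply, ← ContinuousLinearMap.adjoint_inner_left] using this

theorem hasSum_norm_sq_mode (u : L2Strip) :
    HasSum (fun j => ‖(mode j).adjoint u‖ ^ 2) (‖u‖ ^ 2) := by
  have := (Complex.reCLM.hasSum (hasSum_inner_mode u u))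
  simp only [Complex.reCLM_apply, ← RCLike.re_eq_complex_re,
    ← @norm_sq_eq_re_inner ℂ] at this
  exact this

/-! ### The spectral projectors of the transverse operator -/

theorem act_mul (A B : Matrix (Fin 2) (Fin 2) ℂ) (x : Spinor) : act (A * B) x = act A (act B x) := by
  rw [act, map_mul]
  rfl

theorem act_smul (c : ℂ) (A : Matrix (Fin 2) (Fin 2) ℂ) (x : Spinor) :
    act (c • A) x = c • act A x := by
  rw [act, map_smul]
  rfl

theorem act_one (x : Spinor) : act 1 x = x := by
  rw [act, map_one]
  rfl

theorem act_real_smul (A : Matrix (Fin 2) (Fin 2) ℂ) (c : ℝ) (x : Spinor) :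
    act A (c • x) = c • act A x := (act A).map_smul_of_tower c x

theorem memLp_cross {g : ℝ → ℝ} (hg : Continuous g) :
    MemLp g 2 (volume.restrict (Ioo (-1 : ℝ) 1)) := by
  rw [memLp_two_iff_integrable_sq hg.aestronglyMeasurable]
  exact integrable_of_continuous_Ioo (hg.pow 2)

/-- Integration against a continuous function over `(-1, 1)`. -/
def crossPair (g : C(ℝ, ℝ)) : L2Cross →L[ℂ] Spinor :=
  LinearMap.mkContinuous
    { toFun := fun u => ∫ t in Ioo (-1 : ℝ) 1, g t • u t
      map_add' := fun u v => by
        have hi (u : L2Cross) : Integrable (fun t => g t • u t)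
            (volume.restrict (Ioo (-1 : ℝ) 1)) :=
          integrable_continuous_smul ((Lp.memLp u).integrable (by norm_num)) g.continuous
        rw [← integral_add (hi u) (hi v)]
        refine integral_congr_ae ?_
        filter_upwards [Lp.coeFn_add u v] with t ht
        rw [ht, Pi.add_apply, smul_add]
      map_smul' := fun c u => pairing_smul g c u }
    _ (norm_pairing_le (memLp_cross g.continuous))

theorem crossPair_apply (g : C(ℝ, ℝ)) (u : L2Cross) :
    crossPair g u = ∫ t in Ioo (-1 : ℝ) 1, g t • u t := rfl

/-- The coefficients of a transverse spinor with respect to a mode, up to a factor `√2`. -/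
def crossCoef (j : ℤ) : L2Cross →L[ℂ] Spinor :=
  crossPair (cosMap (freq j)) - act σ₁ ∘L crossPair (sinMap (freq j))

theorem crossCoef_apply (j : ℤ) (u : L2Cross) : crossCoef j u =
    crossPair (cosMap (freq j)) u - act σ₁ (crossPair (sinMap (freq j)) u) := rfl

theorem HasBoundaryValues.crossPair {u v : L2Cross} {a b : Spinor} (h : HasBoundaryValues u v a b)
    {g g' : C(ℝ, ℝ)} (hg : ContDiff ℝ ∞ g) (hd : ∀ t, HasDerivAt g (g' t) t) :
    ThinGuide.crossPair g v = g 1 • b - g (-1) • a - ThinGuide.crossPair g' u := by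
  have := h (fun t => wideCutoff t * g t) (wideCutoff.contDiff.mul hg)
    wideCutoff.hasCompactSupport.mul_right
  rw [crossPair_apply, crossPair_apply]
  have e1 : ∫ t in Ioo (-1 : ℝ) 1, (wideCutoff t * g t) • v t = ∫ t in Ioo (-1 : ℝ) 1, g t • v t := by
    refine setIntegral_congr_fun measurableSet_Ioo fun t ht => ?_
    rw [(wideCutoff_eventuallyEq (Ioo_subset_Icc_self ht)).eq_of_nhds, Pi.one_apply, one_mul]
  have e2 : ∫ t in Ioo (-1 : ℝ) 1, deriv (fun t => wideCutoff t * g t) t • u t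
      = ∫ t in Ioo (-1 : ℝ) 1, g' t • u t := by
    refine setIntegral_congr_fun measurableSet_Ioo fun t ht => ?_
    have : (fun t => wideCutoff t * g t) =ᶠ[𝓝 t] g := by
      filter_upwards [wideCutoff_eventuallyEq (Ioo_subset_Icc_self ht)] with t ht
      rw [ht, Pi.one_apply, one_mul]
    rw [this.deriv_eq, (hd _).deriv]
  rw [e1, e2, (wideCutoff_eventuallyEq (t := 1) (by simp)).eq_of_nhds,
    (wideCutoff_eventuallyEq (t := -1) (by simp)).eq_of_nhds] at this
  simpa using this

theorem contDiff_cosMap (l : ℝ) : ContDiff ℝ ∞ (cosMap l) := by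
  change ContDiff ℝ ∞ fun t => Real.cos (l * t)
  fun_prop

theorem contDiff_sinMap (l : ℝ) : ContDiff ℝ ∞ (sinMap l) := by
  change ContDiff ℝ ∞ fun t => Real.sin (l * t)
  fun_prop

theorem hasDerivAt_cosMap (l t : ℝ) : HasDerivAt (cosMap l) (((-l) • sinMap l) t) t := by
  have := ((hasDerivAt_id t).const_mul l).cos
  simp only [id, mul_one] at this
  convert! this using 1
  simp [sinMap_apply]
  ring

theorem hasDerivAt_sinMap (l t : ℝ) : HasDerivAt (sinMap l) ((l • cosMap l) t) t := by
  have := ((hasDerivAt_id t).const_mul l).sin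
  simp only [id, mul_one] at this
  convert! this using 1
  simp [cosMap_apply]
  ring

/-- This quantises the transverse frequencies: the boundary values of a mode become multiples of `(1
- σ₁)e` at `t = 1` and of `(1 + σ₁)e` at `t = -1`, as the boundary conditions demand. -/
theorem sin_freq (j : ℤ) : Real.sin (freq j) = Real.cos (freq j) := by
  have h := cos_sub_sin_freq j 1
  have h2 : freq j * (1 + 1) = Real.pi / 2 + (2 * j : ℤ) * Real.pi := by
    simp only [freq]; push_cast; ring
  rw [mul_one, h2, Real.cos_add_int_mul_pi, Real.cos_pi_div_two, mul_zero, mul_zero] at h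
  linarith

theorem cosMap_freq_one (j : ℤ) : cosMap (freq j) 1 = Real.cos (freq j) := by
  rw [cosMap_apply, mul_one]

theorem cosMap_freq_neg_one (j : ℤ) : cosMap (freq j) (-1) = Real.cos (freq j) := by
  rw [cosMap_apply, mul_neg_one, Real.cos_neg]

theorem sinMap_freq_one (j : ℤ) : sinMap (freq j) 1 = Real.cos (freq j) := by
  rw [sinMap_apply, mul_one, sin_freq]

theorem sinMap_freq_neg_one (j : ℤ) : sinMap (freq j) (-1) = - Real.cos (freq j) := by
  rw [sinMap_apply, mul_neg_one, Real.sin_neg, sin_freq]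

theorem crossPair_smul (c : ℝ) (g : C(ℝ, ℝ)) (u : L2Cross) :
    crossPair (c • g) u = c • crossPair g u := by
  rw [crossPair_apply, crossPair_apply, ← integral_smul]
  refine integral_congr_ae (Eventually.of_forall fun t => ?_)
  simp only [ContinuousMap.smul_apply, smul_eq_mul, mul_smul]

theorem crossPair_lift (g : C(ℝ, ℝ)) (A : Matrix (Fin 2) (Fin 2) ℂ) (u : L2Cross) :
    crossPair g (lift A u) = act A (crossPair g u) := by
  rw [crossPair_apply, crossPair_apply, ← ContinuousLinearMap.integral_comp_comm _
    (integrable_continuous_smul ((Lp.memLp u).integrable (by norm_num)) g.continuous)]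
  refine integral_congr_ae ?_
  filter_upwards [coeFn_lift A u] with t ht
  rw [ht, act_real_smul]

/-- The transverse operator multiplies the mode coefficients by `freq j` times `σ₃`. -/
theorem crossCoef_of_mem_crossGraph {z : L2Cross × L2Cross} (hz : z ∈ crossGraph) (j : ℤ) :
    crossCoef j z.2 = freq j • act σ₃ (crossCoef j z.1) := by
  obtain ⟨ut, -, ⟨a, b, h1, hb, ha⟩, h2⟩ := hz
  have e : z.2 = lift (-Complex.I • σ₂) ut := Lp.ext (h2.trans (coeFn_lift _ _).symm)
  have hc := h1.crossPair (contDiff_cosMap (freq j)) (hasDerivAt_cosMap (freq j))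
  have hs := h1.crossPair (contDiff_sinMap (freq j)) (hasDerivAt_sinMap (freq j))
  rw [cosMap_freq_one, cosMap_freq_neg_one, crossPair_smul] at hc
  rw [sinMap_freq_one, sinMap_freq_neg_one, crossPair_smul] at hs
  rw [crossCoef_apply, crossCoef_apply, e, crossPair_lift, crossPair_lift, hc, hs]
  generalize crossPair (cosMap (freq j)) z.1 = C
  generalize crossPair (sinMap (freq j)) z.1 = S
  ext i
  fin_cases i <;> simp [act_apply, σ₁, σ₂, σ₃, ha, hb] <;> ring_nf

theorem mem_crossGraph_of_eigenvector {x : L2Cross} {l : ℝ} (h : x ∈ crossDirac.domain)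
    (hl : crossDirac ⟨x, h⟩ = (l : ℂ) • x) : (x, (l : ℂ) • x) ∈ crossGraph := by
  have e : crossDirac.graph = crossGraph := Submodule.toLinearPMap_graph_eq _ crossGraph_single
  have := crossDirac.mem_graph ⟨x, h⟩
  rwa [hl, e] at this

/-- The coefficient `c` of an eigenvector for `l ∈ Λ` satisfies `l c = freq j σ₃ c`. Applying `1 +
σσ₃`, on whose range `σ₃` equals `σ`, gives `l = σ freq j` unless the component vanishes. The
condition is linear and closed, hence passes to the closed span. -/
theorem act_crossCoef_eq_zero {Λ : Set ℝ} {x : L2Cross} (hx : x ∈ crossSpectralSubspace Λ) (j : ℤ)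
    {σ : ℝ} (hσ : σ ^ 2 = 1) (hj : σ * freq j ∉ Λ) :
    act (1 + (σ : ℂ) • σ₃) (crossCoef j x) = 0 := by
  have h : crossSpectralSubspace Λ ≤
      LinearMap.ker (act (1 + (σ : ℂ) • σ₃) ∘L crossCoef j).toLinearMap := by
    refine Submodule.topologicalClosure_minimal _ (Submodule.span_le.2 ?_)
      (ContinuousLinearMap.isClosed_ker _)
    rintro y ⟨l, hl, hy, hly⟩
    have h1 := crossCoef_of_mem_crossGraph (mem_crossGraph_of_eigenvector hy hly) j
    rw [map_smul] at h1
    change act (1 + (σ : ℂ) • σ₃) (crossCoef j y) = 0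
    have h2 := congrArg (act (1 + (σ : ℂ) • σ₃)) h1
    have h3 : (1 + (σ : ℂ) • σ₃) * σ₃ = (σ : ℂ) • (1 + (σ : ℂ) • σ₃) := by
      have hσ' : (σ : ℂ) * σ = 1 := by rw [← Complex.ofReal_mul, ← sq, hσ, Complex.ofReal_one]
      rw [add_mul, one_mul, smul_mul_assoc, σ₃_sq, smul_add, smul_smul, hσ', one_smul, add_comm]
    rw [map_smul, act_real_smul, ← act_mul, h3, act_smul, ← Complex.coe_smul, smul_smul,
      ← sub_eq_zero, ← sub_smul] at h2
    refine (smul_eq_zero.1 h2).resolve_left fun h4 => hj ?_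
    have h5 : l = freq j * σ := by
      have := sub_eq_zero.1 h4
      exact_mod_cast this
    rwa [mul_comm, ← h5]
  exact h hx

/-- The mode coefficient of a product `f(s) x(t)` is `f(s)` times a multiple of `crossCoef j x`, so
the vanishing in the cross section carries over to the closed span of products. -/
theorem lift_adjoint_mode_eq_zero {Λ : Set ℝ} {u : L2Strip} (hu : u ∈ stripSpectralSubspace Λ)
    (j : ℤ) {σ : ℝ} (hσ : σ ^ 2 = 1) (hj : σ * freq j ∉ Λ) :
    lift (1 + (σ : ℂ) • σ₃) ((mode j).adjoint u) = 0 := by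
  have h : stripSpectralSubspace Λ ≤
      LinearMap.ker (lift (1 + (σ : ℂ) • σ₃) ∘L (mode j).adjoint).toLinearMap := by
    refine Submodule.topologicalClosure_minimal _ (Submodule.span_le.2 ?_)
      (ContinuousLinearMap.isClosed_ker _)
    rintro y ⟨f, x, hx, hy⟩
    change lift (1 + (σ : ℂ) • σ₃) ((mode j).adjoint y) = 0
    have hy' : ∀ᵐ s : ℝ, ∀ᵐ t ∂(volume.restrict (Ioo (-1 : ℝ) 1)), y (s, t) = f s • x t := by
      have : ∀ᵐ p ∂((volume : Measure ℝ).prod (volume.restrict (Ioo (-1 : ℝ) 1))),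
          y p = f p.1 • x p.2 := by
        rw [← volume_restrict_strip]
        exact hy
      exact Measure.ae_ae_of_ae_prod this
    have hg (g : C(ℝ, ℝ)) : ((tensor g).adjoint y : L2Line) =ᵐ[volume]
        fun s => f s • crossPair g x := by
      filter_upwards [coeFn_adjoint_tensor g y, hy'] with s h1 h2
      rw [h1, crossPair_apply, ← integral_smul]
      refine integral_congr_ae ?_
      filter_upwards [h2] with t ht
      rw [ht, smul_comm]
    suffices hz : lift (1 + (σ : ℂ) • σ₃) ((tensor (cosMap (freq j))).adjoint y
        - lift σ₁ ((tensor (sinMap (freq j))).adjoint y)) = 0 by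
      rw [adjoint_mode, map_smul, hz, smul_zero]
    rw [Lp.eq_zero_iff_ae_eq_zero]
    filter_upwards [coeFn_lift (1 + (σ : ℂ) • σ₃) ((tensor (cosMap (freq j))).adjoint y
        - lift σ₁ ((tensor (sinMap (freq j))).adjoint y)),
      Lp.coeFn_sub ((tensor (cosMap (freq j))).adjoint y)
        (lift σ₁ ((tensor (sinMap (freq j))).adjoint y)),
      coeFn_lift σ₁ ((tensor (sinMap (freq j))).adjoint y), hg (cosMap (freq j)),
      hg (sinMap (freq j))] with s k1 k2 k3 k4 k5
    rw [k1, k2, Pi.sub_apply, k3, k4, k5, map_smul, ← smul_sub, ← crossCoef_apply, map_smul,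
      act_crossCoef_eq_zero hx j hσ hj, smul_zero, Pi.zero_apply]
  exact h hu

/-! ### Explicit eigenvectors of the transverse operator -/

theorem hasBoundaryValues_smul_const {h h' : C(ℝ, ℝ)} (hd : ∀ t, HasDerivAt h (h' t) t)
    (e : Spinor) :
    HasBoundaryValues (fun t => h t • e) (fun t => h' t • e) (h (-1) • e) (h 1 • e) := by
  intro φ k1 k2
  have hφ (t : ℝ) : HasDerivAt φ (deriv φ t) t :=
    (k1.differentiable (by simp)).differentiableAt.hasDerivAt
  have c := (contDiff_infty_iff_deriv.1 k1).2.continuous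
  have ibp : ∫ t in Ioo (-1 : ℝ) 1, φ t * h' t =
      φ 1 * h 1 - φ (-1) * h (-1) - ∫ t in Ioo (-1 : ℝ) 1, deriv φ t * h t := by
    rw [integral_Ioo_eq_intervalIntegral, integral_Ioo_eq_intervalIntegral]
    exact intervalIntegral.integral_mul_deriv_eq_deriv_mul (fun t _ => hφ t) (fun t _ => hd t)
      (c.intervalIntegrable _ _) (h'.continuous.intervalIntegrable _ _)
  simp only [smul_smul]
  rw [integral_smul_const, integral_smul_const, ibp, sub_smul, sub_smul]

theorem HasBoundaryValues.congr {u v u' v' : ℝ → Spinor} {a b : Spinor}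
    (h : HasBoundaryValues u v a b) (hu : u' =ᵐ[volume.restrict (Ioo (-1 : ℝ) 1)] u)
    (hv : v' =ᵐ[volume.restrict (Ioo (-1 : ℝ) 1)] v) : HasBoundaryValues u' v' a b := by
  intro φ k1 k2
  have e1 : ∫ t in Ioo (-1 : ℝ) 1, φ t • v' t = ∫ t in Ioo (-1 : ℝ) 1, φ t • v t :=
    integral_congr_ae (hv.mono fun t ht => by simp only [ht])
  have e2 : ∫ t in Ioo (-1 : ℝ) 1, deriv φ t • u' t = ∫ t in Ioo (-1 : ℝ) 1, deriv φ t • u t :=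
    integral_congr_ae (hu.mono fun t ht => by simp only [ht])
  rw [e1, e2, h φ k1 k2]

theorem HasBoundaryValues.isWeakDeriv {u v : ℝ → Spinor} {a b : Spinor}
    (h : HasBoundaryValues u v a b) : IsWeakDeriv (Ioo (-1 : ℝ) 1) (1 : ℝ) u v := by
  intro φ k1 k2 k3
  have z (t : ℝ) (ht : t ∉ Ioo (-1 : ℝ) 1) : φ t = 0 :=
    image_eq_zero_of_notMem_tsupport fun hn => ht (k3 hn)
  have := h φ k1 k2
  rw [z 1 (by simp), z (-1) (by simp), zero_smul, zero_smul, sub_zero, zero_sub] at this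
  rw [this, neg_neg]
  rfl

/-- The product of a transverse mode with a constant spinor. -/
def crossMode (j : ℤ) (e : Spinor) : L2Cross :=
  testField (memLp_cross (cosMap (freq j)).continuous) e
    - testField (memLp_cross (sinMap (freq j)).continuous) (act σ₁ e)

/-- The transverse derivative of `crossMode`. -/
def crossModeDeriv (j : ℤ) (e : Spinor) : L2Cross :=
  testField (memLp_cross ((-freq j) • sinMap (freq j)).continuous) e
    - testField (memLp_cross (freq j • cosMap (freq j)).continuous) (act σ₁ e)

theorem coeFn_crossMode (j : ℤ) (e : Spinor) :
    crossMode j e =ᵐ[volume.restrict (Ioo (-1 : ℝ) 1)]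
      fun t => cosMap (freq j) t • e - sinMap (freq j) t • act σ₁ e := by
  filter_upwards [Lp.coeFn_sub (testField (memLp_cross (cosMap (freq j)).continuous) e)
    (testField (memLp_cross (sinMap (freq j)).continuous) (act σ₁ e)),
    coeFn_testField (memLp_cross (cosMap (freq j)).continuous) e,
    coeFn_testField (memLp_cross (sinMap (freq j)).continuous) (act σ₁ e)] with t h1 h2 h3
  rw [crossMode, h1, Pi.sub_apply, h2, h3]

theorem coeFn_crossModeDeriv (j : ℤ) (e : Spinor) :
    crossModeDeriv j e =ᵐ[volume.restrict (Ioo (-1 : ℝ) 1)]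
      fun t => ((-freq j) • sinMap (freq j)) t • e - (freq j • cosMap (freq j)) t • act σ₁ e := by
  filter_upwards [Lp.coeFn_sub
    (testField (memLp_cross ((-freq j) • sinMap (freq j)).continuous) e)
    (testField (memLp_cross (freq j • cosMap (freq j)).continuous) (act σ₁ e)),
    coeFn_testField (memLp_cross ((-freq j) • sinMap (freq j)).continuous) e,
    coeFn_testField (memLp_cross (freq j • cosMap (freq j)).continuous) (act σ₁ e)] with t h1 h2 h3
  rw [crossModeDeriv, h1, Pi.sub_apply, h2, h3]

/-- As `-iσ₂ = σ₁σ₃` and `σ₁σ₃σ₁ = -σ₃`, differentiating the mode of `e` and applying the matrix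
gives the mode of `freq j σ₃ e`. -/
theorem crossMode_mem_crossGraph (j : ℤ) {σ : ℝ} {e : Spinor} (he : act σ₃ e = (σ : ℂ) • e) :
    (crossMode j e, ((σ * freq j : ℝ) : ℂ) • crossMode j e) ∈ crossGraph := by
  have hc := (hasBoundaryValues_smul_const (hasDerivAt_cosMap (freq j)) e).congr
    (coeFn_testField (memLp_cross (cosMap (freq j)).continuous) e)
    (coeFn_testField (memLp_cross ((-freq j) • sinMap (freq j)).continuous) e)
  have hs := (hasBoundaryValues_smul_const (hasDerivAt_sinMap (freq j)) (act σ₁ e)).congr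
    (coeFn_testField (memLp_cross (sinMap (freq j)).continuous) (act σ₁ e))
    (coeFn_testField (memLp_cross (freq j • cosMap (freq j)).continuous) (act σ₁ e))
  have h := hc.add (hs.smul (-1))
  rw [cosMap_freq_one, cosMap_freq_neg_one, sinMap_freq_one, sinMap_freq_neg_one] at h
  have e1 : testField (memLp_cross (cosMap (freq j)).continuous) e + (-1 : ℂ) •
      testField (memLp_cross (sinMap (freq j)).continuous) (act σ₁ e) = crossMode j e := by
    rw [crossMode, neg_one_smul, sub_eq_add_neg]
  have e2 : testField (memLp_cross ((-freq j) • sinMap (freq j)).continuous) e + (-1 : ℂ) •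
      testField (memLp_cross (freq j • cosMap (freq j)).continuous) (act σ₁ e)
        = crossModeDeriv j e := by
    rw [crossModeDeriv, neg_one_smul, sub_eq_add_neg]
  rw [e1, e2] at h
  refine ⟨crossModeDeriv j e, h.isWeakDeriv, ⟨_, _, h, ?_, ?_⟩, ?_⟩
  · simp [act_apply, σ₁]
  · simp [act_apply, σ₁]
    ring
  · filter_upwards [Lp.coeFn_smul (((σ * freq j : ℝ) : ℂ)) (crossMode j e), coeFn_crossMode j e,
      coeFn_crossModeDeriv j e] with t h1 h2 h3
    rw [h1, Pi.smul_apply, h2, h3, neg_I_smul_σ₂, act_mul, map_sub, map_sub, act_real_smul,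
      act_real_smul, act_real_smul, act_real_smul, ← act_mul σ₃, σ₃_mul_σ₁, he]
    have h4 : act (-(σ₁ * σ₃)) e = -((σ : ℂ) • act σ₁ e) := by
      rw [← map_smul, ← he, ← act_mul, act, map_neg]
      rfl
    rw [h4, map_neg, map_smul, map_smul, ← act_mul, σ₁_sq, act_one]
    simp only [← Complex.coe_smul, ContinuousMap.smul_apply, smul_eq_mul, smul_smul, smul_sub,
      smul_neg]
    push_cast
    module

theorem crossMode_mem_crossSpectralSubspace {Λ : Set ℝ} (j : ℤ) {σ : ℝ} (hj : σ * freq j ∈ Λ)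
    {e : Spinor} (he : act σ₃ e = (σ : ℂ) • e) : crossMode j e ∈ crossSpectralSubspace Λ := by
  have h1 : crossDirac.graph = crossGraph := Submodule.toLinearPMap_graph_eq _ crossGraph_single
  have h := crossMode_mem_crossGraph j he
  rw [← h1, LinearPMap.mem_graph_iff] at h
  obtain ⟨y, hy1, hy2⟩ := h
  simp only at hy1 hy2
  refine Submodule.le_topologicalClosure _ (Submodule.subset_span ⟨_, hj, ?_, ?_⟩)
  · rw [← hy1]
    exact y.2
  · rw [← hy2]
    congr 1
    exact Subtype.ext hy1.symm

theorem exists_scalar_of_component {a : L2Line} {i : Fin 2} (h : ∀ᵐ s, ∀ k, k ≠ i → a s k = 0) :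
    ∃ f : Lp ℂ 2 (volume : Measure ℝ), ∀ᵐ s, a s = f s • EuclideanSpace.single i (1 : ℂ) := by
  refine ⟨(EuclideanSpace.proj i : Spinor →L[ℂ] ℂ).compLp a, ?_⟩
  filter_upwards [h, (EuclideanSpace.proj i : Spinor →L[ℂ] ℂ).coeFn_compLp a] with s h1 h2
  rw [h2]
  ext k
  by_cases hk : k = i
  · subst hk; simp
  · simp [h1 k hk, hk]

/-- The eigenvalue equation for `σ₃` leaves a single component of `a`, so `mode j a` is, up to a
constant, a scalar function of `s` times an eigenvector of `T₀`. -/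
theorem mode_mem_stripSpectralSubspace {Λ : Set ℝ} (j : ℤ) {σ : ℝ} (hσ : σ = 1 ∨ σ = -1)
    (hj : σ * freq j ∈ Λ) {a : L2Line} (ha : lift σ₃ a = (σ : ℂ) • a) :
    mode j a ∈ stripSpectralSubspace Λ := by
  obtain ⟨i, he, hk⟩ : ∃ i : Fin 2, act σ₃ (EuclideanSpace.single i (1 : ℂ)) =
      (σ : ℂ) • EuclideanSpace.single i (1 : ℂ) ∧ ∀ᵐ s, ∀ k, k ≠ i → a s k = 0 := by
    have h : ∀ᵐ s, act σ₃ (a s) = (σ : ℂ) • a s := by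
      filter_upwards [coeFn_lift σ₃ a, Lp.coeFn_smul (σ : ℂ) a] with s h1 h2
      rw [← h1, ha, h2, Pi.smul_apply]
    rcases hσ with rfl | rfl
    · refine ⟨0, ?_, ?_⟩
      · ext k; fin_cases k <;> simp [act_apply, σ₃]
      · filter_upwards [h] with s hs k hk
        obtain rfl : k = 1 := by omega
        have := congrArg (fun x : Spinor => x 1) hs
        simp [act_apply, σ₃] at this
        linear_combination (-1 / 2) * this
    · refine ⟨1, ?_, ?_⟩
      · ext k; fin_cases k <;> simp [act_apply, σ₃]
      · filter_upwards [h] with s hs k hk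
        obtain rfl : k = 0 := by omega
        have := congrArg (fun x : Spinor => x 0) hs
        simp [act_apply, σ₃] at this
        linear_combination (1 / 2) * this
  obtain ⟨f, hf⟩ := exists_scalar_of_component hk
  rw [mode_apply]
  refine Submodule.smul_mem _ _ (Submodule.le_topologicalClosure _ (Submodule.subset_span
    ⟨f, _, crossMode_mem_crossSpectralSubspace j hj he, ?_⟩))
  have hx : ∀ᵐ p ∂((volume : Measure (ℝ × ℝ)).restrict strip),
      crossMode j (EuclideanSpace.single i (1 : ℂ)) p.2 =
        cosMap (freq j) p.2 • EuclideanSpace.single i (1 : ℂ)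
          - sinMap (freq j) p.2 • act σ₁ (EuclideanSpace.single i (1 : ℂ)) := by
    have := Measure.quasiMeasurePreserving_snd (μ := (volume : Measure ℝ))
      (ν := volume.restrict (Ioo (-1 : ℝ) 1)) |>.ae
        (coeFn_crossMode j (EuclideanSpace.single i (1 : ℂ)))
    rwa [← volume_restrict_strip] at this
  filter_upwards [Lp.coeFn_sub (tensor (cosMap (freq j)) a) (tensor (sinMap (freq j)) (lift σ₁ a)),
    coeFn_tensor (cosMap (freq j)) a, coeFn_tensor (sinMap (freq j)) (lift σ₁ a),
    ae_strip_of_ae_line (coeFn_lift σ₁ a), ae_strip_of_ae_line hf, hx] with p h1 h2 h3 h4 h5 h6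
  rw [h1, Pi.sub_apply, h2, h3, h4, h5, h6, map_smul, smul_sub, smul_comm (f p.1),
    smul_comm (f p.1)]

/-- Of the eigenvalues `±freq j` exactly one, `σ freq j`, lies in `Λ`. The coefficient of the
projection has only its `σ₃ = σ` part, and that of the remainder has no such part, so the projector
acts on the mode as `(1 + σσ₃)/2`; the factor `2` clears the denominator. -/
theorem adjoint_mode_stripProjector {Λ : Set ℝ} (j : ℤ) {σ : ℝ} (hσ : σ = 1 ∨ σ = -1)
    (h1 : σ * freq j ∈ Λ) (h2 : -σ * freq j ∉ Λ) (u : L2Strip) :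
    (2 : ℂ) • (mode j).adjoint (stripProjector Λ u)
      = (mode j).adjoint u + (σ : ℂ) • lift σ₃ ((mode j).adjoint u) := by
  have hσ2 : (σ : ℂ) * σ = 1 := by rcases hσ with rfl | rfl <;> norm_num
  set p := stripProjector Λ u with hp
  have e1 : (mode j).adjoint p = (σ : ℂ) • lift σ₃ ((mode j).adjoint p) := by
    have := lift_adjoint_mode_eq_zero (Submodule.starProjection_apply_mem _ u) j
      (σ := -σ) (by rcases hσ with rfl | rfl <;> norm_num) h2
    rw [lift_add, lift_one, lift_smul] at this
    change (mode j).adjoint p + _ • lift σ₃ ((mode j).adjoint p) = 0 at this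
    rw [Complex.ofReal_neg, neg_smul, ← sub_eq_add_neg, sub_eq_zero] at this
    exact this
  have e2 : (mode j).adjoint (u - p) + (σ : ℂ) • lift σ₃ ((mode j).adjoint (u - p)) = 0 := by
    refine ext_inner_left ℂ fun b => ?_
    have hm : mode j (b + (σ : ℂ) • lift σ₃ b) ∈ stripSpectralSubspace Λ := by
      refine mode_mem_stripSpectralSubspace j hσ h1 ?_
      rw [map_add, map_smul, ← lift_mul, σ₃_sq, lift_one, smul_add, smul_smul, hσ2, one_smul,
        add_comm]
    have := Submodule.inner_right_of_mem_orthogonal hm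
      ((stripSpectralSubspace Λ).sub_starProjection_mem_orthogonal u)
    change ⟪_, u - p⟫_ℂ = 0 at this
    rw [← ContinuousLinearMap.adjoint_inner_right, inner_add_left, inner_smul_left, lift_inner,
      σ₃_herm, Complex.conj_ofReal] at this
    rw [inner_add_right, inner_smul_right, this, inner_zero_right]
  rw [map_sub, map_sub, smul_sub, ← e1] at e2
  rw [two_smul, ← sub_eq_zero, ← neg_eq_zero, ← e2]
  abel

/-- The sign of the frequency `freq j`. -/
def modeSign (j : ℤ) : ℝ := if 0 ≤ j then 1 else -1

theorem modeSign_eq (j : ℤ) : modeSign j = 1 ∨ modeSign j = -1 := by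
  unfold modeSign; split_ifs <;> simp

theorem modeSign_mul_freq_pos (j : ℤ) : 0 < modeSign j * freq j := by
  have := Real.pi_pos
  unfold modeSign freq
  split_ifs with h
  · have : (0 : ℝ) ≤ j := by exact_mod_cast h
    positivity
  · have : (j : ℝ) ≤ -1 := by exact_mod_cast (by omega : j ≤ -1)
    nlinarith

theorem adjoint_mode_Pplus_sub_Pminus (j : ℤ) (u : L2Strip) :
    (mode j).adjoint ((Pplus - Pminus) u) = (modeSign j : ℂ) • lift σ₃ ((mode j).adjoint u) := by
  have h := modeSign_mul_freq_pos j
  have h1 := adjoint_mode_stripProjector (Λ := Ioi 0) j (modeSign_eq j) h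
    (by simp only [mem_Ioi]; linarith) u
  have h2 := adjoint_mode_stripProjector (Λ := Iio 0) j (σ := -modeSign j)
    (by rcases modeSign_eq j with h | h <;> simp [h]) (by simp only [mem_Iio]; linarith)
    (by simp only [mem_Iio]; linarith) u
  rw [sub_apply, map_sub, Pplus, Pminus]
  push_cast at h2
  have h3 : (2 : ℂ) ≠ 0 := two_ne_zero
  refine smul_right_injective _ h3 ?_
  simp only [smul_sub]
  rw [h1, h2]
  module

/-- The eigenvalues of `T₀` on the modes, after renormalisation. -/
def gap (j : ℤ) : ℝ := freq j - modeSign j * (Real.pi / 4)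

theorem gap_zero : gap 0 = 0 := by
  simp [gap, freq, modeSign]

/-- The extremal case is `j = -1`, where `freq j = -3π/4` is shifted to `-π/2`. -/
theorem le_abs_gap {j : ℤ} (hj : j ≠ 0) : Real.pi / 2 ≤ |gap j| := by
  have := Real.pi_pos
  unfold gap modeSign freq
  split_ifs with h
  · have : (1 : ℝ) ≤ j := by exact_mod_cast (by omega : 1 ≤ j)
    refine le_trans ?_ (le_abs_self _)
    nlinarith
  · have : (j : ℝ) ≤ -1 := by exact_mod_cast (by omega : j ≤ -1)
    refine le_trans ?_ (neg_le_abs _)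
    nlinarith

/-! ### The renormalised operator of the straight waveguide -/

theorem adjoint_mode_mem_lineH1 {z : L2Strip × L2Strip × L2Strip} (hz : z ∈ stripH1) (j : ℤ) :
    ((mode j).adjoint z.1, (mode j).adjoint z.2.1) ∈ lineH1 := by
  have h := (mem_stripH1_iff.1 hz).1
  have hc := h.adjoint_tensor (contDiff_cosMap (freq j))
  have hs := lineH1_lift σ₁ (h.adjoint_tensor (contDiff_sinMap (freq j)))
  have := lineH1.smul_mem (((Real.sqrt 2)⁻¹ : ℝ) : ℂ) (lineH1.sub_mem hc hs)
  rw [adjoint_mode, adjoint_mode]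
  rwa [Prod.mk_sub_mk, Prod.smul_mk] at this

/-- The mode matrices are combinations of `1` and `σ₁`, so a matrix that commutes with `σ₁` passes
through them. -/
theorem adjoint_mode_lift {A : Matrix (Fin 2) (Fin 2) ℂ} (hA : σ₁ * A = A * σ₁) (j : ℤ)
    (u : L2Strip) : (mode j).adjoint (lift A u) = lift A ((mode j).adjoint u) := by
  rw [adjoint_mode, adjoint_mode, adjoint_tensor_lift, adjoint_tensor_lift, ← lift_mul, hA,
    lift_mul, map_smul, map_sub]

/-- Integration by parts moves the derivative onto the mode. The boundary terms cancel because `σ₁`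
is `-1` on the upper trace and `1` on the lower one, while `sin (freq j) = cos (freq j)`. -/
theorem adjoint_mode_transverse {z : L2Strip × L2Strip × L2Strip} (hz : z ∈ stripH1) (j : ℤ) :
    (mode j).adjoint (lift (-Complex.I • σ₂) z.2.2)
      = (freq j : ℂ) • lift σ₃ ((mode j).adjoint z.1) := by
  obtain ⟨-, ht, hb, ha⟩ := mem_stripH1_iff.1 hz
  have hc := ht.adjoint_tensor (contDiff_cosMap (freq j)) (hasDerivAt_cosMap (freq j))
  have hs := ht.adjoint_tensor (contDiff_sinMap (freq j)) (hasDerivAt_sinMap (freq j))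
  rw [cosMap_freq_one, cosMap_freq_neg_one, tensor_smul, map_smulₛₗ, smul_apply,
    starRingEnd_apply, RCLike.star_def, Complex.conj_ofReal] at hc
  rw [sinMap_freq_one, sinMap_freq_neg_one, tensor_smul, map_smulₛₗ, smul_apply,
    starRingEnd_apply, RCLike.star_def, Complex.conj_ofReal] at hs
  have hb' : lift σ₁ (traceTop z) = - traceTop z := by
    rw [lift_add, lift_one] at hb
    exact (neg_eq_of_add_eq_zero_right hb).symm
  have ha' : lift σ₁ (traceBot z) = traceBot z := by
    rw [sub_eq_add_neg, lift_add, lift_one, lift_neg, ← sub_eq_add_neg] at ha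
    exact (sub_eq_zero.1 ha).symm
  have k (x : L2Line) : lift σ₁ (lift σ₃ x) = - lift σ₃ (lift σ₁ x) := by
    rw [← lift_mul, ← lift_mul, σ₃_mul_σ₁, lift_neg, neg_neg]
  have k2 (x : L2Line) : lift σ₁ (lift σ₁ x) = x := by rw [← lift_mul, σ₁_sq, lift_one]
  rw [adjoint_mode, adjoint_mode, adjoint_tensor_lift, adjoint_tensor_lift, hc, hs,
    neg_I_smul_σ₂, lift_mul, lift_mul]
  simp only [map_sub, map_smul, k, hb', ha', k2, smul_sub, map_neg]
  push_cast
  module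

/-- The operator `-i σ₁ ∂ₛ + ε⁻¹ T₀ - π / (4 ε) (P⁺ - P⁻) - i y` on triples `(u, ∂ₛ u, ∂ₜ u)`. -/
def flatShift (ε y : ℝ) : L2Strip × L2Strip × L2Strip →L[ℂ] L2Strip :=
  lift (-Complex.I • σ₁) ∘L ContinuousLinearMap.fst ℂ _ _ ∘L ContinuousLinearMap.snd ℂ _ _
  + ((1 / ε : ℝ) : ℂ) • (lift (-Complex.I • σ₂) ∘L
      ContinuousLinearMap.snd ℂ _ _ ∘L ContinuousLinearMap.snd ℂ _ _)
  - ((Real.pi / (4 * ε) : ℝ) : ℂ) • ((Pplus - Pminus) ∘L ContinuousLinearMap.fst ℂ _ _)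
  - (y * Complex.I) • ContinuousLinearMap.fst ℂ _ _

theorem flatShift_apply (ε y : ℝ) (z : L2Strip × L2Strip × L2Strip) :
    flatShift ε y z = lift (-Complex.I • σ₁) z.2.1
      + ((1 / ε : ℝ) : ℂ) • lift (-Complex.I • σ₂) z.2.2
      - ((Real.pi / (4 * ε) : ℝ) : ℂ) • (Pplus - Pminus) z.1 - (y * Complex.I) • z.1 := rfl

/-- The modes decouple: `T₀/ε` contributes `freq j / ε` to the mass in the `j`-th mode, and the
renormalisation subtracts `modeSign j π/(4ε)`. -/
theorem adjoint_mode_flatShift (ε y : ℝ) {z : L2Strip × L2Strip × L2Strip} (hz : z ∈ stripH1)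
    (j : ℤ) : (mode j).adjoint (flatShift ε y z)
      = lineShift (gap j / ε) y ((mode j).adjoint z.1, (mode j).adjoint z.2.1) := by
  rw [flatShift_apply, lineShift_eq, map_sub, map_sub, map_add, map_smul, map_smul, map_smul,
    adjoint_mode_lift (by rw [mul_smul_comm, smul_mul_assoc]), adjoint_mode_transverse hz,
    adjoint_mode_Pplus_sub_Pminus, gap]
  have : (((freq j - modeSign j * (Real.pi / 4)) / ε : ℝ) : ℂ) =
      ((1 / ε : ℝ) : ℂ) * freq j - ((Real.pi / (4 * ε) : ℝ) : ℂ) * modeSign j := by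
    rw [← Complex.ofReal_mul, ← Complex.ofReal_mul, ← Complex.ofReal_sub]
    congr 1
    field_simp
  rw [this]
  module

/-- Parseval combined with `norm_lineShift_sq` in each mode. Nonnegativity of the terms bounds `u`
and `∂ₛu`; the size of the gaps makes the higher modes small. -/
theorem hasSum_gap (ε y : ℝ) {z : L2Strip × L2Strip × L2Strip} (hz : z ∈ stripH1) :
    HasSum (fun j => (gap j / ε) ^ 2 * ‖(mode j).adjoint z.1‖ ^ 2)
      (‖flatShift ε y z‖ ^ 2 - ‖z.2.1‖ ^ 2 - y ^ 2 * ‖z.1‖ ^ 2) := by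
  refine (((hasSum_norm_sq_mode (flatShift ε y z)).sub (hasSum_norm_sq_mode z.2.1)).sub
    ((hasSum_norm_sq_mode z.1).mul_left (y ^ 2))).congr_fun fun j => ?_
  rw [adjoint_mode_flatShift ε y hz, norm_lineShift_sq _ _ (adjoint_mode_mem_lineH1 hz j)]
  ring

theorem norm_sq_le_flatShift (ε y : ℝ) {z : L2Strip × L2Strip × L2Strip} (hz : z ∈ stripH1) :
    ‖z.2.1‖ ^ 2 + y ^ 2 * ‖z.1‖ ^ 2 ≤ ‖flatShift ε y z‖ ^ 2 := by
  have := (hasSum_gap ε y hz).nonneg fun j => by positivity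
  linarith

theorem norm_longitudinal_le (ε y : ℝ) {z : L2Strip × L2Strip × L2Strip} (hz : z ∈ stripH1) :
    ‖z.2.1‖ ≤ ‖flatShift ε y z‖ := by
  refine (abs_le_of_sq_le_sq' ?_ (norm_nonneg _)).2
  have := norm_sq_le_flatShift ε y hz
  nlinarith [mul_nonneg (sq_nonneg y) (sq_nonneg ‖z.1‖)]

theorem norm_le_flatShift (ε y : ℝ) {z : L2Strip × L2Strip × L2Strip} (hz : z ∈ stripH1) :
    |y| * ‖z.1‖ ≤ ‖flatShift ε y z‖ := by
  refine (abs_le_of_sq_le_sq' ?_ (norm_nonneg _)).2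
  have := norm_sq_le_flatShift ε y hz
  rw [mul_pow, sq_abs]
  nlinarith [sq_nonneg ‖z.2.1‖]

theorem norm_sub_mode_zero_sq (u : L2Strip) :
    ‖u - mode 0 ((mode 0).adjoint u)‖ ^ 2 = ‖u‖ ^ 2 - ‖(mode 0).adjoint u‖ ^ 2 := by
  have h : ⟪u - mode 0 ((mode 0).adjoint u), mode 0 ((mode 0).adjoint u)⟫_ℂ = 0 := by
    rw [← ContinuousLinearMap.adjoint_inner_left, map_sub, adjoint_mode_mode, if_pos rfl, sub_self,
      inner_zero_left]
  have := norm_add_sq_eq_norm_sq_add_norm_sq_of_inner_eq_zero _ _ h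
  rw [sub_add_cancel, norm_mode] at this
  linarith

/-- The components orthogonal to the zero mode are of order `ε`. -/
theorem norm_sub_mode_zero_le {ε : ℝ} (hε : 0 < ε) (y : ℝ) {z : L2Strip × L2Strip × L2Strip}
    (hz : z ∈ stripH1) :
    ‖z.1 - mode 0 ((mode 0).adjoint z.1)‖ ≤ ε * ‖flatShift ε y z‖ := by
  refine (abs_le_of_sq_le_sq' ?_ (by positivity)).2
  rw [norm_sub_mode_zero_sq]
  -- The Parseval series without the zero mode, scaled by `1/ε²`, is compared termwise with
  -- `hasSum_gap`, using `|gap j| ≥ π/2 > 1` for `j ≠ 0`.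
  have h1 := ((hasSum_norm_sq_mode z.1).sub
    (hasSum_ite_eq (0 : ℤ) (‖(mode 0).adjoint z.1‖ ^ 2))).mul_left ((1 / ε) ^ 2)
  have h2 := hasSum_le (fun j => ?_) h1 (hasSum_gap ε y hz)
  · have h3 : (1 / ε) ^ 2 * (‖z.1‖ ^ 2 - ‖(mode 0).adjoint z.1‖ ^ 2) ≤ ‖flatShift ε y z‖ ^ 2 := by
      nlinarith [sq_nonneg ‖z.2.1‖, mul_nonneg (sq_nonneg y) (sq_nonneg ‖z.1‖)]
    rw [one_div, inv_pow, inv_mul_le_iff₀ (by positivity)] at h3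
    rw [mul_pow]
    exact h3
  · by_cases hj : j = 0
    · subst hj
      simp only [if_true, sub_self, mul_zero]
      positivity
    · simp only [if_neg hj, sub_zero]
      refine mul_le_mul_of_nonneg_right ?_ (sq_nonneg _)
      refine sq_le_sq.2 ?_
      rw [abs_div, abs_div, abs_one]
      refine div_le_div_of_nonneg_right ?_ (abs_nonneg _)
      linarith [le_abs_gap hj, Real.pi_gt_three]

theorem exists_mode_mem_stripH1 (j : ℤ) {b b' : L2Line} (hb : (b, b') ∈ lineH1) :
    ∃ ut, (mode j b, mode j b', ut) ∈ stripH1 := by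
  have hc := hasTraces_tensor (hasDerivAt_cosMap (freq j)) b
  have hs := hasTraces_tensor (hasDerivAt_sinMap (freq j)) (lift σ₁ b)
  have h := (hc.add (hs.smul (-1))).smul (((Real.sqrt 2)⁻¹ : ℝ) : ℂ)
  have e (x : L2Line) : (((Real.sqrt 2)⁻¹ : ℝ) : ℂ) • (tensor (cosMap (freq j)) x + (-1 : ℂ) •
      tensor (sinMap (freq j)) (lift σ₁ x)) = mode j x := by
    rw [mode_apply, neg_one_smul, sub_eq_add_neg]
  have hw := ((isWeakDeriv_tensor (cosMap (freq j)) hb).add ((isWeakDeriv_tensor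
    (sinMap (freq j)) (lineH1_lift σ₁ hb)).smul (-1))).smul (((Real.sqrt 2)⁻¹ : ℝ) : ℂ)
  rw [e] at h
  rw [e, e] at hw
  rw [cosMap_freq_one, cosMap_freq_neg_one, sinMap_freq_one, sinMap_freq_neg_one] at h
  have k : lift σ₁ (lift σ₁ b) = b := by rw [← lift_mul, σ₁_sq, lift_one]
  refine ⟨_, hw, h.isWeakDeriv, _, _, h, (boundary_top_iff _).2 ?_, (boundary_bot_iff _).2 ?_⟩
  · rw [lift_add, lift_one]
    simp only [map_smul, map_add, k]
    module
  · rw [sub_eq_add_neg, lift_add, lift_one, lift_neg]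
    simp only [map_smul, map_add, k]
    push_cast
    module

/-- The one-dimensional equation is solved in the `j`-th mode and the solution reinserted. Since the
range contains every mode, its orthogonal complement is trivial. -/
theorem mode_mem_range_flatShift (ε : ℝ) {y : ℝ} (hy : y ≠ 0) (j : ℤ) (a : L2Line) :
    ∃ z ∈ stripH1, flatShift ε y z = mode j a := by
  obtain ⟨w, hw, rfl⟩ := lineShift_surjective (gap j / ε) hy a
  obtain ⟨ut, hz⟩ := exists_mode_mem_stripH1 j hw
  refine ⟨_, hz, ?_⟩
  rw [← sub_eq_zero]
  refine eq_zero_of_adjoint_mode fun k => ?_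
  rw [map_sub, adjoint_mode_flatShift _ _ hz]
  simp only [adjoint_mode_mode]
  split_ifs with h
  · rw [h, sub_self]
  · rw [sub_zero]
    exact map_zero _

theorem norm_lift_σ₂ (u : L2Strip) : ‖lift (-Complex.I • σ₂) u‖ = ‖u‖ := by
  rw [neg_I_smul_σ₂, lift_mul, norm_lift_σ₁, norm_lift_σ₃]

theorem norm_lift_neg_I_σ₁ {X : Type*} [MeasurableSpace X] {μ : Measure X} (u : Lp Spinor 2 μ) :
    ‖lift (-Complex.I • σ₁) u‖ = ‖u‖ := by
  rw [lift_smul, norm_smul, norm_lift_σ₁, norm_neg, Complex.norm_I, one_mul]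

/-- Once `u` and `∂ₛu` are bounded, `∂ₜu` is read off from the equation itself. The constant may
depend on `ε`, since it serves only to make the range closed. -/
theorem exists_bound_flatShift {ε : ℝ} (hε : 0 < ε) {y : ℝ} (hy : y ≠ 0) :
    ∃ c > 0, ∀ z ∈ stripH1, ‖z‖ ≤ c * ‖flatShift ε y z‖ := by
  set B := ‖((Real.pi / (4 * ε) : ℝ) : ℂ) • (Pplus - Pminus)‖ with hB
  have hB0 : 0 ≤ B := norm_nonneg _
  have hy' : 0 < |y| := abs_pos.2 hy
  refine ⟨1 + 1 / |y| + ε * (1 + 1 + B * (1 / |y|) + 1), by positivity, fun z hz => ?_⟩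
  set N := ‖flatShift ε y z‖ with hN
  have hN0 : 0 ≤ N := norm_nonneg _
  have h1 : ‖z.2.1‖ ≤ N := norm_longitudinal_le ε y hz
  have h2 : |y| * ‖z.1‖ ≤ N := norm_le_flatShift ε y hz
  have h2' : ‖z.1‖ ≤ 1 / |y| * N := by
    rw [one_div, ← div_eq_inv_mul, le_div_iff₀ hy']
    linarith
  have h3 : ‖z.2.2‖ ≤ ε * (N + N + B * ‖z.1‖ + N) := by
    have e : ((1 / ε : ℝ) : ℂ) • lift (-Complex.I • σ₂) z.2.2 = flatShift ε y z
        - lift (-Complex.I • σ₁) z.2.1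
        + (((Real.pi / (4 * ε) : ℝ) : ℂ) • (Pplus - Pminus)) z.1 + (y * Complex.I) • z.1 := by
      rw [flatShift_apply, smul_apply]
      abel
    have h4 := congrArg norm e
    rw [norm_smul, norm_lift_σ₂, Complex.norm_real, Real.norm_eq_abs, abs_of_pos (by positivity)]
      at h4
    have h5 : ‖flatShift ε y z - lift (-Complex.I • σ₁) z.2.1
        + (((Real.pi / (4 * ε) : ℝ) : ℂ) • (Pplus - Pminus)) z.1 + (y * Complex.I) • z.1‖
        ≤ N + N + B * ‖z.1‖ + N := by
      refine (norm_add_le _ _).trans (add_le_add ((norm_add_le _ _).trans (add_le_add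
        ((norm_sub_le _ _).trans (add_le_add le_rfl ?_)) ?_)) ?_)
      · rwa [norm_lift_neg_I_σ₁]
      · exact ContinuousLinearMap.le_opNorm _ _
      · rw [norm_smul, norm_mul, Complex.norm_I, mul_one, Complex.norm_real, Real.norm_eq_abs]
        exact h2
    rw [← h4, one_div, inv_mul_le_iff₀ hε] at h5
    exact h5
  have h6 : B * ‖z.1‖ ≤ B * (1 / |y|) * N := by
    rw [mul_assoc]
    exact mul_le_mul_of_nonneg_left h2' hB0
  have h7 : ‖z.2.2‖ ≤ ε * (1 + 1 + B * (1 / |y|) + 1) * N := by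
    refine h3.trans ?_
    rw [mul_assoc]
    refine mul_le_mul_of_nonneg_left ?_ hε.le
    linarith
  have p1 : 0 ≤ 1 / |y| * N := by positivity
  have p2 : 0 ≤ ε * (1 + 1 + B * (1 / |y|) + 1) * N := by positivity
  refine norm_prod_le_iff.2 ⟨?_, norm_prod_le_iff.2 ⟨?_, ?_⟩⟩ <;> linarith

theorem flatShift_surjective {ε : ℝ} (hε : 0 < ε) {y : ℝ} (hy : y ≠ 0) (f : L2Strip) :
    ∃ z ∈ stripH1, flatShift ε y z = f := by
  obtain ⟨c, hc, h⟩ := exists_bound_flatShift hε hy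
  refine surjective_of_boundedBelow stripH1 isClosed_stripH1 (flatShift ε y) hc h (fun g hg => ?_) f
  refine eq_zero_of_adjoint_mode fun j => ext_inner_left ℂ fun a => ?_
  obtain ⟨z, hz, e⟩ := mode_mem_range_flatShift ε hy j a
  rw [ContinuousLinearMap.adjoint_inner_right, ← e, hg z hz, inner_zero_right]

/-! ### Perturbation of bijective operators -/

/-- A relatively small perturbation of an operator that maps `X` bijectively to `H` maps `X`
onto `H`. -/
theorem surjective_add_of_relatively_small {Z H : Type*} [NormedAddCommGroup Z] [NormedSpace ℂ Z]
    [NormedAddCommGroup H] [NormedSpace ℂ H] [CompleteSpace H] (X : Submodule ℂ Z)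
    (T K : Z →L[ℂ] H) (hi : ∀ x ∈ X, T x = 0 → x = 0) (hs : ∀ f, ∃ x ∈ X, T x = f) {θ : ℝ}
    (hθ : θ < 1) (h0 : 0 ≤ θ) (hK : ∀ x ∈ X, ‖K x‖ ≤ θ * ‖T x‖) (f : H) :
    ∃ x ∈ X, (T + K) x = f := by
  let e : X ≃ₗ[ℂ] H := LinearEquiv.ofBijective (T.toLinearMap ∘ₗ X.subtype)
    ⟨(injective_iff_map_eq_zero _).2 fun x hx => Subtype.ext (hi x x.2 hx),
      fun f => (hs f).elim fun x hx => ⟨⟨x, hx.1⟩, hx.2⟩⟩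
  have he (g : H) : T (e.symm g) = g := e.apply_symm_apply g
  -- Transported to `H`, the perturbation is `K T⁻¹`, of norm at most `θ < 1`; adding it to the
  -- identity leaves an invertible operator by the Neumann series.
  let N : H →L[ℂ] H := (K.toLinearMap ∘ₗ X.subtype ∘ₗ e.symm.toLinearMap).mkContinuous θ
    fun g => (hK _ (e.symm g).2).trans (by rw [he])
  have hN (g : H) : N g = K (e.symm g) := rfl
  have hN1 : ‖-N‖ < 1 := by
    rw [norm_neg]
    exact (LinearMap.mkContinuous_norm_le _ h0 _).trans_lt hθ
  obtain ⟨g, hg⟩ : ∃ g, g + N g = f := by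
    obtain ⟨v, hv⟩ := isUnit_one_sub_of_norm_lt_one hN1
    refine ⟨(v⁻¹ : (H →L[ℂ] H)ˣ).val f, ?_⟩
    have : (v.val * (v⁻¹ : (H →L[ℂ] H)ˣ).val) f = f := by rw [Units.mul_inv]; rfl
    rw [hv, sub_neg_eq_add] at this
    exact this
  refine ⟨e.symm g, (e.symm g).2, ?_⟩
  rw [add_apply, he, ← hN, hg]

/-! ### The straight operator with a mass term -/

theorem eq_zero_of_mem_stripH1 {z : L2Strip × L2Strip × L2Strip} (hz : z ∈ stripH1)
    (h : z.1 = 0) : z = 0 := by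
  obtain ⟨u, us, ut⟩ := z
  obtain ⟨h1, h2, -⟩ := hz
  simp only at h
  subst h
  obtain rfl := h1.eq_zero isOpen_strip
  obtain rfl := h2.eq_zero isOpen_strip
  rfl

/-- The operator `flatShift` with an additional mass term `m σ₃`. -/
def massiveShift (ε m y : ℝ) : L2Strip × L2Strip × L2Strip →L[ℂ] L2Strip :=
  flatShift ε y + (m : ℂ) • (lift σ₃ ∘L ContinuousLinearMap.fst ℂ _ _)

theorem massiveShift_apply (ε m y : ℝ) (z : L2Strip × L2Strip × L2Strip) :
    massiveShift ε m y z = flatShift ε y z + (m : ℂ) • lift σ₃ z.1 := rfl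

theorem flatShift_eq_sub (ε y : ℝ) (z : L2Strip × L2Strip × L2Strip) :
    flatShift ε y z = flatShift ε 0 z - (y : ℂ) • Complex.I • z.1 := by
  rw [flatShift_apply, flatShift_apply, Complex.ofReal_zero, zero_mul, zero_smul, sub_zero,
    smul_smul]

theorem norm_sub_real_smul_sq {H : Type*} [NormedAddCommGroup H] [InnerProductSpace ℂ H] (a b : H)
    (y : ℝ) :
    ‖a - (y : ℂ) • b‖ ^ 2 = ‖a‖ ^ 2 - 2 * y * (⟪a, b⟫_ℂ).re + y ^ 2 * ‖b‖ ^ 2 := by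
  rw [@norm_sub_sq ℂ, inner_smul_right, norm_smul, mul_pow, Complex.norm_real, Real.norm_eq_abs,
    sq_abs]
  simp only [RCLike.re_to_complex, Complex.re_ofReal_mul]
  ring

/-- The series in `hasSum_gap` does not involve `y`. Comparing its sums for `y = 1` and `y = 0`
shows that the cross term vanishes, which expresses the symmetry of the operator. -/
theorem re_inner_flatShift (ε : ℝ) {z : L2Strip × L2Strip × L2Strip} (hz : z ∈ stripH1) :
    (⟪flatShift ε 0 z, Complex.I • z.1⟫_ℂ).re = 0 := by
  have h := (hasSum_gap ε 1 hz).unique (hasSum_gap ε 0 hz)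
  rw [flatShift_eq_sub ε 1, norm_sub_real_smul_sq, norm_smul, Complex.norm_I] at h
  linarith

theorem re_inner_lift_I_smul {X : Type*} [MeasurableSpace X] {μ : Measure X}
    {K : Matrix (Fin 2) (Fin 2) ℂ} (hK : K.conjTranspose = K) (u : Lp Spinor 2 μ) :
    (⟪lift K u, Complex.I • u⟫_ℂ).re = 0 := by
  have h : (⟪lift K u, u⟫_ℂ).im = 0 := by
    have h1 : ⟪lift K u, u⟫_ℂ = (starRingEnd ℂ) ⟪lift K u, u⟫_ℂ := by
      rw [inner_conj_symm, lift_inner, hK]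
    have h2 := congrArg Complex.im h1
    rw [Complex.conj_im] at h2
    linarith
  rw [inner_smul_right, Complex.mul_re, Complex.I_re, Complex.I_im, h]
  ring

/-- With the Hermitian mass included, the operator at `y = 0` is still symmetric, so subtracting
`iyu` adds `y²‖u‖²` to the squared norm. -/
theorem norm_le_massiveShift (ε m y : ℝ) {z : L2Strip × L2Strip × L2Strip} (hz : z ∈ stripH1) :
    |y| * ‖z.1‖ ≤ ‖massiveShift ε m y z‖ := by
  refine (abs_le_of_sq_le_sq' ?_ (norm_nonneg _)).2
  have e : massiveShift ε m y z
      = (flatShift ε 0 z + (m : ℂ) • lift σ₃ z.1) - (y : ℂ) • Complex.I • z.1 := by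
    rw [massiveShift_apply, flatShift_eq_sub]
    abel
  have h : (⟪flatShift ε 0 z + (m : ℂ) • lift σ₃ z.1, Complex.I • z.1⟫_ℂ).re = 0 := by
    rw [inner_add_left, Complex.add_re, re_inner_flatShift ε hz, inner_smul_left,
      Complex.conj_ofReal, Complex.re_ofReal_mul, re_inner_lift_I_smul σ₃_herm, mul_zero, add_zero]
  rw [e, norm_sub_real_smul_sq, h, norm_smul, Complex.norm_I, one_mul, mul_pow, sq_abs, mul_zero,
    sub_zero]
  nlinarith [sq_nonneg ‖flatShift ε 0 z + (m : ℂ) • lift σ₃ z.1‖]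

/-- The mass term is bounded by `m‖u‖`, hence by `m` times the massive norm. This transfers the flat
estimates to the massive operator, uniformly in `ε`. -/
theorem norm_flatShift_le (ε : ℝ) {m : ℝ} (hm : 0 ≤ m) {z : L2Strip × L2Strip × L2Strip}
    (hz : z ∈ stripH1) : ‖flatShift ε 1 z‖ ≤ (1 + m) * ‖massiveShift ε m 1 z‖ := by
  have h := norm_le_massiveShift ε m 1 hz
  rw [abs_one, one_mul] at h
  have e : flatShift ε 1 z = massiveShift ε m 1 z - (m : ℂ) • lift σ₃ z.1 := by
    rw [massiveShift_apply, add_sub_cancel_right]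
  rw [e]
  refine (norm_sub_le _ _).trans ?_
  rw [norm_smul, norm_lift_σ₃, Complex.norm_real, Real.norm_eq_abs, abs_of_nonneg hm]
  nlinarith

theorem massiveShift_injective (ε m : ℝ) {y : ℝ} (hy : y ≠ 0) {z : L2Strip × L2Strip × L2Strip}
    (hz : z ∈ stripH1) (h : massiveShift ε m y z = 0) : z = 0 := by
  refine eq_zero_of_mem_stripH1 hz (norm_le_zero_iff.1 ?_)
  have := norm_le_massiveShift ε m y hz
  rw [h, norm_zero] at this
  exact nonpos_of_mul_nonpos_right this (abs_pos.2 hy)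

/-- At `y = 1` the mass need not be relatively small. At `y = m + 1` its relative bound is `m/(m +
1) < 1`, so it can be added there; returning to `y = 1` is a perturbation by `im` with the same
relative bound. -/
theorem massiveShift_surjective {ε m : ℝ} (hε : 0 < ε) (hm : 0 ≤ m) (f : L2Strip) :
    ∃ z ∈ stripH1, massiveShift ε m 1 z = f := by
  have hY : (m + 1 : ℝ) ≠ 0 := by positivity
  have hθ : m / (m + 1) < 1 := by rw [div_lt_one (by positivity)]; linarith
  have bound {z : L2Strip × L2Strip × L2Strip} {N : ℝ} (h : |m + 1| * ‖z.1‖ ≤ N) :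
      m * ‖z.1‖ ≤ m / (m + 1) * N := by
    rw [abs_of_nonneg (by positivity)] at h
    rw [div_mul_eq_mul_div, le_div_iff₀ (by positivity)]
    nlinarith
  have h1 (f : L2Strip) : ∃ z ∈ stripH1, massiveShift ε m (m + 1) z = f := by
    refine surjective_add_of_relatively_small stripH1 (flatShift ε (m + 1))
      ((m : ℂ) • (lift σ₃ ∘L ContinuousLinearMap.fst ℂ _ _)) (fun z hz h => ?_)
      (flatShift_surjective hε hY) hθ (by positivity) (fun z hz => ?_) f
    · refine massiveShift_injective ε 0 hY hz ?_
      rw [massiveShift_apply, h, Complex.ofReal_zero, zero_smul, zero_add]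
    · rw [smul_apply, norm_smul, Complex.norm_real, Real.norm_eq_abs, abs_of_nonneg hm]
      change m * ‖lift σ₃ z.1‖ ≤ _
      rw [norm_lift_σ₃]
      exact bound (norm_le_flatShift ε (m + 1) hz)
  obtain ⟨z, hz, h⟩ := surjective_add_of_relatively_small stripH1 (massiveShift ε m (m + 1))
    ((m : ℂ) • Complex.I • ContinuousLinearMap.fst ℂ _ _)
    (fun z hz h => massiveShift_injective ε m hY hz h) h1 hθ (by positivity) (fun z hz => by
      rw [smul_apply, smul_apply, norm_smul, norm_smul, Complex.norm_I, one_mul, Complex.norm_real,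
        Real.norm_eq_abs, abs_of_nonneg hm]
      exact bound (norm_le_massiveShift ε m (m + 1) hz)) f
  refine ⟨z, hz, ?_⟩
  rw [← h, add_apply, massiveShift_apply, massiveShift_apply, flatShift_eq_sub ε 1,
    flatShift_eq_sub ε (m + 1)]
  change _ = _ + (m : ℂ) • Complex.I • z.1
  push_cast
  module

/-! ### The effective mass -/

theorem adjoint_tensor_tensor (h g : C(ℝ, ℝ)) (a : L2Line) : (tensor h).adjoint (tensor g a) =
    ((∫ t in Ioo (-1 : ℝ) 1, h t * g t : ℝ) : ℂ) • a := by
  refine ext_inner_left ℂ fun b => ?_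
  rw [ContinuousLinearMap.adjoint_inner_right, inner_tensor, inner_smul_right]

theorem integral_cos_sq_sub_sin_sq :
    (∫ t in Ioo (-1 : ℝ) 1, Real.cos (freq 0 * t) * Real.cos (freq 0 * t))
      - ∫ t in Ioo (-1 : ℝ) 1, Real.sin (freq 0 * t) * Real.sin (freq 0 * t) = 4 / Real.pi := by
  have hpi := Real.pi_pos
  rw [← integral_sub (integrable_of_continuous_Ioo (by fun_prop))
    (integrable_of_continuous_Ioo (by fun_prop)), integral_Ioo_eq_intervalIntegral]
  have e (t : ℝ) : Real.cos (freq 0 * t) * Real.cos (freq 0 * t)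
      - Real.sin (freq 0 * t) * Real.sin (freq 0 * t) = Real.cos (Real.pi / 2 * t) := by
    rw [← Real.cos_add]
    congr 1
    simp only [freq]
    push_cast
    ring
  simp only [e]
  rw [intervalIntegral.integral_comp_mul_left (fun t => Real.cos t) (by positivity), integral_cos,
    mul_one, mul_neg_one, Real.sin_neg, Real.sin_pi_div_two, smul_eq_mul]
  field_simp
  norm_num

/-- As `σ₃` anticommutes with `σ₁`, the two mode factors around it combine to `½(cos² - sin²)σ₃ = ½
cos (πt/2) σ₃`, whose integral over `(-1, 1)` is `(2/π)σ₃`. -/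
theorem adjoint_mode_zero_mass (a : L2Line) : (mode 0).adjoint (lift σ₃ (mode 0 a))
    = ((2 / Real.pi : ℝ) : ℂ) • lift σ₃ a := by
  have k (x : L2Line) : lift σ₃ (lift σ₁ x) = - lift σ₁ (lift σ₃ x) := by
    rw [← lift_mul, ← lift_mul, σ₃_mul_σ₁, lift_neg]
  have k2 (x : L2Line) : lift σ₁ (lift σ₁ x) = x := by rw [← lift_mul, σ₁_sq, lift_one]
  have hz1 (a : L2Line) :
      (tensor (cosMap (freq 0))).adjoint (tensor (sinMap (freq 0)) a) = 0 := by
    rw [adjoint_tensor_tensor]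
    simp only [cosMap_apply, sinMap_apply, integral_cos_mul_sin, Complex.ofReal_zero, zero_smul]
  have hz2 (a : L2Line) :
      (tensor (sinMap (freq 0))).adjoint (tensor (cosMap (freq 0)) a) = 0 := by
    rw [adjoint_tensor_tensor]
    simp only [cosMap_apply, sinMap_apply]
    simp only [mul_comm (Real.sin _), integral_cos_mul_sin, Complex.ofReal_zero, zero_smul]
  have h := integral_cos_sq_sub_sin_sq
  have hr : (((Real.sqrt 2)⁻¹ : ℝ) : ℂ) * (((Real.sqrt 2)⁻¹ : ℝ) : ℂ) = 1 / 2 := by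
    rw [← Complex.ofReal_mul, ← mul_inv, Real.mul_self_sqrt (by norm_num)]
    norm_num
  rw [mode_apply, map_smul, map_sub, ← tensor_lift, ← tensor_lift, k, adjoint_mode]
  simp only [map_smul, map_sub, map_neg, hz1, hz2, adjoint_tensor_tensor, cosMap_apply,
    sinMap_apply, k2, map_zero]
  set A := ∫ t in Ioo (-1 : ℝ) 1, Real.cos (freq 0 * t) * Real.cos (freq 0 * t)
  set B := ∫ t in Ioo (-1 : ℝ) 1, Real.sin (freq 0 * t) * Real.sin (freq 0 * t)
  have e : (2 / Real.pi : ℝ) = 1 / 2 * (A - B) := by rw [h]; ring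
  rw [e]
  push_cast

  rw [← hr]
  push_cast
  module

/-- The flat part decouples with `gap 0 = 0`, and the mass on the zero mode produces the effective
mass. The last term is the only coupling to the other modes; it is small by `norm_sub_mode_zero_le`.
-/
theorem adjoint_mode_zero_massiveShift (ε m : ℝ) {z : L2Strip × L2Strip × L2Strip}
    (hz : z ∈ stripH1) : (mode 0).adjoint (massiveShift ε m 1 z)
      = lineShift (2 / Real.pi * m) 1 ((mode 0).adjoint z.1, (mode 0).adjoint z.2.1)
        + (m : ℂ) • (mode 0).adjoint (lift σ₃ (z.1 - mode 0 ((mode 0).adjoint z.1))) := by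
  rw [massiveShift_apply, map_add, adjoint_mode_flatShift _ _ hz, map_smul, map_sub, map_sub,
    adjoint_mode_zero_mass, gap_zero, zero_div, lineShift_eq, lineShift_eq]
  push_cast
  module

theorem norm_adjoint_mode_le (j : ℤ) (u : L2Strip) : ‖(mode j).adjoint u‖ ≤ ‖u‖ := by
  refine (abs_le_of_sq_le_sq' ?_ (norm_nonneg _)).2
  exact (hasSum_norm_sq_mode u).summable.le_tsum j (fun _ _ => sq_nonneg _) |>.trans_eq
    (hasSum_norm_sq_mode u).tsum_eq

/-! ### The curvature terms -/

theorem exists_multiplication {X : Type*} [MeasurableSpace X] {μ : Measure X} {c : X → ℝ}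
    (hc : AEStronglyMeasurable c μ) {B : ℝ} (hB : ∀ᵐ x ∂μ, |c x| ≤ B) :
    ∃ M : Lp Spinor 2 μ →L[ℂ] Lp Spinor 2 μ,
      (∀ u, M u =ᵐ[μ] fun x => c x • u x) ∧ ∀ u, ‖M u‖ ≤ B * ‖u‖ := by
  have hm (u : Lp Spinor 2 μ) : MemLp (fun x => c x • u x) 2 μ :=
    (Lp.memLp u).smul (r := 2) (memLp_top_of_bound hc B hB)
  have hb (u : Lp Spinor 2 μ) : ‖(hm u).toLp‖ ≤ B * ‖u‖ := by
    refine Lp.norm_le_mul_norm_of_ae_le_mul ?_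
    filter_upwards [(hm u).coeFn_toLp, hB] with x h1 h2
    rw [h1, norm_smul]
    exact mul_le_mul_of_nonneg_right h2 (norm_nonneg _)
  let M : Lp Spinor 2 μ →ₗ[ℂ] Lp Spinor 2 μ :=
    { toFun := fun u => (hm u).toLp
      map_add' := fun u v => by
        refine Lp.ext ?_
        filter_upwards [(hm (u + v)).coeFn_toLp, (hm u).coeFn_toLp, (hm v).coeFn_toLp,
          Lp.coeFn_add u v, Lp.coeFn_add (hm u).toLp (hm v).toLp] with x h1 h2 h3 h4 h5
        rw [h1, h5, Pi.add_apply, h2, h3, h4, Pi.add_apply, smul_add]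
      map_smul' := fun k u => by
        refine Lp.ext ?_
        filter_upwards [(hm (k • u)).coeFn_toLp, (hm u).coeFn_toLp, Lp.coeFn_smul k u,
          Lp.coeFn_smul k (hm u).toLp] with x h1 h2 h3 h4
        rw [h1, RingHom.id_apply, h4, Pi.smul_apply, h2, h3, Pi.smul_apply, smul_comm] }
  exact ⟨M.mkContinuous B hb, fun u => (hm u).coeFn_toLp, hb⟩

theorem IsBaseCurve.measurable_curvature {γ : ℝ → EuclideanSpace ℝ (Fin 2)} (h : IsBaseCurve γ) :
    Measurable (curvature γ) := by
  have c2 := ((contDiff_succ_iff_deriv (n := 2)).1 h.contDiff).2.2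
  have c1 := ((contDiff_succ_iff_deriv (n := 1)).1 c2).2.2
  have k : curvature γ = fun s =>
      -(deriv γ s 1) * deriv (deriv γ) s 0 + deriv γ s 0 * deriv (deriv γ) s 1 := by
    funext s
    simp [curvature, normal, PiLp.inner_apply, Fin.sum_univ_two]
    ring
  rw [k]
  have := c2.continuous
  have := c1.continuous
  fun_prop

theorem exists_ae_bound_of_memLp_top {f : ℝ → ℝ} (h : eLpNorm f ⊤ volume ≠ ⊤) :
    ∃ K : ℝ, ∀ᵐ s, |f s| ≤ K := by
  refine ⟨(eLpNorm f ⊤ volume).toReal, ?_⟩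
  filter_upwards [ae_le_eLpNormEssSup (f := f) (μ := volume)] with s hs
  rw [eLpNorm_exponent_top, ← Real.norm_eq_abs, ← toReal_enorm]
  exact ENNReal.toReal_mono (by rwa [← eLpNorm_exponent_top]) hs

/-- An infinite essential supremum of the curvature would violate `small`. Taking the maximum with
`1` keeps `K` positive also for a straight line. -/
theorem IsBaseCurve.exists_curvature_bound {γ : ℝ → EuclideanSpace ℝ (Fin 2)} (h : IsBaseCurve γ)
    {ε : ℝ} (hε : IsAdmissibleWidth γ ε) :
    ∃ K > 0, (∀ᵐ s, |curvature γ s| ≤ K) ∧ ∀ᵐ s, |deriv (curvature γ) s| ≤ K := by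
  obtain ⟨K₁, h1⟩ := exists_ae_bound_of_memLp_top (f := curvature γ) fun e => by
    have := hε.small
    rw [e, ENNReal.mul_top (by simpa using hε.pos)] at this
    exact absurd this (by simp)
  obtain ⟨K₂, h2⟩ := exists_ae_bound_of_memLp_top h.deriv_curvature.2.ne
  refine ⟨max 1 (max K₁ K₂), by positivity, ?_, ?_⟩
  · filter_upwards [h1] with s hs
    exact hs.trans ((le_max_left _ _).trans (le_max_right _ _))
  · filter_upwards [h2] with s hs
    exact hs.trans ((le_max_right _ _).trans (le_max_right _ _))

/-- The terms of the operator that involve the curvature are of order `ε`. -/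
theorem exists_curvature_term {κ : ℝ → ℝ} (hκ : Measurable κ) {K : ℝ}
    (h1 : ∀ᵐ s, |κ s| ≤ K) (h2 : ∀ᵐ s, |deriv κ s| ≤ K) {ε : ℝ} (hε : 0 < ε) (hK : ε * K ≤ 1 / 2) :
    ∃ T : L2Strip × L2Strip × L2Strip →L[ℂ] L2Strip,
      (∀ z, T z =ᵐ[volume.restrict strip] fun p =>
        (1 / (1 - ε * p.2 * κ p.1) - 1) • act (-Complex.I • σ₁) (z.2.1 p) +
        (ε * p.2 * deriv κ p.1 / (2 * (1 - ε * p.2 * κ p.1) ^ 2)) •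
          act (-Complex.I • σ₁) (z.1 p)) ∧
      ∀ z, ‖T z‖ ≤ 2 * (ε * K) * (‖z.2.1‖ + ‖z.1‖) := by
  have hm := measurable_deriv κ
  have hst : ∀ᵐ p ∂((volume : Measure (ℝ × ℝ)).restrict strip), |p.2| ≤ 1 := by
    filter_upwards [ae_restrict_mem isOpen_strip.measurableSet] with p hp
    exact abs_le.2 ⟨hp.2.1.le, hp.2.2.le⟩
  have hb {a b : ℝ} (ha : |a| ≤ 1) (hb : |b| ≤ K) : |ε * a * b| ≤ ε * K := by
    rw [abs_mul, abs_mul, abs_of_pos hε, mul_assoc]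
    refine mul_le_mul_of_nonneg_left ?_ hε.le
    nlinarith [abs_nonneg b]
  have hlow : ∀ᵐ p ∂((volume : Measure (ℝ × ℝ)).restrict strip),
      1 / 2 ≤ 1 - ε * p.2 * κ p.1 := by
    filter_upwards [hst, ae_strip_of_ae_line h1] with p k1 k2
    linarith [(abs_le.1 (hb k1 k2)).2]
  obtain ⟨M₁, a1, b1⟩ := exists_multiplication (μ := (volume : Measure (ℝ × ℝ)).restrict strip)
    (c := fun p => 1 / (1 - ε * p.2 * κ p.1) - 1)
    (Measurable.aestronglyMeasurable (by fun_prop)) (B := 2 * (ε * K)) (by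
      filter_upwards [hst, ae_strip_of_ae_line h1, hlow] with p k1 k2 k3
      have k4 := hb k1 k2
      -- The coefficient has the form `x / (1 - x)`, at most `2|x|` in modulus because `1 - x ≥
      -- 1/2`.
      have k5 : 1 / (1 - ε * p.2 * κ p.1) - 1 = ε * p.2 * κ p.1 / (1 - ε * p.2 * κ p.1) := by
        have : 1 - ε * p.2 * κ p.1 ≠ 0 := by linarith
        field_simp
        ring
      rw [k5, abs_div, abs_of_pos (show 0 < 1 - ε * p.2 * κ p.1 by linarith),
        div_le_iff₀ (by linarith)]
      nlinarith [abs_nonneg (ε * p.2 * κ p.1)])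
  obtain ⟨M₂, a2, b2⟩ := exists_multiplication (μ := (volume : Measure (ℝ × ℝ)).restrict strip)
    (c := fun p => ε * p.2 * deriv κ p.1 / (2 * (1 - ε * p.2 * κ p.1) ^ 2))
    (Measurable.aestronglyMeasurable (by fun_prop)) (B := 2 * (ε * K)) (by
      filter_upwards [hst, ae_strip_of_ae_line h2, hlow] with p k1 k2 k3
      have k4 := hb k1 k2
      have k5 : 1 / 2 ≤ 2 * (1 - ε * p.2 * κ p.1) ^ 2 := by nlinarith
      rw [abs_div, abs_of_pos (show 0 < 2 * (1 - ε * p.2 * κ p.1) ^ 2 by linarith),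
        div_le_iff₀ (by linarith)]
      nlinarith [abs_nonneg (ε * p.2 * deriv κ p.1)])
  refine ⟨M₁ ∘L lift (-Complex.I • σ₁) ∘L ContinuousLinearMap.fst ℂ _ _ ∘L
      ContinuousLinearMap.snd ℂ _ _ +
    M₂ ∘L lift (-Complex.I • σ₁) ∘L ContinuousLinearMap.fst ℂ _ _, fun z => ?_, fun z => ?_⟩
  · change (M₁ (lift (-Complex.I • σ₁) z.2.1) + M₂ (lift (-Complex.I • σ₁) z.1) : L2Strip)
      =ᵐ[volume.restrict strip] _
    filter_upwards [Lp.coeFn_add (M₁ (lift (-Complex.I • σ₁) z.2.1))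
      (M₂ (lift (-Complex.I • σ₁) z.1)), a1 (lift (-Complex.I • σ₁) z.2.1),
      a2 (lift (-Complex.I • σ₁) z.1), coeFn_lift (-Complex.I • σ₁) z.2.1,
      coeFn_lift (-Complex.I • σ₁) z.1] with p k1 k2 k3 k4 k5
    rw [k1, Pi.add_apply, k2, k3, k4, k5]
  · change ‖M₁ (lift (-Complex.I • σ₁) z.2.1) + M₂ (lift (-Complex.I • σ₁) z.1)‖ ≤ _
    refine (norm_add_le _ _).trans ?_
    rw [mul_add]
    refine add_le_add ((b1 _).trans_eq ?_) ((b2 _).trans_eq ?_) <;> rw [norm_lift_neg_I_σ₁]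

theorem mem_graph_vadd {H : Type*} [NormedAddCommGroup H] [NormedSpace ℂ H] (B : H →ₗ[ℂ] H)
    (A : H →ₗ.[ℂ] H) (p : H × H) : p ∈ (B +ᵥ A).graph ↔ (p.1, p.2 - B p.1) ∈ A.graph := by
  rw [LinearPMap.mem_graph_iff, LinearPMap.mem_graph_iff]
  constructor
  · rintro ⟨x, h1, h2⟩
    refine ⟨x, h1, ?_⟩
    simp only [← h2, ← h1, LinearPMap.vadd_apply]
    exact (add_sub_cancel_left _ _).symm
  · rintro ⟨x, h1, h2⟩
    refine ⟨x, h1, ?_⟩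
    rw [LinearPMap.vadd_apply]
    simp only at h1 h2
    rw [h2, ← h1]
    exact add_sub_cancel _ _

/-- On triples `(u, ∂ₛu, ∂ₜu)` the unbounded operator minus `i` is the restriction to `stripH1` of
the bounded operator `massiveShift ε m 1 + T`, to which the perturbation arguments apply. -/
theorem mem_renormalizedDirac_graph {κ : ℝ → ℝ} {ε m : ℝ}
    {T : L2Strip × L2Strip × L2Strip →L[ℂ] L2Strip}
    (hT : ∀ z, T z =ᵐ[volume.restrict strip] fun p =>
        (1 / (1 - ε * p.2 * κ p.1) - 1) • act (-Complex.I • σ₁) (z.2.1 p) +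
        (ε * p.2 * deriv κ p.1 / (2 * (1 - ε * p.2 * κ p.1) ^ 2)) •
          act (-Complex.I • σ₁) (z.1 p)) (p : L2Strip × L2Strip) :
    p ∈ (renormalizedDirac κ ε m).graph ↔
      ∃ z ∈ stripH1, z.1 = p.1 ∧ (massiveShift ε m 1 + T) z = p.2 - Complex.I • p.1 := by
  have e : (guideDirac κ ε m).graph = guideGraph κ ε m :=
    Submodule.toLinearPMap_graph_eq _ (guideGraph_single κ ε m)
  rw [renormalizedDirac, mem_graph_vadd, e]
  have key (z : L2Strip × L2Strip × L2Strip) (w : L2Strip) :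
      (w =ᵐ[volume.restrict strip] fun p =>
        (1 / (1 - ε * p.2 * κ p.1)) • act (-Complex.I • σ₁) (z.2.1 p)
        + (1 / ε) • act (-Complex.I • σ₂) (z.2.2 p)
        + (ε * p.2 * deriv κ p.1 / (2 * (1 - ε * p.2 * κ p.1) ^ 2)) •
            act (-Complex.I • σ₁) (z.1 p)
        + m • act σ₃ (z.1 p)) ↔
      w = lift (-Complex.I • σ₁) z.2.1 + ((1 / ε : ℝ) : ℂ) • lift (-Complex.I • σ₂) z.2.2
        + (m : ℂ) • lift σ₃ z.1 + T z := by
    have h : (lift (-Complex.I • σ₁) z.2.1 + ((1 / ε : ℝ) : ℂ) • lift (-Complex.I • σ₂) z.2.2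
        + (m : ℂ) • lift σ₃ z.1 + T z : L2Strip) =ᵐ[volume.restrict strip] fun p =>
        (1 / (1 - ε * p.2 * κ p.1)) • act (-Complex.I • σ₁) (z.2.1 p)
        + (1 / ε) • act (-Complex.I • σ₂) (z.2.2 p)
        + (ε * p.2 * deriv κ p.1 / (2 * (1 - ε * p.2 * κ p.1) ^ 2)) •
            act (-Complex.I • σ₁) (z.1 p)
        + m • act σ₃ (z.1 p) := by
      filter_upwards [hT z, coeFn_lift (-Complex.I • σ₁) z.2.1, coeFn_lift (-Complex.I • σ₂) z.2.2,
        coeFn_lift σ₃ z.1,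
        Lp.coeFn_smul ((1 / ε : ℝ) : ℂ) (lift (-Complex.I • σ₂) z.2.2),
        Lp.coeFn_smul (m : ℂ) (lift σ₃ z.1),
        Lp.coeFn_add (lift (-Complex.I • σ₁) z.2.1)
          (((1 / ε : ℝ) : ℂ) • lift (-Complex.I • σ₂) z.2.2),
        Lp.coeFn_add (lift (-Complex.I • σ₁) z.2.1 + ((1 / ε : ℝ) : ℂ) •
          lift (-Complex.I • σ₂) z.2.2) ((m : ℂ) • lift σ₃ z.1),
        Lp.coeFn_add (lift (-Complex.I • σ₁) z.2.1 + ((1 / ε : ℝ) : ℂ) •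
          lift (-Complex.I • σ₂) z.2.2 + (m : ℂ) • lift σ₃ z.1) (T z)]
        with p k1 k2 k3 k4 k5 k6 k7 k8 k9
      rw [k9, Pi.add_apply, k8, Pi.add_apply, k7, Pi.add_apply, k6, Pi.smul_apply, k5,
        Pi.smul_apply, k4, k3, k2, k1, Complex.coe_smul, Complex.coe_smul]
      module
    constructor
    · exact fun h' => Lp.ext (h'.trans h.symm)
    · rintro rfl
      exact h
  constructor
  · rintro ⟨us, ut, hz, h⟩
    refine ⟨(p.1, us, ut), hz, rfl, ?_⟩
    have h := (key (p.1, us, ut) _).1 h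
    rw [sub_eq_iff_eq_add] at h
    simp only at h
    rw [h, add_apply, massiveShift_apply, flatShift_apply]
    change _ = _ + (-(_ • (Pplus - Pminus)) : L2Strip →L[ℂ] L2Strip) p.1 - _
    rw [neg_apply, smul_apply, Complex.ofReal_one, one_mul]
    abel
  · rintro ⟨z, hz, h0, h⟩
    refine ⟨z.2.1, z.2.2, ?_, ?_⟩
    · simp only [← h0]
      exact hz
    · have := (key z (p.2 - (-(((Real.pi / (4 * ε) : ℝ) : ℂ) • (Pplus - Pminus)) :
        L2Strip →L[ℂ] L2Strip) p.1)).2 ?_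
      · rw [h0] at this
        exact this
      · rw [eq_sub_iff_add_eq] at h
        rw [← h, add_apply, massiveShift_apply, flatShift_apply, neg_apply, smul_apply,
          Complex.ofReal_one, one_mul, h0]
        abel

/-! ### Convergence of the resolvents -/

/-- The orthogonal complement of the zero mode. -/
def zeroModeCompl : Submodule ℂ L2Strip := LinearMap.ker (mode 0).adjoint.toLinearMap

theorem sub_mode_zero_mem (u : L2Strip) : u - mode 0 ((mode 0).adjoint u) ∈ zeroModeCompl := by
  change (mode 0).adjoint _ = 0
  rw [map_sub, adjoint_mode_mode, if_pos rfl, sub_self]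

/-- The decomposition of `L²` of the strip into the zero mode and its orthogonal complement. -/
def zeroModeSplitting : L2Strip ≃ₗᵢ[ℂ] WithLp 2 (L2Line × zeroModeCompl) where
  toFun u := WithLp.toLp 2 ((mode 0).adjoint u, ⟨_, sub_mode_zero_mem u⟩)
  invFun x := mode 0 x.fst + x.snd
  map_add' u v := by
    refine congrArg (WithLp.toLp 2) (Prod.ext (map_add _ _ _) (Subtype.ext ?_))
    change u + v - mode 0 ((mode 0).adjoint (u + v)) = (u - mode 0 ((mode 0).adjoint u))
      + (v - mode 0 ((mode 0).adjoint v))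
    rw [map_add, map_add]
    abel
  map_smul' c u := by
    refine congrArg (WithLp.toLp 2) (Prod.ext (map_smul _ _ _) (Subtype.ext ?_))
    change c • u - mode 0 ((mode 0).adjoint (c • u)) = c • (u - mode 0 ((mode 0).adjoint u))
    rw [map_smul, map_smul, smul_sub]
  left_inv u := add_sub_cancel _ _
  right_inv x := by
    have h : (mode 0).adjoint (mode 0 x.fst + x.snd) = x.fst := by
      have : (mode 0).adjoint (x.snd : L2Strip) = 0 := x.snd.2
      rw [map_add, this, adjoint_mode_mode, if_pos rfl, add_zero]
    refine (WithLp.ofLp_injective 2) (Prod.ext h (Subtype.ext ?_))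
    change mode 0 x.fst + x.snd - mode 0 ((mode 0).adjoint (mode 0 x.fst + x.snd)) = x.snd
    rw [h, add_sub_cancel_left]
  norm_map' u := by
    refine (sq_eq_sq₀ (norm_nonneg _) (norm_nonneg _)).1 ?_
    rw [WithLp.prod_norm_sq_eq_of_L2]
    change ‖(mode 0).adjoint u‖ ^ 2 + ‖u - mode 0 ((mode 0).adjoint u)‖ ^ 2 = _
    rw [norm_sub_mode_zero_sq]
    ring

theorem norm_withLp_prod_le {E F : Type*} [NormedAddCommGroup E] [NormedAddCommGroup F]
    (x : WithLp 2 (E × F)) : ‖x‖ ≤ ‖x.fst‖ + ‖x.snd‖ := by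
  refine (abs_le_of_sq_le_sq' ?_ (by positivity)).2
  rw [WithLp.prod_norm_sq_eq_of_L2]
  nlinarith [norm_nonneg x.fst, norm_nonneg x.snd]

/-- Since the splitting is an isometry, the norm can be tested on `f`; the hypotheses bound the two
components of the difference. -/
theorem norm_conjugate_sub_sumZero_le {R : L2Strip →L[ℂ] L2Strip} {R₀ : L2Line →L[ℂ] L2Line}
    {a b : ℝ} (hab : 0 ≤ a + b)
    (ha : ∀ f, ‖(mode 0).adjoint (R f) - R₀ ((mode 0).adjoint f)‖ ≤ a * ‖f‖)
    (hb : ∀ f, ‖R f - mode 0 ((mode 0).adjoint (R f))‖ ≤ b * ‖f‖) :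
    ‖conjugate zeroModeSplitting R - sumZero zeroModeCompl R₀‖ ≤ a + b := by
  refine ContinuousLinearMap.opNorm_le_bound _ hab fun x => ?_
  obtain ⟨f, rfl⟩ := zeroModeSplitting.surjective x
  have h1 : conjugate zeroModeSplitting R (zeroModeSplitting f) = zeroModeSplitting (R f) :=
    congrArg (fun g => zeroModeSplitting (R g)) (zeroModeSplitting.symm_apply_apply f)
  rw [sub_apply, h1, zeroModeSplitting.norm_map, add_mul]
  refine (norm_withLp_prod_le _).trans (add_le_add (ha f) ?_)
  have h2 : (zeroModeSplitting (R f) - sumZero zeroModeCompl R₀ (zeroModeSplitting f)).snd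
      = (⟨_, sub_mode_zero_mem (R f)⟩ : zeroModeCompl) := sub_zero _
  rw [h2]
  exact hb f

/-- The lower bound makes `u` a function of `G z` whatever preimage is chosen, and this uniqueness
makes the chosen solution map linear and bounded. -/
theorem exists_resolvent_of_bijective {A : L2Strip →ₗ.[ℂ] L2Strip} {ζ : ℂ}
    {G : L2Strip × L2Strip × L2Strip →L[ℂ] L2Strip}
    (hA : ∀ p, p ∈ A.graph ↔ ∃ z ∈ stripH1, z.1 = p.1 ∧ G z = p.2 - ζ • p.1)
    (hs : ∀ f, ∃ z ∈ stripH1, G z = f) {C : ℝ} (hb : ∀ z ∈ stripH1, ‖z.1‖ ≤ C * ‖G z‖) :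
    ∃ R : L2Strip →L[ℂ] L2Strip, IsResolvent A ζ R ∧ ∀ z ∈ stripH1, R (G z) = z.1 := by
  choose S hS1 hS2 using hs
  have key : ∀ z ∈ stripH1, (S (G z)).1 = z.1 := fun z hz => by
    have := hb _ (stripH1.sub_mem (hS1 (G z)) hz)
    rw [map_sub, hS2, sub_self, norm_zero, mul_zero] at this
    exact sub_eq_zero.1 (norm_le_zero_iff.1 this)
  let L : L2Strip →ₗ[ℂ] L2Strip :=
    { toFun := fun f => (S f).1
      map_add' := fun f g => by
        have := key _ (stripH1.add_mem (hS1 f) (hS1 g))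
        rwa [map_add, hS2, hS2] at this
      map_smul' := fun c f => by
        have := key _ (stripH1.smul_mem c (hS1 f))
        rwa [map_smul, hS2] at this }
  let R := L.mkContinuous C fun f => (hb _ (hS1 f)).trans_eq (by rw [hS2])
  refine ⟨R, isResolvent_of_graph (fun f => ?_) (fun p hp => ?_), key⟩
  · exact (hA _).2 ⟨S f, hS1 f, rfl, by rw [hS2]; exact (add_sub_cancel_right _ _).symm⟩
  · obtain ⟨z, hz, h1, h2⟩ := (hA p).1 hp
    rw [← h2, ← h1]
    exact key z hz

theorem IsResolvent.lineDirac_apply {M : ℝ} {R₀ : L2Line →L[ℂ] L2Line}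
    (h : IsResolvent (lineDirac M) Complex.I R₀) {w : L2Line × L2Line} (hw : w ∈ lineH1) :
    R₀ (lineShift M 1 w) = w.1 := by
  have e : (lineDirac M).graph = lineGraph M :=
    Submodule.toLinearPMap_graph_eq _ (lineGraph_single M)
  have hg : (w.1, lift (-Complex.I • σ₁) w.2 + (M : ℂ) • lift σ₃ w.1) ∈ (lineDirac M).graph := by
    rw [e, mem_lineGraph]
    exact ⟨w.2, hw, rfl⟩
  obtain ⟨x, h1, h2⟩ := (LinearPMap.mem_graph_iff _).1 hg
  simp only at h1 h2
  have := h.2 x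
  rw [h2, h1] at this
  rw [lineShift_eq, Complex.ofReal_one, one_mul, this]

/-- Applying `R₀` to the zero-mode coefficient of `f = (S + T) z` recovers that of `u`, up to `R₀`
of two errors: the mass coupling, at most `2m(1 + m)ε‖f‖`, and the curvature term, at most `4K(2 +
m)ε‖f‖`. The complementary component of `u` is at most `2(1 + m)ε‖f‖`. -/
theorem exists_resolvent_renormalizedDirac {κ : ℝ → ℝ} (hκ : Measurable κ) {K : ℝ} (hK : 0 < K)
    (h1 : ∀ᵐ s, |κ s| ≤ K) (h2 : ∀ᵐ s, |deriv κ s| ≤ K) {m : ℝ} (hm : 0 ≤ m)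
    {R₀ : L2Line →L[ℂ] L2Line} (hR₀ : IsResolvent (lineDirac (2 / Real.pi * m)) Complex.I R₀)
    {ε : ℝ} (hε : 0 < ε) (hε' : ε < 1 / (4 * K * (2 + m))) :
    ∃ R : L2Strip →L[ℂ] L2Strip, IsResolvent (renormalizedDirac κ ε m) Complex.I R ∧
      ‖conjugate zeroModeSplitting R - sumZero zeroModeCompl R₀‖ ≤
        (‖R₀‖ * (4 * K * (2 + m) + 2 * m * (1 + m)) + 2 * (1 + m)) * ε := by
  -- The threshold makes the relative bound `2K(2 + m)ε` of the curvature term at most `1/2`; it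
  -- also implies `εK ≤ 1/2`, which keeps `1 - εtκ` away from zero.
  have hs : ε * (4 * K * (2 + m)) ≤ 1 := ((lt_div_iff₀ (by positivity)).1 hε').le
  obtain ⟨T, hT1, hT2⟩ := exists_curvature_term hκ h1 h2 hε (by
    nlinarith [mul_pos hε hK, mul_nonneg (mul_pos hε hK).le hm])
  set S := massiveShift ε m 1 with hS
  have bu : ∀ z ∈ stripH1, ‖z.1‖ ≤ ‖S z‖ := fun z hz => by
    have := norm_le_massiveShift ε m 1 hz
    rwa [abs_one, one_mul] at this
  have bT : ∀ z ∈ stripH1, ‖T z‖ ≤ 2 * K * (2 + m) * ε * ‖S z‖ := fun z hz => by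
    refine (hT2 z).trans ?_
    have k1 := (norm_longitudinal_le ε 1 hz).trans (norm_flatShift_le ε hm hz)
    have k2 := bu z hz
    have : ‖z.2.1‖ + ‖z.1‖ ≤ (2 + m) * ‖S z‖ := by linarith
    calc 2 * (ε * K) * (‖z.2.1‖ + ‖z.1‖) ≤ 2 * (ε * K) * ((2 + m) * ‖S z‖) := by gcongr
      _ = _ := by ring
  have bT' : ∀ z ∈ stripH1, ‖T z‖ ≤ 1 / 2 * ‖S z‖ := fun z hz =>
    (bT z hz).trans (mul_le_mul_of_nonneg_right (by linarith) (norm_nonneg _))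
  have bS : ∀ z ∈ stripH1, ‖S z‖ ≤ 2 * ‖(S + T) z‖ := fun z hz => by
    have k1 := norm_sub_le ((S + T) z) (T z)
    rw [add_apply, add_sub_cancel_right] at k1
    have k2 := bT' z hz
    rw [add_apply]
    linarith
  have surj : ∀ f, ∃ z ∈ stripH1, (S + T) z = f :=
    surjective_add_of_relatively_small stripH1 S T
      (fun z hz h => massiveShift_injective ε m one_ne_zero hz h)
      (massiveShift_surjective hε hm) (by norm_num) (by norm_num) bT'
  obtain ⟨R, hR1, hR2⟩ := exists_resolvent_of_bijective (mem_renormalizedDirac_graph hT1) surj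
    (C := 2) fun z hz => (bu z hz).trans (bS z hz)
  have bp : ∀ z ∈ stripH1, ‖z.1 - mode 0 ((mode 0).adjoint z.1)‖ ≤
      2 * (1 + m) * ε * ‖(S + T) z‖ := fun z hz => by
    refine (norm_sub_mode_zero_le hε 1 hz).trans ?_
    calc ε * ‖flatShift ε 1 z‖ ≤ ε * ((1 + m) * (2 * ‖(S + T) z‖)) := by
          gcongr
          exact (norm_flatShift_le ε hm hz).trans (by gcongr; exact bS z hz)
      _ = _ := by ring
  refine ⟨R, hR1, ?_⟩
  rw [add_mul]
  refine norm_conjugate_sub_sumZero_le (by positivity) (fun f => ?_) (fun f => ?_)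
  · obtain ⟨z, hz, rfl⟩ := surj f
    rw [hR2 z hz]
    have e : (mode 0).adjoint ((S + T) z) =
        lineShift (2 / Real.pi * m) 1 ((mode 0).adjoint z.1, (mode 0).adjoint z.2.1)
        + ((m : ℂ) • (mode 0).adjoint (lift σ₃ (z.1 - mode 0 ((mode 0).adjoint z.1)))
        + (mode 0).adjoint (T z)) := by
      rw [add_apply, map_add, hS, adjoint_mode_zero_massiveShift ε m hz, add_assoc]
    rw [e, map_add, hR₀.lineDirac_apply (adjoint_mode_mem_lineH1 hz 0), sub_add_cancel_left,
      norm_neg]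
    refine (R₀.le_opNorm _).trans ?_
    rw [mul_assoc, mul_assoc]
    refine mul_le_mul_of_nonneg_left ((norm_add_le _ _).trans ?_) (norm_nonneg _)
    have k1 : ‖(m : ℂ) • (mode 0).adjoint (lift σ₃ (z.1 - mode 0 ((mode 0).adjoint z.1)))‖
        ≤ m * (2 * (1 + m) * ε * ‖(S + T) z‖) := by
      rw [norm_smul, Complex.norm_real, Real.norm_eq_abs, abs_of_nonneg hm]
      refine mul_le_mul_of_nonneg_left ((norm_adjoint_mode_le 0 _).trans ?_) hm
      rw [norm_lift_σ₃]
      exact bp z hz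
    have k2 : ‖(mode 0).adjoint (T z)‖ ≤ 2 * K * (2 + m) * ε * (2 * ‖(S + T) z‖) :=
      (norm_adjoint_mode_le 0 _).trans ((bT z hz).trans (by gcongr; exact bS z hz))
    refine (add_le_add k1 k2).trans_eq ?_
    ring
  · obtain ⟨z, hz, rfl⟩ := surj f
    rw [hR2 z hz]
    exact bp z hz

end ThinGuide

end

theorem theorem3 (γ : ℝ → EuclideanSpace ℝ (Fin 2)) (hγ : ThinGuide.IsBaseCurve γ)
    (hadm : ∃ ε₁ > 0, ∀ ε : ℝ, 0 < ε → ε < ε₁ → ThinGuide.IsAdmissibleWidth γ ε)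
    (m : ℝ) (hm : 0 ≤ m) :
    ∃ (F : Submodule ℂ ThinGuide.L2Strip)
      (V : ThinGuide.L2Strip ≃ₗᵢ[ℂ] WithLp 2 (ThinGuide.L2Line × F))
      (R₀ : ThinGuide.L2Line →L[ℂ] ThinGuide.L2Line),
      IsClosed (F : Set ThinGuide.L2Strip) ∧
      ThinGuide.IsResolvent (ThinGuide.lineDirac (2 / Real.pi * m)) Complex.I R₀ ∧
      ∃ C : ℝ, ∃ ε₀ > 0, ∀ ε : ℝ, 0 < ε → ε < ε₀ →
        ∃ R : ThinGuide.L2Strip →L[ℂ] ThinGuide.L2Strip,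
          ThinGuide.IsResolvent
            (ThinGuide.renormalizedDirac (ThinGuide.curvature γ) ε m) Complex.I R ∧
          ‖ThinGuide.conjugate V R - ThinGuide.sumZero F R₀‖ ≤ C * ε := by
  obtain ⟨R₀, hR₀⟩ := ThinGuide.exists_resolvent_lineDirac (2 / Real.pi * m)
  obtain ⟨ε₁, hε₁, hw⟩ := hadm
  -- A single admissible width, here `ε₁/2`, is enough to bound the curvature.
  obtain ⟨K, hK, h1, h2⟩ := hγ.exists_curvature_bound (hw (ε₁ / 2) (by linarith) (by linarith))
  exact ⟨ThinGuide.zeroModeCompl, ThinGuide.zeroModeSplitting, R₀,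
    ContinuousLinearMap.isClosed_ker (ThinGuide.mode 0).adjoint, hR₀, _, 1 / (4 * K * (2 + m)),
    by positivity, fun ε k1 k2 => ThinGuide.exists_resolvent_renormalizedDirac
      hγ.measurable_curvature hK h1 h2 hm hR₀ k1 k2⟩
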